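/- Let $N\ge 0$ and let $t,t_N$ be independent indeterminates (``Case A''). Let $S_N^C$ be the Coxeter group of type $B_N=C_N$ with simple reflections $s_1,\dots,s_N$ (with $(s_{N-1}s_N)^4=1$), and let $\mathcal H$ be its Hecke algebra over $\mathbb C[t^{\pm1},t_N^{\pm1}]$, with generators $T_1,\dots,T_N$ satisfying the braid relations, $(T_i-t)(T_i+t^{-1})=0$ for $i<N$ and $(T_N-t_N)(T_N+t_N^{-1})=0$. The bar involution is the $\mathbb C$-linear ring automorphism with $T_i\mapsto T_i^{-1}$, $t\mapsto t^{-1}$, $t_N\mapsto t_N^{-1}$. For a binary string $\alpha\in\{1,2\}^N$ whose letters $2$ are at positions $p_1<\dots<p_r$, let $w(\alpha)=(s_{p_r}\cdots s_N)\cdots(s_{p_1}\cdots s_N)$, the minimal representative of a coset in $S_N^C/S_N$; write $\alpha\le\beta$ if $w(\alpha)\le w(\beta)$ in the Bruhat order. Let $l_N(\alpha)$, $l'(\alpha)$ be the numbers of factors of this word which are equal to $s_N$, respectively different from $s_N$, and put $\mathbf t^{|\alpha|-|\beta|}=t^{\,l'(\alpha)-l'(\beta)}\,t_N^{\,l_N(\alpha)-l_N(\beta)}$.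 Let $\mathcal M^-$ be the $\mathcal H$-module with basis $m_\alpha$, $\alpha\in\{1,2\}^N$, where for $i<N$: $T_im_\alpha=-t^{-1}m_\alpha$ if $\alpha_i=\alpha_{i+1}$, $T_im_\alpha=m_{s_i\alpha}$ if $\alpha_i<\alpha_{i+1}$, and $T_im_\alpha=m_{s_i\alpha}+(t-t^{-1})m_\alpha$ if $\alpha_i>\alpha_{i+1}$; and $T_Nm_\alpha=m_{s_N\alpha}$ if $\alpha_N=1$, $T_Nm_\alpha=m_{s_N\alpha}+(t_N-t_N^{-1})m_\alpha$ if $\alpha_N=2$. Here $s_i$ ($i<N$) exchanges the letters $i,i+1$ and $s_N$ changes the last letter. The module carries the bar involution compatible with that of $\mathcal H$ and fixing $m_{1\cdots1}$. Let $\Gamma_-=\{t^it_N^j: i<0,\text{ or } i=0 \text{ and } j<0\}$. The parabolic Kazhdan--Lusztig polynomials $P^{A,-}_{\alpha,\beta}$ are determined by the existence of a basis $(C_\beta)$ of $\mathcal M^-$ of bar-invariant elements with $$C_\beta=\sum_{\alpha\le\beta}\mathbf t^{|\alpha|-|\beta|}P^{A,-}_{\alpha,\beta}\,m_\alpha,\qquad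 P^{A,-}_{\beta,\beta}=1,\qquad \mathbf t^{|\alpha|-|\beta|}P^{A,-}_{\alpha,\beta}\in\mathbb Z\Gamma_-\ (\alpha<\beta),$$ and $P^{A,-}_{\alpha,\beta}=0$ if $\alpha\not\le\beta$. View $\alpha$ as a path from $(0,0)$ with step $(1,-1)$ for each letter $1$ and $(1,1)$ for each letter $2$. Boxes are the unit squares rotated by 45 degrees and are named by their centres. Let $\lambda(\alpha)$ be the set of boxes $(i,j)$ below the path with $0<i\le N$, $|j|\le i$, $i+j$ odd. A ballot strip of length $(l,l')\in\mathbb N^2$ is the set of boxes centred at the vertices of a path with steps $(1,\pm1)$ from some $(x,y)$ to $(x+2l+l',y+l')$ which stays weakly above height $y$; if $l'\ge1$, its rightmost box is required to have abscissa $N$. For $\alpha\le\beta$ set $$Q^{A,II,-}_{\alpha,\beta}=\sum_{\mathcal C}\prod_{\mathcal D\in\mathcal C}\mathrm{wt}(\mathcal D),\qquad \mathrm{wt}(\mathcal D)=\begin{cases}t^{2l+l'}&l'\text{ even},\\ t^{2l+l'-1}t_N^2&l'\text{ odd},\end{cases}$$ where $\mathcal C$ runs over the partitions of $\lambda(\beta)\setminus\lambda(\alpha)$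 into such ballot strips which satisfy Rule II: for distinct strips $\mathcal D,\mathcal D'$ of $\mathcal C$, if some box of $\mathcal D'$ is just above ($(x,y+2)$), north-west ($(x-1,y+1)$) or north-east ($(x+1,y+1)$) of a box $(x,y)$ of $\mathcal D$, then all boxes just above, north-west and north-east of boxes of $\mathcal D$, at positions with abscissa at most $N$, belong to $\mathcal D$ or $\mathcal D'$. Put $Q^{A,II,-}_{\alpha,\beta}=0$ if $\alpha\not\le\beta$. In a string $\beta$, repeatedly pair and remove adjacent letters $2,1$ (in this order) until a string $1\cdots12\cdots2$ of unpaired letters remains. An unpaired $2$ is o-unpaired (resp. e-unpaired) if it is the $k$-th unpaired $2$ from the right with $k$ odd (resp. even). Let $F^A(\beta)$ be the set of $\alpha\le\beta$ obtained from $\beta$ by flipping some of the pairs (exchanging their $2$ and $1$) and some of the unpaired $2$'s (changing them to $1$), and let $d^A(\alpha,\beta)$, $d^A_e(\alpha,\beta)$, $d^A_o(\alpha,\beta)$ be the numbers of flipped pairs, flipped e-unpaired $2$'s and flipped o-unpaired $2$'s. \textbf{Corollary.} The family $P^{A,-}$ exists and is unique, and for all $\alpha,\beta\in\{1,2\}^N$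 $$\mathbf t^{|\alpha|-|\beta|}Q^{A,II,-}_{\alpha,\beta}=\mathbf t^{|\alpha|-|\beta|}P^{A,-}_{\alpha,\beta};$$ if $\alpha\in F^A(\beta)$, this is equal to $$t^{-d^A(\alpha,\beta)}\,t_N^{-d^A_o(\alpha,\beta)}\,(t/t_N)^{-d^A_e(\alpha,\beta)}.$$ -/

import Mathlib

open scoped Classical

noncomputable section

namespace KLB

/-! ## The coefficient ring `ℂ[t^{±1}, t_N^{±1}]` (independent parameters) -/

/-- Laurent polynomials over `ℂ` in two independent variables `t`, `t_N`; the exponent `(i, j)`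
stands for the monomial `t ^ i * t_N ^ j`. -/
abbrev Coeff : Type := AddMonoidAlgebra ℂ (ℤ × ℤ)

/-- The monomial `t ^ i * t_N ^ j`. -/
def mon (i j : ℤ) : Coeff := AddMonoidAlgebra.single (i, j) 1

/-- The `ℂ`-linear ring involution `t ↦ t⁻¹`, `t_N ↦ t_N⁻¹`. -/
def barCoeff : Coeff →+* Coeff :=
  AddMonoidAlgebra.mapDomainRingHom ℂ (negAddMonoidHom : (ℤ × ℤ) →+ (ℤ × ℤ))

/-- The exponents of the negative monomials `Γ₋` for the lexicographic order of the group of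
monomials: `t ^ i * t_N ^ j` with `i < 0`, or with `i = 0` and `j < 0`. -/
def GammaNeg : Set (ℤ × ℤ) := {g | g.1 < 0 ∨ (g.1 = 0 ∧ g.2 < 0)}

/-- The integral linear combinations of negative monomials. -/
def ZGammaNeg : Set Coeff :=
  {f | ∀ g : ℤ × ℤ, (∃ n : ℤ, f.coeff g = (n : ℂ)) ∧ (f.coeff g ≠ 0 → g ∈ GammaNeg)}

lemma mon_mul (i j k l : ℤ) : mon i j * mon k l = mon (i + k) (j + l) := by
  simp [mon, AddMonoidAlgebra.single_mul_single]

lemma mon_zero : mon 0 0 = 1 := rfl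

lemma barCoeff_mon (i j : ℤ) : barCoeff (mon i j) = mon (-i) (-j) := by
  simp [barCoeff, mon, AddMonoidAlgebra.mapDomain_single]

/-! ## The Hecke algebra of type `B_N` and its bar involution

The generators `T_1, …, T_N` are indexed by `Fin N`; the last index carries the parameter `t_N`,
all the others carry `t`. -/

variable {N : ℕ}

/-- The Hecke parameter of the `i`-th generator: `t`, or `t_N` for the last generator. -/
def par (i : Fin N) : Coeff := if i.val + 1 < N then mon 1 0 else mon 0 1

/-- The inverse of the Hecke parameter. -/
def parInv (i : Fin N) : Coeff := if i.val + 1 < N then mon (-1) 0 else mon 0 (-1)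

lemma par_mul_parInv (i : Fin N) : par i * parInv i = 1 := by
  unfold par parInv
  split_ifs <;> simp [mon_mul, mon_zero]

lemma barCoeff_par (i : Fin N) : barCoeff (par i) = parInv i := by
  unfold par parInv
  split_ifs <;> simp [barCoeff_mon]

lemma barCoeff_parInv (i : Fin N) : barCoeff (parInv i) = par i := by
  unfold par parInv
  split_ifs <;> simp [barCoeff_mon]

/-- The defining relations of the Hecke algebra. -/
inductive HeckeRel (N : ℕ) : FreeAlgebra Coeff (Fin N) → FreeAlgebra Coeff (Fin N) → Prop
  | quad (i : Fin N) : HeckeRel N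
      ((FreeAlgebra.ι Coeff i - algebraMap Coeff _ (par i)) *
        (FreeAlgebra.ι Coeff i + algebraMap Coeff _ (parInv i))) 0
  | braid3 (i j : Fin N) (hij : i.val + 1 = j.val) (hj : j.val + 1 < N) : HeckeRel N
      (FreeAlgebra.ι Coeff i * FreeAlgebra.ι Coeff j * FreeAlgebra.ι Coeff i)
      (FreeAlgebra.ι Coeff j * FreeAlgebra.ι Coeff i * FreeAlgebra.ι Coeff j)
  | braid4 (i j : Fin N) (hij : i.val + 1 = j.val) (hj : j.val + 1 = N) : HeckeRel N
      (FreeAlgebra.ι Coeff i * FreeAlgebra.ι Coeff j * FreeAlgebra.ι Coeff i *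
        FreeAlgebra.ι Coeff j)
      (FreeAlgebra.ι Coeff j * FreeAlgebra.ι Coeff i * FreeAlgebra.ι Coeff j *
        FreeAlgebra.ι Coeff i)
  | comm (i j : Fin N) (hij : i.val + 1 < j.val) : HeckeRel N
      (FreeAlgebra.ι Coeff i * FreeAlgebra.ι Coeff j)
      (FreeAlgebra.ι Coeff j * FreeAlgebra.ι Coeff i)

/-- The Iwahori--Hecke algebra of type `B_N` over `ℂ[t^{±1}, t_N^{±1}]`. -/
def Hecke (N : ℕ) : Type := RingQuot (HeckeRel N)

instance instRingHecke (N : ℕ) : Ring (Hecke N) := inferInstanceAs (Ring (RingQuot (HeckeRel N)))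

instance instAlgebraHecke (N : ℕ) : Algebra Coeff (Hecke N) :=
  inferInstanceAs (Algebra Coeff (RingQuot (HeckeRel N)))

/-- The quotient map from the free algebra to the Hecke algebra. -/
def mkHecke (N : ℕ) : FreeAlgebra Coeff (Fin N) →ₐ[Coeff] Hecke N :=
  RingQuot.mkAlgHom Coeff (HeckeRel N)

lemma mkHecke_rel {x y : FreeAlgebra Coeff (Fin N)} (h : HeckeRel N x y) :
    mkHecke N x = mkHecke N y :=
  RingQuot.mkAlgHom_rel Coeff h

/-- The generator `T_i`. -/
def T (i : Fin N) : Hecke N := mkHecke N (FreeAlgebra.ι Coeff i)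

lemma T_quad (i : Fin N) :
    (T i - algebraMap Coeff (Hecke N) (par i)) * (T i + algebraMap Coeff (Hecke N) (parInv i))
      = 0 := by
  simpa [T] using mkHecke_rel (HeckeRel.quad i)

lemma T_braid3 (i j : Fin N) (hij : i.val + 1 = j.val) (hj : j.val + 1 < N) :
    T i * T j * T i = T j * T i * T j := by
  simpa [T] using mkHecke_rel (HeckeRel.braid3 i j hij hj)

lemma T_braid4 (i j : Fin N) (hij : i.val + 1 = j.val) (hj : j.val + 1 = N) :
    T i * T j * T i * T j = T j * T i * T j * T i := by
  simpa [T] using mkHecke_rel (HeckeRel.braid4 i j hij hj)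

lemma T_comm (i j : Fin N) (hij : i.val + 1 < j.val) : T i * T j = T j * T i := by
  simpa [T] using mkHecke_rel (HeckeRel.comm i j hij)

/-- The element `T_i - (p - p⁻¹)`, where `p` is the parameter of `T_i`; it is the inverse
of `T_i`. -/
def TInv (i : Fin N) : Hecke N :=
  T i - algebraMap Coeff (Hecke N) (par i) + algebraMap Coeff (Hecke N) (parInv i)

lemma T_sq (i : Fin N) :
    T i * T i = algebraMap Coeff (Hecke N) (par i) * T i
      - algebraMap Coeff (Hecke N) (parInv i) * T i + 1 := by
  have h := T_quad i
  have h1 : algebraMap Coeff (Hecke N) (par i) * algebraMap Coeff (Hecke N) (parInv i) = 1 := by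
    rw [← map_mul, par_mul_parInv, map_one]
  have h2 := Algebra.commutes (parInv i) (T i)
  rw [sub_mul, mul_add, mul_add, h1, ← h2] at h
  have := sub_eq_zero.mp h
  rw [eq_sub_of_add_eq this]
  abel

lemma T_mul_TInv (i : Fin N) : T i * TInv i = 1 := by
  rw [TInv, mul_add, mul_sub, T_sq, ← Algebra.commutes (par i) (T i),
    ← Algebra.commutes (parInv i) (T i)]
  abel

lemma TInv_mul_T (i : Fin N) : TInv i * T i = 1 := by
  rw [TInv, add_mul, sub_mul, T_sq]
  abel

/-- `T_i` as a unit of the Hecke algebra. -/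
def TUnit (i : Fin N) : (Hecke N)ˣ := ⟨T i, TInv i, T_mul_TInv i, TInv_mul_T i⟩

/-- The bar involution on the free algebra, with values in the Hecke algebra: it sends the `i`-th
generator to `T_i⁻¹` and acts on the coefficients through `barCoeff`. -/
def barFree (N : ℕ) : FreeAlgebra Coeff (Fin N) →+* Hecke N :=
  letI : Algebra Coeff (Hecke N) :=
    ((algebraMap Coeff (Hecke N)).comp barCoeff).toAlgebra'
      (fun c x => Algebra.commutes (barCoeff c) x)
  (FreeAlgebra.lift Coeff (fun i : Fin N => TInv i)).toRingHom

lemma barFree_ι (i : Fin N) : barFree N (FreeAlgebra.ι Coeff i) = TInv i := by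
  exact @FreeAlgebra.lift_ι_apply Coeff _ _ _ _
    (((algebraMap Coeff (Hecke N)).comp barCoeff).toAlgebra'
      (fun c x => Algebra.commutes (barCoeff c) x)) (fun i : Fin N => TInv i) i

lemma barFree_algebraMap (c : Coeff) :
    barFree N (algebraMap Coeff _ c) = algebraMap Coeff (Hecke N) (barCoeff c) :=
  @AlgHom.commutes Coeff _ _ _ _ _ _
    (((algebraMap Coeff (Hecke N)).comp barCoeff).toAlgebra'
      (fun c x => Algebra.commutes (barCoeff c) x))
    (@FreeAlgebra.lift Coeff _ _ _ _ (((algebraMap Coeff (Hecke N)).comp barCoeff).toAlgebra'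
      (fun c x => Algebra.commutes (barCoeff c) x)) (fun i : Fin N => TInv i)) c

lemma barFree_rel ⦃x y : FreeAlgebra Coeff (Fin N)⦄ (h : HeckeRel N x y) :
    barFree N x = barFree N y := by
  have key : ∀ i : Fin N, TInv i = ((TUnit i)⁻¹ : (Hecke N)ˣ) := fun _ => rfl
  cases h with
  | quad i =>
    rw [map_mul, map_sub, map_add, map_zero, barFree_ι, barFree_algebraMap, barFree_algebraMap,
      barCoeff_par, barCoeff_parInv, TInv]
    have h := T_quad i
    have e1 : T i - algebraMap Coeff (Hecke N) (par i) + algebraMap Coeff (Hecke N) (parInv i)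
        - algebraMap Coeff (Hecke N) (parInv i) = T i - algebraMap Coeff (Hecke N) (par i) := by
      abel
    have e2 : T i - algebraMap Coeff (Hecke N) (par i) + algebraMap Coeff (Hecke N) (parInv i)
        + algebraMap Coeff (Hecke N) (par i) = T i + algebraMap Coeff (Hecke N) (parInv i) := by
      abel
    rw [e1, e2, h]
  | braid3 i j hij hj =>
    have h : TUnit i * TUnit j * TUnit i = TUnit j * TUnit i * TUnit j :=
      Units.ext (T_braid3 i j hij hj)
    simp only [map_mul, barFree_ι, key, ← Units.val_mul]
    congr 1
    simpa [mul_assoc] using congrArg (·⁻¹) h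
  | braid4 i j hij hj =>
    have h : TUnit i * TUnit j * TUnit i * TUnit j = TUnit j * TUnit i * TUnit j * TUnit i :=
      Units.ext (T_braid4 i j hij hj)
    simp only [map_mul, barFree_ι, key, ← Units.val_mul]
    congr 1
    simpa [mul_assoc] using (congrArg (·⁻¹) h).symm
  | comm i j hij =>
    have h : TUnit i * TUnit j = TUnit j * TUnit i := Units.ext (T_comm i j hij)
    simp only [map_mul, barFree_ι, key, ← Units.val_mul]
    congr 1
    simpa [mul_assoc] using (congrArg (·⁻¹) h).symm

/-- The bar involution of the Hecke algebra: the ring homomorphism with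
`T_i ↦ T_i⁻¹`, `t ↦ t⁻¹`, `t_N ↦ t_N⁻¹`. -/
def barHecke (N : ℕ) : Hecke N →+* Hecke N :=
  RingQuot.lift ⟨barFree N, fun _ _ h => barFree_rel h⟩

lemma barHecke_mkHecke (x : FreeAlgebra Coeff (Fin N)) :
    barHecke N (mkHecke N x) = barFree N x := by
  have h := RingQuot.lift_mkRingHom_apply (barFree N) (fun _ _ h => barFree_rel h) x
  rw [← RingQuot.mkAlgHom_coe Coeff] at h
  exact h

lemma barHecke_T (i : Fin N) : barHecke N (T i) = TInv i := by
  rw [T, barHecke_mkHecke, barFree_ι]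

lemma barHecke_algebraMap (c : Coeff) :
    barHecke N (algebraMap Coeff (Hecke N) c) = algebraMap Coeff (Hecke N) (barCoeff c) := by
  rw [← (mkHecke N).commutes c, barHecke_mkHecke, barFree_algebraMap]

/-! ## Binary strings and the module `M⁻` -/

/-- Binary strings of length `N`: `false` is the letter `1`, `true` is the letter `2`. -/
abbrev BString (N : ℕ) : Type := Fin N → Bool

/-- The action of the `i`-th simple reflection on strings: it exchanges the letters `i` and
`i + 1`, and for the last index it changes the last letter. -/
def sAct (i : Fin N) (α : BString N) : BString N :=
  if h : i.val + 1 < N then α ∘ Equiv.swap i ⟨i.val + 1, h⟩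
  else Function.update α i (!(α i))

/-- The module `M⁻`, free on the strings. -/
abbrev Mod (N : ℕ) : Type := BString N →₀ Coeff

/-- The standard basis vector `m_α`. -/
def m (α : BString N) : Mod N := Finsupp.single α 1

/-- The vector `T_i m_α` of `M⁻`. -/
def TVec (i : Fin N) (α : BString N) : Mod N :=
  if h : i.val + 1 < N then
    if α i = α ⟨i.val + 1, h⟩ then -(mon (-1) 0 • m α)
    else if α i = false then m (sAct i α)
    else m (sAct i α) + (mon 1 0 - mon (-1) 0) • m α
  else
    if α i = false then m (sAct i α)
    else m (sAct i α) + (mon 0 1 - mon 0 (-1)) • m α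

/-- The operator `T_i` on `M⁻`. -/
def TOp (i : Fin N) : Module.End Coeff (Mod N) := Finsupp.linearCombination Coeff (TVec i)

lemma TOp_m (i : Fin N) (α : BString N) : TOp i (m α) = TVec i α := by
  simp [TOp, m]

lemma TOp_rule (i j : Fin N) (hij : i.val + 1 = j.val) (α : BString N) :
    TOp i (m α) = if α i = α j then -(mon (-1) 0 • m α)
      else if α i = false then m (α ∘ Equiv.swap i j)
      else m (α ∘ Equiv.swap i j) + (mon 1 0 - mon (-1) 0) • m α := by
  have h : i.val + 1 < N := hij ▸ j.isLt
  have e : (⟨i.val + 1, h⟩ : Fin N) = j := Fin.ext hij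
  rw [TOp_m, TVec, dif_pos h, sAct, dif_pos h, e]

lemma TOp_last (j : Fin N) (hj : j.val + 1 = N) (α : BString N) :
    TOp j (m α) = if α j = false then m (Function.update α j true)
      else m (Function.update α j false) + (mon 0 1 - mon 0 (-1)) • m α := by
  have h : ¬ j.val + 1 < N := by omega
  rw [TOp_m, TVec, dif_neg h, sAct, dif_neg h]
  cases hb : α j <;> simp

lemma Mod_hom_ext {f g : Module.End Coeff (Mod N)} (h : ∀ α, f (m α) = g (m α)) : f = g := by
  ext1 α
  ext1
  exact h α

lemma TOp_adj (i j : Fin N) (hij : i.val + 1 = j.val) (u : Bool → Bool → BString N)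
    (hi : ∀ a b, u a b i = a) (hj : ∀ a b, u a b j = b)
    (hu : ∀ a b a' b' k, k ≠ i → k ≠ j → u a b k = u a' b' k) (a b : Bool) :
    TOp i (m (u a b)) = if a = b then -(mon (-1) 0 • m (u a b))
      else if a = false then m (u b a)
      else m (u b a) + (mon 1 0 - mon (-1) 0) • m (u a b) := by
  have hne : i ≠ j := fun h => by subst h; omega
  have h : u a b ∘ Equiv.swap i j = u b a := by
    funext k
    by_cases h1 : k = i
    · subst h1; simp [hi, hj]
    · by_cases h2 : k = j
      · subst h2; simp [hi, hj]
      · simp [Equiv.swap_apply_of_ne_of_ne h1 h2, hu a b b a k h1 h2]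
  rw [TOp_rule i j hij, hi, hj, h]

lemma TOp_end (j : Fin N) (hj : j.val + 1 = N) (u : Bool → BString N)
    (hjj : ∀ a, u a j = a) (hu : ∀ a a' k, k ≠ j → u a k = u a' k) (a : Bool) :
    TOp j (m (u a)) = if a = false then m (u true)
      else m (u false) + (mon 0 1 - mon 0 (-1)) • m (u a) := by
  have h : ∀ b, Function.update (u a) j b = u b := by
    intro b
    funext k
    by_cases h1 : k = j
    · subst h1; simp [hjj]
    · simp [h1, hu a b k h1]
  rw [TOp_last j hj, hjj, h, h]

lemma exists_upd (α : BString N) (i j k l : Fin N) (hij : i ≠ j) (hik : i ≠ k) (hil : i ≠ l)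
    (hjk : j ≠ k) (hjl : j ≠ l) (hkl : k ≠ l) :
    ∃ u : Bool → Bool → Bool → Bool → BString N,
      (∀ a b c d, u a b c d i = a) ∧ (∀ a b c d, u a b c d j = b) ∧
      (∀ a b c d, u a b c d k = c) ∧ (∀ a b c d, u a b c d l = d) ∧
      (∀ a b c d n, n ≠ i → n ≠ j → n ≠ k → n ≠ l → u a b c d n = α n) ∧
      α = u (α i) (α j) (α k) (α l) := by
  refine ⟨fun a b c d n => if n = i then a else if n = j then b else if n = k then c
    else if n = l then d else α n, ?_, ?_, ?_, ?_, ?_, ?_⟩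
  · simp
  · simp [hij.symm]
  · simp [hik.symm, hjk.symm]
  · simp [hil.symm, hjl.symm, hkl.symm]
  · intro a b c d n h1 h2 h3 h4; simp [h1, h2, h3, h4]
  · funext n
    dsimp only
    split_ifs <;> simp_all

lemma exists_upd3 (α : BString N) (i j k : Fin N) (hij : i ≠ j) (hik : i ≠ k) (hjk : j ≠ k) :
    ∃ u : Bool → Bool → Bool → BString N,
      (∀ a b c, u a b c i = a) ∧ (∀ a b c, u a b c j = b) ∧ (∀ a b c, u a b c k = c) ∧
      (∀ a b c n, n ≠ i → n ≠ j → n ≠ k → u a b c n = α n) ∧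
      α = u (α i) (α j) (α k) := by
  refine ⟨fun a b c n => if n = i then a else if n = j then b else if n = k then c
    else α n, ?_, ?_, ?_, ?_, ?_⟩
  · simp
  · simp [hij.symm]
  · simp [hik.symm, hjk.symm]
  · intro a b c n h1 h2 h3; simp [h1, h2, h3]
  · funext n
    dsimp only
    split_ifs <;> simp_all

lemma exists_upd2 (α : BString N) (i j : Fin N) (hij : i ≠ j) :
    ∃ u : Bool → Bool → BString N,
      (∀ a b, u a b i = a) ∧ (∀ a b, u a b j = b) ∧
      (∀ a b n, n ≠ i → n ≠ j → u a b n = α n) ∧ α = u (α i) (α j) := by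
  refine ⟨fun a b n => if n = i then a else if n = j then b else α n, ?_, ?_, ?_, ?_⟩
  · simp
  · simp [hij.symm]
  · intro a b n h1 h2; simp [h1, h2]
  · funext n
    dsimp only
    split_ifs <;> simp_all

lemma TOp_quad (i : Fin N) :
    (TOp i - algebraMap Coeff (Module.End Coeff (Mod N)) (par i)) *
      (TOp i + algebraMap Coeff (Module.End Coeff (Mod N)) (parInv i)) = 0 := by
  refine Mod_hom_ext fun α => ?_
  have hA : mon 1 0 * mon (-1) 0 = 1 := by simp [mon_mul, mon_zero]
  have hB : mon 0 1 * mon 0 (-1) = 1 := by simp [mon_mul, mon_zero]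
  simp only [Module.End.mul_apply, LinearMap.sub_apply, LinearMap.add_apply,
    Module.algebraMap_end_apply, map_add, map_smul, LinearMap.zero_apply]
  by_cases h : i.val + 1 < N
  · have hp : par i = mon 1 0 := if_pos h
    have hq : parInv i = mon (-1) 0 := if_pos h
    rw [hp, hq]
    obtain ⟨j, hij⟩ : ∃ j : Fin N, i.val + 1 = j.val := ⟨⟨i.val + 1, h⟩, rfl⟩
    obtain ⟨u, h1, h2, h3, e⟩ := exists_upd2 α i j (fun h => by subst h; omega)
    have key := TOp_adj i j hij u h1 h2 (fun a b a' b' n hi hj => by rw [h3 _ _ n hi hj, h3 _ _ n hi hj])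
    rw [e]
    generalize α i = a
    generalize α j = b
    generalize mon 1 0 = p at *
    generalize mon (-1) 0 = q at *
    cases a <;> cases b <;>
      simp only [key, map_neg, map_add, map_smul, smul_neg, reduceIte, reduceCtorEq] <;>
      match_scalars <;> first | ring1 | linear_combination hA | linear_combination -hA
  · have hp : par i = mon 0 1 := if_neg h
    have hq : parInv i = mon 0 (-1) := if_neg h
    rw [hp, hq]
    have key := TOp_end i (by omega) (fun a => Function.update α i a)
      (by simp) (by intro a a' k h1; simp [h1])
    have e : α = (fun a => Function.update α i a) (α i) := by simp
    generalize hu : (fun a => Function.update α i a) = u at e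
    have key' : ∀ a, _ := key
    simp only [congrFun hu _] at key'
    rw [e]
    clear key
    generalize α i = a
    generalize mon 0 1 = p at *
    generalize mon 0 (-1) = q at *
    cases a <;>
      simp only [key', map_add, map_smul, reduceIte, reduceCtorEq] <;>
      match_scalars <;> first | ring1 | linear_combination hB | linear_combination -hB

lemma TOp_braid3 (i j : Fin N) (hij : i.val + 1 = j.val) (hj : j.val + 1 < N) :
    TOp i * TOp j * TOp i = TOp j * TOp i * TOp j := by
  refine Mod_hom_ext fun α => ?_
  have hA : mon 1 0 * mon (-1) 0 = 1 := by simp [mon_mul, mon_zero]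
  simp only [Module.End.mul_apply]
  obtain ⟨k, hjk⟩ : ∃ k : Fin N, j.val + 1 = k.val := ⟨⟨j.val + 1, hj⟩, rfl⟩
  obtain ⟨u, h1, h2, h3, h4, e⟩ := exists_upd3 α i j k (fun h => by subst h; omega)
    (fun h => by subst h; omega) (fun h => by subst h; omega)
  have key1 : ∀ c a b, _ := fun c => TOp_adj i j hij (fun a b => u a b c) (fun a b => h1 a b c)
    (fun a b => h2 a b c) (fun a b a' b' n hi hj => by
      by_cases hk : n = k
      · subst hk; rw [h3, h3]
      · rw [h4 _ _ _ n hi hj hk, h4 _ _ _ n hi hj hk])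
  have key2 : ∀ a b c, _ := fun a => TOp_adj j k hjk (fun b c => u a b c) (fun b c => h2 a b c)
    (fun b c => h3 a b c) (fun b c b' c' n hj hk => by
      by_cases hi : n = i
      · subst hi; rw [h1, h1]
      · rw [h4 _ _ _ n hi hj hk, h4 _ _ _ n hi hj hk])
  rw [e]
  generalize α i = a
  generalize α j = b
  generalize α k = c
  generalize mon 1 0 = p at *
  generalize mon (-1) 0 = q at *
  cases a <;> cases b <;> cases c <;>
    simp only [key1, key2, map_neg, map_add, map_smul, smul_neg, reduceIte, reduceCtorEq,
      neg_neg] <;>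
    match_scalars <;>
    first | ring1 | linear_combination (q - p) * hA | linear_combination (p - q) * hA

lemma TOp_braid4 (i j : Fin N) (hij : i.val + 1 = j.val) (hj : j.val + 1 = N) :
    TOp i * TOp j * TOp i * TOp j = TOp j * TOp i * TOp j * TOp i := by
  refine Mod_hom_ext fun α => ?_
  have hA : mon 1 0 * mon (-1) 0 = 1 := by simp [mon_mul, mon_zero]
  have hB : mon 0 1 * mon 0 (-1) = 1 := by simp [mon_mul, mon_zero]
  simp only [Module.End.mul_apply]
  obtain ⟨u, h1, h2, h3, e⟩ := exists_upd2 α i j (fun h => by subst h; omega)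
  have key1 := TOp_adj i j hij u h1 h2
    (fun a b a' b' n hi hj => by rw [h3 _ _ n hi hj, h3 _ _ n hi hj])
  have key2 : ∀ a b, _ := fun a => TOp_end j hj (fun b => u a b) (fun b => h2 a b)
    (fun b b' n hj => by
      by_cases hi : n = i
      · subst hi; rw [h1, h1]
      · rw [h3 _ _ n hi hj, h3 _ _ n hi hj])
  rw [e]
  generalize α i = a
  generalize α j = b
  generalize mon 1 0 = p at *
  generalize mon (-1) 0 = q at *
  generalize mon 0 1 = r at *
  generalize mon 0 (-1) = s at *
  cases a <;> cases b <;>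
    simp only [key1, key2, map_neg, map_add, map_smul, smul_neg, reduceIte, reduceCtorEq] <;>
    match_scalars <;>
    first | ring1 | linear_combination (r - s) * hA | linear_combination (s - r) * hA

lemma TOp_comm (i j : Fin N) (hij : i.val + 1 < j.val) : TOp i * TOp j = TOp j * TOp i := by
  refine Mod_hom_ext fun α => ?_
  simp only [Module.End.mul_apply]
  obtain ⟨k, hik⟩ : ∃ k : Fin N, i.val + 1 = k.val := ⟨⟨i.val + 1, by omega⟩, rfl⟩
  by_cases h : j.val + 1 < N
  · obtain ⟨l, hjl⟩ : ∃ l : Fin N, j.val + 1 = l.val := ⟨⟨j.val + 1, h⟩, rfl⟩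
    obtain ⟨u, h1, h2, h3, h4, h5, e⟩ := exists_upd α i k j l
      (fun h => by subst h; omega) (fun h => by subst h; omega) (fun h => by subst h; omega)
      (fun h => by subst h; omega) (fun h => by subst h; omega) (fun h => by subst h; omega)
    have key1 : ∀ c d a b, _ := fun c d => TOp_adj i k hik (fun a b => u a b c d)
      (fun a b => h1 a b c d) (fun a b => h2 a b c d) (fun a b a' b' n hi hk => by
        by_cases hj : n = j
        · subst hj; rw [h3, h3]
        · by_cases hl : n = l
          · subst hl; rw [h4, h4]
          · rw [h5 _ _ _ _ n hi hk hj hl, h5 _ _ _ _ n hi hk hj hl])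
    have key2 : ∀ a b c d, _ := fun a b => TOp_adj j l hjl (fun c d => u a b c d)
      (fun c d => h3 a b c d) (fun c d => h4 a b c d) (fun c d c' d' n hj hl => by
        by_cases hi : n = i
        · subst hi; rw [h1, h1]
        · by_cases hk : n = k
          · subst hk; rw [h2, h2]
          · rw [h5 _ _ _ _ n hi hk hj hl, h5 _ _ _ _ n hi hk hj hl])
    rw [e]
    generalize α i = a
    generalize α k = b
    generalize α j = c
    generalize α l = d
    generalize mon 1 0 = p at *
    generalize mon (-1) 0 = q at *
    cases a <;> cases b <;> cases c <;> cases d <;>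
      simp only [key1, key2, map_neg, map_add, map_smul, smul_neg, reduceIte, reduceCtorEq] <;>
      module
  · obtain ⟨u, h1, h2, h3, h4, e⟩ := exists_upd3 α i k j (fun h => by subst h; omega)
      (fun h => by subst h; omega) (fun h => by subst h; omega)
    have key1 : ∀ c a b, _ := fun c => TOp_adj i k hik (fun a b => u a b c) (fun a b => h1 a b c)
      (fun a b => h2 a b c) (fun a b a' b' n hi hk => by
        by_cases hj : n = j
        · subst hj; rw [h3, h3]
        · rw [h4 _ _ _ n hi hk hj, h4 _ _ _ n hi hk hj])
    have key2 : ∀ a b c, _ := fun a b => TOp_end j (by omega) (fun c => u a b c)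
      (fun c => h3 a b c) (fun c c' n hj => by
        by_cases hi : n = i
        · subst hi; rw [h1, h1]
        · by_cases hk : n = k
          · subst hk; rw [h2, h2]
          · rw [h4 _ _ _ n hi hk hj, h4 _ _ _ n hi hk hj])
    rw [e]
    generalize α i = a
    generalize α k = b
    generalize α j = c
    cases a <;> cases b <;> cases c <;>
      simp only [key1, key2, map_neg, map_add, map_smul, smul_neg, reduceIte, reduceCtorEq] <;>
      module

lemma TOp_rel ⦃x y : FreeAlgebra Coeff (Fin N)⦄ (h : HeckeRel N x y) :
    FreeAlgebra.lift Coeff (TOp (N := N)) x = FreeAlgebra.lift Coeff (TOp (N := N)) y := by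
  cases h with
  | quad i => simpa using TOp_quad i
  | braid3 i j hij hj => simpa using TOp_braid3 i j hij hj
  | braid4 i j hij hj => simpa using TOp_braid4 i j hij hj
  | comm i j hij => simpa using TOp_comm i j hij

/-- The action of the Hecke algebra on `M⁻`; the generator `T_i` acts by `TOp i`. -/
def act (N : ℕ) : Hecke N →ₐ[Coeff] Module.End Coeff (Mod N) :=
  RingQuot.liftAlgHom Coeff ⟨FreeAlgebra.lift Coeff TOp, fun _ _ h => TOp_rel h⟩

lemma act_T (i : Fin N) : act N (T i) = TOp i := by
  have h := RingQuot.liftAlgHom_mkAlgHom_apply Coeff (FreeAlgebra.lift Coeff (TOp (N := N)))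
    (fun _ _ h => TOp_rel h) (FreeAlgebra.ι Coeff i)
  exact h.trans (FreeAlgebra.lift_ι_apply _ _)

/-! ## The coset space `S_N^C / S_N`, the Bruhat order and the bar involution of `M⁻` -/

/-- The Coxeter system of type `B_N` (equivalently `C_N`), with simple reflections indexed by
`Fin N`. -/
abbrev cox (N : ℕ) : CoxeterSystem (CoxeterMatrix.B N) (CoxeterMatrix.B N).Group :=
  (CoxeterMatrix.B N).toCoxeterSystem

/-- The reduced word of the minimal coset representative of the string `α`: if the letters `2` are
at the positions `p_1 < ⋯ < p_r`, it is
`(s_{p_r} ⋯ s_N) ⋯ (s_{p_2} ⋯ s_N) (s_{p_1} ⋯ s_N)`. -/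
def word (α : BString N) : List (Fin N) :=
  ((List.finRange N).filter (fun p => α p)).reverse.flatMap
    (fun p => (List.finRange N).filter (fun i => p ≤ i))

/-- The minimal coset representative `w⁻(α)`. -/
def minRep (α : BString N) : (CoxeterMatrix.B N).Group := (cox N).wordProd (word α)

/-- The strong Bruhat order: `w' ≤ w` if `w'` is the product of a subexpression of a reduced
expression of `w`. -/
def BruhatLE (w' w : (CoxeterMatrix.B N).Group) : Prop :=
  ∃ ω : List (Fin N), (cox N).IsReduced ω ∧ (cox N).wordProd ω = w ∧
    ∃ ω' : List (Fin N), ω'.Sublist ω ∧ (cox N).wordProd ω' = w'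

/-- The order of strings: the Bruhat order of the minimal representatives. -/
def StrLE (α β : BString N) : Prop := BruhatLE (minRep α) (minRep β)

/-- The number of letters of the reduced word of `α` different from the last generator. -/
def len' (α : BString N) : ℕ := (word α).countP (fun i => i.val + 1 < N)

/-- The number of occurrences of the last generator in the reduced word of `α`. -/
def lenN (α : BString N) : ℕ := (word α).countP (fun i => i.val + 1 = N)

/-- The normalisation `𝐭^{|α| - |β|}`, that is
`t ^ (l'(α) - l'(β)) * t_N ^ (l_N(α) - l_N(β))`. -/
def normFactor (α β : BString N) : Coeff :=
  mon ((len' α : ℤ) - len' β) ((lenN α : ℤ) - lenN β)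

/-- The string `1 ⋯ 1`. -/
def allOnes (N : ℕ) : BString N := fun _ => false

/-- The standard basis element of the Hecke algebra at the minimal representative of `α`. -/
def TWord (α : BString N) : Hecke N := ((word α).map T).prod

/-- The bar involution of `M⁻`, the one compatible with the bar involution of the Hecke algebra
and fixing `m_{1 ⋯ 1}`: since `m_α = T_{w⁻(α)} m_{1 ⋯ 1}`, it is the additive map
`∑ c_α m_α ↦ ∑ bar(c_α) bar(T_{w⁻(α)}) m_{1 ⋯ 1}`. -/
def barMod (x : Mod N) : Mod N :=
  x.sum (fun α c => barCoeff c • act N (barHecke N (TWord α)) (m (allOnes N)))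

/-! ## Parabolic Kazhdan--Lusztig polynomials -/

/-- `C` is a Kazhdan--Lusztig basis of `M⁻`, and `P α β` are its (normalised) coefficients; the
coefficients not occurring in the expansion are set to be `0`. -/
structure IsKLBasis (C : Module.Basis (BString N) Coeff (Mod N))
    (P : BString N → BString N → Coeff) : Prop where
  bar_invariant : ∀ β, barMod (C β) = C β
  expansion : ∀ β, C β =
    ∑ α ∈ Finset.univ.filter (fun α => StrLE α β), (normFactor α β * P α β) • m α
  diag : ∀ β, P β β = 1
  negative : ∀ α β, StrLE α β → α ≠ β → normFactor α β * P α β ∈ ZGammaNeg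
  support : ∀ α β, ¬ StrLE α β → P α β = 0

/-- `P` is the family `P_{α,β}^{A,-}` of parabolic Kazhdan--Lusztig polynomials of `M⁻`. -/
def IsKLPolynomials (P : BString N → BString N → Coeff) : Prop :=
  ∃ C : Module.Basis (BString N) Coeff (Mod N), IsKLBasis C P

/-! ## Paths and ballot strips

A string is a path starting at `(0, 0)` in which the letter `1` is the step `(1, -1)` and the
letter `2` is the step `(1, 1)`. A box is given by its centre. -/

/-- The height of the path of `α` at abscissa `i`. -/
def height (α : BString N) (i : ℤ) : ℤ :=
  ∑ k : Fin N, if (k.val : ℤ) < i then (if α k then 1 else -1) else 0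

/-- The boxes of the shifted Ferrers diagram `λ⁻(α)`. -/
def boxes (α : BString N) : Set (ℤ × ℤ) :=
  {b | 0 < b.1 ∧ b.1 ≤ N ∧ |b.2| ≤ b.1 ∧ Even (b.1 + b.2 - 1) ∧ b.2 < height α b.1}

/-- The skew diagram `λ⁻(β) / λ⁻(α)`. -/
def skew (α β : BString N) : Set (ℤ × ℤ) := boxes β \ boxes α

/-- A ballot strip: the first vertex `(x, y)` of a ballot path, and its steps, `true` for
`(1, 1)` and `false` for `(1, -1)`. The path stays weakly above its starting height. -/
structure BallotStrip where
  x : ℤ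
  y : ℤ
  steps : List Bool
  ballot : ∀ k, (steps.take k).count false ≤ (steps.take k).count true

namespace BallotStrip

/-- The `k`-th vertex of the ballot path. -/
def vertex (D : BallotStrip) (k : ℕ) : ℤ × ℤ :=
  (D.x + k, D.y + (D.steps.take k).count true - (D.steps.take k).count false)

/-- The boxes of the strip, centred at the vertices of the ballot path. -/
def boxSet (D : BallotStrip) : Set (ℤ × ℤ) := {b | ∃ k ≤ D.steps.length, b = D.vertex k}

/-- The strip has length `(l, l')` when its path ends at `(x + 2 l + l', y + l')`: here `l` is the
number of down steps, and `l'` is the excess of the number of up steps. -/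
def l (D : BallotStrip) : ℕ := D.steps.count false

/-- The second component `l'` of the length. -/
def l' (D : BallotStrip) : ℕ := D.steps.count true - D.steps.count false

/-- The weight of a strip, with the sign `σ` (`1` for Rule I and `-1` for Rule II). -/
def wt (σ : ℤ) (D : BallotStrip) : Coeff :=
  if Even D.l' then mon (2 * D.l + D.l') 0
  else -(σ • mon (2 * D.l + D.l' - 1) 2)

end BallotStrip

/-- The boxes just above, NW and NE of a box. -/
def above (b : ℤ × ℤ) : Set (ℤ × ℤ) :=
  {(b.1, b.2 + 2), (b.1 - 1, b.2 + 1), (b.1 + 1, b.2 + 1)}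

/-- Rule 0: the rightmost box of a strip of length `(l, l')` with `l' ≥ 1` is an anchor box, that
is, a box with abscissa `N`. -/
def Rule0 (N : ℕ) (D : BallotStrip) : Prop :=
  1 ≤ D.l' → (D.vertex D.steps.length).1 = N

/-- Rule II: if a box of a strip `D'` is just above, NW or NE of a box of another strip `D`, then
all boxes just above, NW and NE of a box of `D` belong to `D` or `D'`. Positions to the right of
the column of anchor boxes are no boxes. -/
def RuleII (N : ℕ) (C : Finset BallotStrip) : Prop :=
  ∀ D ∈ C, ∀ D' ∈ C, D ≠ D' →
    (∃ b ∈ D.boxSet, ∃ b' ∈ D'.boxSet, b' ∈ above b) →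
      ∀ b ∈ D.boxSet, ∀ b' ∈ above b, b'.1 ≤ N → b' ∈ D.boxSet ∨ b' ∈ D'.boxSet

/-- The fillings of the skew diagram by ballot strips. -/
def Conf (α β : BString N) : Set (Finset BallotStrip) :=
  {C | (∀ D ∈ C, D.boxSet ⊆ skew α β ∧ Rule0 N D) ∧
    ∀ b ∈ skew α β, ∃! D, D ∈ C ∧ b ∈ D.boxSet}

/-- The fillings satisfying Rule II. -/
def ConfII (α β : BString N) : Set (Finset BallotStrip) := {C ∈ Conf α β | RuleII N C}

lemma finite_strips (α β : BString N) : {D : BallotStrip | D.boxSet ⊆ skew α β}.Finite := by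
  have hinj : Function.Injective
      (fun D : BallotStrip => ((D.x, D.y, D.steps) : ℤ × ℤ × List Bool)) := by
    rintro ⟨x, y, s, h⟩ ⟨x', y', s', h'⟩ e
    simp only [Prod.mk.injEq] at e
    obtain ⟨rfl, rfl, rfl⟩ := e
    rfl
  refine Set.Finite.of_finite_image (f := fun D => (D.x, D.y, D.steps)) ?_ hinj.injOn
  refine ((Set.finite_Icc (0 : ℤ) N).prod ((Set.finite_Icc (-(N : ℤ)) N).prod
    (List.finite_length_le Bool N))).subset ?_
  rintro _ ⟨D, hD, rfl⟩
  have h0 := (hD ⟨0, Nat.zero_le _, rfl⟩).1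
  have h1 := (hD ⟨D.steps.length, le_rfl, rfl⟩).1
  simp only [boxes, BallotStrip.vertex, Set.mem_ofPred_eq, List.take_zero, List.count_nil,
    Nat.cast_zero, add_zero, sub_zero] at h0 h1
  obtain ⟨a1, a2, a3, -, -⟩ := h0
  obtain ⟨-, b2, -, -, -⟩ := h1
  have := abs_le.mp a3
  simp only [Set.mem_prod, Set.mem_Icc, Set.mem_ofPred_eq]
  refine ⟨⟨by omega, by omega⟩, ⟨by omega, by omega⟩, by omega⟩

/-- There are finitely many fillings, so that the sums over them are finite sums. -/
lemma finite_Conf (α β : BString N) : (Conf α β).Finite := by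
  refine Set.Finite.of_finite_image (f := fun C : Finset BallotStrip => (C : Set BallotStrip)) ?_
    Finset.coe_injective.injOn
  refine (finite_strips α β).finite_subsets.subset ?_
  rintro _ ⟨C, hC, rfl⟩ D hD
  exact (hC.1 D hD).1

/-- The generating function `Q_{α,β}^{A,II,-}` (with value `0` unless `α ≤ β`). -/
def QII (α β : BString N) : Coeff :=
  if StrLE α β then ∑ᶠ C ∈ ConfII α β, ∏ D ∈ C, D.wt (-1) else 0

/-! ## Link patterns and flips -/

/-- `Paired β i j`: the letter `2` at `i` and the letter `1` at `j` are paired by repeatedly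
pairing and removing adjacent `2` and `1` (in this order). So `i` is to the left of `j` and all
letters strictly between them are paired among themselves; `p` gives their partners. -/
inductive Paired (β : BString N) : Fin N → Fin N → Prop
  | mk (i j : Fin N) (p : Fin N → Fin N) (hij : i < j) (hi : β i = true) (hj : β j = false)
      (hp : ∀ k, i < k → k < j → i < p k ∧ p k < j)
      (h2 : ∀ k, i < k → k < j → β k = true → Paired β k (p k))
      (h1 : ∀ k, i < k → k < j → β k = false → Paired β (p k) k) : Paired β i j

/-- The letter at `i` is unpaired. -/
def Unpaired (β : BString N) (i : Fin N) : Prop := ∀ j, ¬ Paired β i j ∧ ¬ Paired β j i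

/-- The positions of the unpaired `2`s. -/
def unpairedTwos (β : BString N) : Finset (Fin N) :=
  Finset.univ.filter (fun i => Unpaired β i ∧ β i = true)

/-- The rank of a position among the unpaired `2`s, counted from the right and starting
from `1`. -/
def rankFromRight (β : BString N) (i : Fin N) : ℕ :=
  ((unpairedTwos β).filter (fun k => i ≤ k)).card

/-- The o-unpaired `2`s: the first, third, … unpaired `2`s from the right. -/
def oUnpaired (β : BString N) : Finset (Fin N) :=
  (unpairedTwos β).filter (fun i => Odd (rankFromRight β i))

/-- The e-unpaired `2`s: the second, fourth, … unpaired `2`s from the right. -/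
def eUnpaired (β : BString N) : Finset (Fin N) :=
  (unpairedTwos β).filter (fun i => Even (rankFromRight β i))

/-- The set `F^A(β)` of the strings `α ≤ β` obtained from `β` by flipping some pairs (exchanging
their `2` and `1`) and some unpaired `2`s (changing them to `1`). -/
def FA (β : BString N) : Set (BString N) :=
  {α | StrLE α β ∧
    (∀ i j, Paired β i j → (α i = true ∧ α j = false) ∨ (α i = false ∧ α j = true)) ∧
    (∀ i, Unpaired β i → β i = false → α i = false)}

/-- The number of flipped pairs. -/
def dPairs (α β : BString N) : ℕ :=
  (Finset.univ.filter (fun q : Fin N × Fin N =>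
    Paired β q.1 q.2 ∧ α q.1 = false ∧ α q.2 = true)).card

/-- The number of flipped e-unpaired `2`s. -/
def dE (α β : BString N) : ℕ := ((eUnpaired β).filter (fun i => α i = false)).card

/-- The number of flipped o-unpaired `2`s. -/
def dO (α β : BString N) : ℕ := ((oUnpaired β).filter (fun i => α i = false)).card

end KLB

end

open scoped Classical

noncomputable section

namespace KLB

variable {N : ℕ}

/-! The Kazhdan–Lusztig side and the strip side are both computed by one explicit coefficient,
`flipCoeff`. Each letter 2 of β opens an arc, which is closed by the 1 paired with it or stays open
up to the abscissa N. If α arises from β by flipping arcs, its coefficient is the product over the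
flipped arcs of t⁻¹ for a closed arc, and of t_N⁻¹ or t⁻¹t_N for an open one, according to the
parity of its rank from the right. Otherwise the coefficient is 0.

Kazhdan–Lusztig side. When s_i raises γ, the vector of s_iγ is (T_i + p⁻¹) times the vector of γ
(`flipVec_sAct`), with no lower terms to subtract. Since T_i + p⁻¹ preserves bar invariance
(`barMod_TOp_add`), all these vectors are bar-invariant. Their off-diagonal coefficients are zero or
negative monomials, and they are supported below β in the Bruhat order
(`StrLE_of_flipCoeff_ne_zero`). By `eq_zero_of_barMod` they are therefore the only possible
Kazhdan–Lusztig basis. The recursion is checked on the stack automaton `readWeight`, where only the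
letters moved by s_i matter, and `flipCoeff_eq` turns the automaton into a product over arcs. That
the bar involution is compatible with the action rests on `TOp_barVec_of_equal`.

Strip side. Rule II leaves no freedom: by induction on the depth below the upper path, every strip
is a vertical translate of the part of the upper path over an arc (`isArcStrip_of_mem`). Hence there
is at most one filling (`confII_subset`), and it exists only if the lower path is obtained by flips
(`isFlip_of_confII`). Conversely, the strips of the flipped arcs, placed at their nesting depths,
form a filling satisfying Rule II (`ArcStrips.conf`, `ArcStrips.ruleII`). The normalisation removes
one power of t for each column before N and one power of t_N for the column N, which turns the
weight of a strip into that of its arc (`normalized_wt`).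

The closed formula follows since pairs are the closed arcs (`Paired.cov`, `paired_of_cov`) and the
rank of an unpaired 2 is read off from heights (`rankFromRight_eq`). -/

/-! ## Raising steps and reduced words -/

/-- The `i`-th simple reflection raises the string `α`. -/
def Raises (i : Fin N) (α : BString N) : Prop :=
  α i = false ∧ ∀ h : i.val + 1 < N, α ⟨i.val + 1, h⟩ = true

/-- The word of increasing indices from `p` on. -/
def block (p : Fin N) : List (Fin N) := (List.finRange N).filter (fun i => p ≤ i)

lemma finRange_split (i : Fin N) : ∃ s t, List.finRange N = s ++ i :: t ∧
    (∀ p ∈ s, p < i) ∧ ∀ p ∈ t, i < p := by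
  obtain ⟨s, t, h⟩ := List.append_of_mem (List.mem_finRange i)
  have hp : (List.finRange N).Pairwise (· < ·) := List.pairwise_lt_finRange N
  rw [h, List.pairwise_append, List.pairwise_cons] at hp
  exact ⟨s, t, h, fun p hp' => hp.2.2 p hp' i (by simp), hp.2.1.1⟩

lemma finRange_split_adj (i j : Fin N) (hij : i.val + 1 = j.val) :
    ∃ s t, List.finRange N = s ++ i :: j :: t ∧ (∀ p ∈ s, p < i) ∧ ∀ p ∈ t, j < p := by
  obtain ⟨s, t, h, hs, ht⟩ := finRange_split i
  have hp : (List.finRange N).Pairwise (· < ·) := List.pairwise_lt_finRange N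
  rw [h, List.pairwise_append, List.pairwise_cons] at hp
  have hj : j ∈ s ++ i :: t := h ▸ List.mem_finRange j
  have hj : j ∈ t := by
    rcases List.mem_append.1 hj with h1 | h1
    · have := hs j h1; omega
    · rcases List.mem_cons.1 h1 with h2 | h2
      · subst h2; omega
      · exact h2
  obtain ⟨s', t', rfl⟩ := List.append_of_mem hj
  have h2 := hp.2.1.2
  rw [List.pairwise_append, List.pairwise_cons] at h2
  have : s' = [] := by
    rw [List.eq_nil_iff_forall_not_mem]
    intro p hp'
    have h3 := h2.2.2 p hp' j (by simp)
    have h4 := ht p (by simp [hp'])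
    omega
  subst this
  exact ⟨s, t', by simpa using h, hs, h2.2.1.1⟩

/-- With one factor for every position, empty for a letter 1, the words of two strings can be
compared factor by factor. -/
lemma word_eq (α : BString N) : word α =
    (List.finRange N).reverse.flatMap (fun p => if α p then block p else []) := by
  have : ∀ l : List (Fin N), (l.filter (fun p => α p)).flatMap block =
      l.flatMap (fun p => if α p then block p else []) := by
    intro l
    induction l with
    | nil => rfl
    | cons a l ih => by_cases h : α a <;> simp [h, ih]
  rw [word, ← List.filter_reverse]
  exact this _

lemma block_adj (i j : Fin N) (hij : i.val + 1 = j.val) : block i = i :: block j := by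
  obtain ⟨s, t, h, hs, ht⟩ := finRange_split_adj i j hij
  have e1 : ∀ p ∈ s, ¬ i ≤ p := fun p hp => not_le.2 (hs p hp)
  have e2 : ∀ p ∈ s, ¬ j ≤ p := fun p hp => by have := hs p hp; omega
  have e3 : ∀ p ∈ t, i ≤ p := fun p hp => by have := ht p hp; omega
  have e4 : ∀ p ∈ t, j ≤ p := fun p hp => (ht p hp).le
  have e5 : i ≤ j := by omega
  have e6 : ¬ j ≤ i := by omega
  rw [block, block, h]
  have f1 : s.filter (fun p => i ≤ p) = [] := List.filter_eq_nil_iff.2 (by simpa using e1)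
  have f2 : s.filter (fun p => j ≤ p) = [] := List.filter_eq_nil_iff.2 (by simpa using e2)
  have f3 : t.filter (fun p => i ≤ p) = t := List.filter_eq_self.2 (by simpa using e3)
  have f4 : t.filter (fun p => j ≤ p) = t := List.filter_eq_self.2 (by simpa using e4)
  simp [List.filter_append, e5, e6, f1, f2, f3, f4]

lemma block_last (i : Fin N) (hi : i.val + 1 = N) : block i = [i] := by
  obtain ⟨s, t, h, hs, ht⟩ := finRange_split i
  have e1 : ∀ p ∈ s, ¬ i ≤ p := fun p hp => not_le.2 (hs p hp)
  have e3 : t = [] := by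
    rw [List.eq_nil_iff_forall_not_mem]
    intro p hp
    have := ht p hp
    omega
  subst e3
  rw [block, h, List.filter_append, List.filter_eq_nil_iff.2 (by simpa using e1)]
  simp

lemma sAct_adj (i j : Fin N) (hij : i.val + 1 = j.val) (α : BString N) :
    sAct i α = α ∘ Equiv.swap i j := by
  have h : i.val + 1 < N := hij ▸ j.isLt
  have e : (⟨i.val + 1, h⟩ : Fin N) = j := Fin.ext hij
  rw [sAct, dif_pos h, e]

lemma sAct_last (i : Fin N) (hi : i.val + 1 = N) (α : BString N) :
    sAct i α = Function.update α i (!(α i)) := by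
  rw [sAct, dif_neg (by omega)]

lemma sAct_sAct (i : Fin N) (α : BString N) : sAct i (sAct i α) = α := by
  by_cases h : i.val + 1 < N
  · rw [sAct_adj i ⟨i.val + 1, h⟩ rfl, sAct_adj i ⟨i.val + 1, h⟩ rfl]
    funext k
    simp
  · rw [sAct_last i (by omega), sAct_last i (by omega)]
    funext k
    by_cases hk : k = i
    · subst hk; simp
    · simp [hk]

/-- The image of the reduced word of a string in a monoid. -/
def wordImage {M : Type*} [Monoid M] (f : Fin N → M) (α : BString N) : M :=
  ((word α).map f).prod

lemma wordImage_eq {M : Type*} [Monoid M] (f : Fin N → M) (α : BString N) : wordImage f α =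
    ((List.finRange N).reverse.map
      (fun p => if α p then ((block p).map f).prod else 1)).prod := by
  rw [wordImage, word_eq, List.map_flatMap, List.flatMap, List.prod_flatten, List.map_map]
  congr 2
  funext p
  by_cases h : α p <;> simp [h]

/-- Raising a string multiplies the image of its reduced word on the left by a generator. -/
lemma wordImage_sAct {M : Type*} [Monoid M] (f : Fin N → M)
    (hf : ∀ i j : Fin N, i.val + 1 < j.val → f i * f j = f j * f i) (i : Fin N) (α : BString N)
    (h : Raises i α) : wordImage f (sAct i α) = f i * wordImage f α := by
  have hcomm : ∀ (L : List (Fin N)) (g : Fin N → M), (∀ p ∈ L, Commute (f i) (g p)) →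
      Commute (f i) (L.map g).prod := by
    intro L g hL
    refine Commute.list_prod_right _ _ ?_
    intro x hx
    obtain ⟨p, hp, rfl⟩ := List.mem_map.1 hx
    exact hL p hp
  rw [wordImage_eq, wordImage_eq]
  by_cases hi : i.val + 1 < N
  · obtain ⟨j, hij⟩ : ∃ j : Fin N, i.val + 1 = j.val := ⟨⟨i.val + 1, hi⟩, rfl⟩
    have hj : α j = true := by
      have := h.2 hi
      rwa [show (⟨i.val + 1, hi⟩ : Fin N) = j from Fin.ext hij] at this
    have hne : i ≠ j := by intro h; subst h; omega
    obtain ⟨s, t, e, hs, ht⟩ := finRange_split_adj i j hij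
    rw [sAct_adj i j hij, e]
    have e1 : ∀ p, p ≠ i → p ≠ j → (α ∘ Equiv.swap i j) p = α p := fun p h1 h2 => by
      simp [Equiv.swap_apply_of_ne_of_ne h1 h2]
    simp only [List.reverse_append, List.reverse_cons, List.map_append, List.prod_append,
      List.map_cons, List.prod_cons, List.append_assoc, List.cons_append, List.nil_append]
    have es : s.reverse.map (fun p => if (α ∘ Equiv.swap i j) p then ((block p).map f).prod else 1)
        = s.reverse.map (fun p => if α p then ((block p).map f).prod else 1) := by
      refine List.map_congr_left fun p hp => ?_
      have := hs p (by simpa using hp)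
      rw [e1 p (by omega) (by omega)]
    have et : t.reverse.map (fun p => if (α ∘ Equiv.swap i j) p then ((block p).map f).prod else 1)
        = t.reverse.map (fun p => if α p then ((block p).map f).prod else 1) := by
      refine List.map_congr_left fun p hp => ?_
      have := ht p (by simpa using hp)
      rw [e1 p (by omega) (by omega)]
    rw [es, et]
    -- The factors to the left come from positions beyond i + 1, and their blocks only contain
    -- generators commuting with the i-th one. This is why no braid relation is needed.
    have hc : Commute (f i)
        (t.reverse.map (fun p => if α p then ((block p).map f).prod else 1)).prod := by
      refine hcomm _ _ fun p hp => ?_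
      have := ht p (by simpa using hp)
      split_ifs
      · refine hcomm _ _ fun q hq => hf i q ?_
        have : p ≤ q := by simpa [block] using hq
        omega
      · exact Commute.one_right _
    have e2 : (α ∘ Equiv.swap i j) i = true := by simp [hj]
    have e3 : (α ∘ Equiv.swap i j) j = false := by simp [h.1]
    simp only [e2, e3, hj, h.1, block_adj i j hij, List.map_cons, List.prod_cons, if_true,
      Bool.false_eq_true, if_false, one_mul]
    simp only [← mul_assoc]
    rw [hc.eq]
  · have hi : i.val + 1 = N := by omega
    obtain ⟨s, t, e, hs, ht⟩ := finRange_split i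
    have ht0 : t = [] := by
      rw [List.eq_nil_iff_forall_not_mem]
      intro p hp
      have := ht p hp
      omega
    subst ht0
    rw [sAct_last i hi, e]
    have es : s.reverse.map (fun p => if Function.update α i (!(α i)) p then
          ((block p).map f).prod else 1)
        = s.reverse.map (fun p => if α p then ((block p).map f).prod else 1) := by
      refine List.map_congr_left fun p hp => ?_
      have := hs p (by simpa using hp)
      rw [Function.update_of_ne (by omega)]
    simp only [List.reverse_append, List.reverse_cons, List.map_append, List.prod_append,
      List.map_cons, List.map_nil, List.prod_cons, List.prod_nil, List.reverse_nil,
      List.nil_append, mul_one]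
    rw [es]
    simp [h.1, block_last i hi]

lemma wordImage_allOnes {M : Type*} [Monoid M] (f : Fin N → M) :
    wordImage f (allOnes N) = 1 := by
  rw [wordImage_eq]
  simp [allOnes]

/-- Sending every generator to 1 in the additive monoid ℕ turns the image of a word into its length.
-/
lemma word_length_sAct (i : Fin N) (α : BString N) (h : Raises i α) :
    (word (sAct i α)).length = (word α).length + 1 := by
  have := wordImage_sAct (fun _ : Fin N => Multiplicative.ofAdd (1 : ℕ))
    (fun _ _ _ => rfl) i α h
  have e : ∀ β : BString N, wordImage (fun _ : Fin N => Multiplicative.ofAdd (1 : ℕ)) β =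
      Multiplicative.ofAdd (word β).length := by
    intro β
    rw [wordImage, List.map_const', List.prod_replicate, ← ofAdd_nsmul]
    simp
  rw [e, e, ← ofAdd_add] at this
  have := Multiplicative.ofAdd.injective this
  omega

/-- The rightmost letter 2 has a 1 to its right or stands in the last place; undoing the
corresponding reflection gives the lower string. -/
lemma exists_raises (α : BString N) (h : α ≠ allOnes N) :
    ∃ i β, Raises i β ∧ sAct i β = α := by
  suffices ∃ i, Raises i (sAct i α) from
    let ⟨i, hi⟩ := this; ⟨i, sAct i α, hi, sAct_sAct i α⟩
  have hne : (Finset.univ.filter (fun k => α k = true)).Nonempty := by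
    by_contra hc
    rw [Finset.not_nonempty_iff_eq_empty, Finset.filter_eq_empty_iff] at hc
    exact h (funext fun k => by simpa [allOnes] using hc (Finset.mem_univ k))
  set i := (Finset.univ.filter (fun k => α k = true)).max' hne with hi
  have h1 : α i = true := by simpa using Finset.max'_mem _ hne
  refine ⟨i, ?_⟩
  by_cases hlt : i.val + 1 < N
  · have h2 : α ⟨i.val + 1, hlt⟩ = false := by
      by_contra hc
      have := Finset.le_max' (Finset.univ.filter (fun k => α k = true)) ⟨i.val + 1, hlt⟩
        (by simpa using hc)
      rw [← hi, Fin.le_def] at this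
      simp at this
    rw [sAct_adj i ⟨i.val + 1, hlt⟩ rfl]
    exact ⟨by simp [h2], fun _ => by simp [h1]⟩
  · rw [sAct_last i (by omega)]
    exact ⟨by simp [h1], fun h => absurd h hlt⟩

/-- Induction on strings along raising steps. -/
lemma raising_induction {P : BString N → Prop} (h0 : P (allOnes N))
    (h1 : ∀ i α, Raises i α → P α → P (sAct i α)) (α : BString N) : P α := by
  induction hn : (word α).length using Nat.strong_induction_on generalizing α with
  | _ n ih =>
    by_cases h : α = allOnes N
    · rw [h]; exact h0
    · obtain ⟨i, β, hβ, rfl⟩ := exists_raises α h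
      have := word_length_sAct i β hβ
      exact h1 i β hβ (ih _ (by omega) β rfl)

/-! ## The action of the Coxeter group on strings -/

lemma sAct_apply_self (i j : Fin N) (hij : i.val + 1 = j.val) (α : BString N) :
    sAct i α i = α j := by
  rw [sAct_adj i j hij]; simp

lemma sAct_apply_next (i j : Fin N) (hij : i.val + 1 = j.val) (α : BString N) :
    sAct i α j = α i := by
  rw [sAct_adj i j hij]; simp

lemma sAct_apply_of_ne (i k : Fin N) (hk : k ≠ i) (hk' : k.val ≠ i.val + 1) (α : BString N) :
    sAct i α k = α k := by
  by_cases h : i.val + 1 < N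
  · rw [sAct_adj i ⟨i.val + 1, h⟩ rfl, Function.comp_apply, Equiv.swap_apply_of_ne_of_ne hk]
    intro hc; exact hk' (congrArg Fin.val hc)
  · rw [sAct_last i (by omega), Function.update_of_ne hk]

lemma sAct_comm (i j : Fin N) (hij : i.val + 1 < j.val) (α : BString N) :
    sAct i (sAct j α) = sAct j (sAct i α) := by
  obtain ⟨i', hi'⟩ : ∃ i' : Fin N, i.val + 1 = i'.val := ⟨⟨i.val + 1, by omega⟩, rfl⟩
  rw [sAct_adj i i' hi', sAct_adj i i' hi']
  have h1 : i ≠ j := by intro h; subst h; omega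
  have h2 : i' ≠ j := by intro h; subst h; omega
  by_cases h : j.val + 1 < N
  · obtain ⟨j', hj'⟩ : ∃ j' : Fin N, j.val + 1 = j'.val := ⟨⟨j.val + 1, h⟩, rfl⟩
    rw [sAct_adj j j' hj', sAct_adj j j' hj']
    have h3 : i ≠ j' := by intro h; subst h; omega
    have h4 : i' ≠ j' := by intro h; subst h; omega
    have : Equiv.swap j j' * Equiv.swap i i' = Equiv.swap i i' * Equiv.swap j j' :=
      Equiv.Perm.Disjoint.commute (Equiv.Perm.disjoint_swap_swap (by simp; omega))
    rw [Function.comp_assoc, Function.comp_assoc]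
    exact congrArg (α ∘ ·) (congrArg DFunLike.coe this)
  · rw [sAct_last j (by omega), sAct_last j (by omega)]
    funext k
    by_cases hk : k = j
    · subst hk
      simp [Equiv.swap_apply_of_ne_of_ne h1.symm h2.symm]
    · have : Equiv.swap i i' k ≠ j := by
        intro hc
        apply hk
        rw [Equiv.swap_apply_eq_iff] at hc
        rw [hc, Equiv.swap_apply_of_ne_of_ne h1.symm h2.symm]
      simp [this, hk]

lemma sAct_braid3 (i j : Fin N) (hij : i.val + 1 = j.val) (hj : j.val + 1 < N) (α : BString N) :
    sAct i (sAct j (sAct i α)) = sAct j (sAct i (sAct j α)) := by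
  obtain ⟨k, hjk⟩ : ∃ k : Fin N, j.val + 1 = k.val := ⟨⟨j.val + 1, hj⟩, rfl⟩
  funext l
  by_cases h1 : l = i
  · subst h1
    simp [sAct_apply_self l j hij, sAct_apply_self j k hjk,
      sAct_apply_of_ne j l (by omega) (by omega), sAct_apply_of_ne l k (by omega) (by omega)]
  by_cases h2 : l = j
  · subst h2
    simp [sAct_apply_self i l hij, sAct_apply_next i l hij, sAct_apply_self l k hjk,
      sAct_apply_next l k hjk,      sAct_apply_of_ne l i (by omega) (by omega), sAct_apply_of_ne i k (by omega) (by omega)]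
  by_cases h3 : l = k
  · subst h3
    simp [sAct_apply_next i j hij, sAct_apply_next j l hjk,
      sAct_apply_of_ne i l (by omega) (by omega), sAct_apply_of_ne j i (by omega) (by omega)]
  · simp [sAct_apply_of_ne i l (by omega) (by omega), sAct_apply_of_ne j l (by omega) (by omega)]

lemma sAct_last_self (i : Fin N) (hi : i.val + 1 = N) (α : BString N) :
    sAct i α i = !(α i) := by
  rw [sAct_last i hi]; simp

lemma sAct_braid4 (i j : Fin N) (hij : i.val + 1 = j.val) (hj : j.val + 1 = N) (α : BString N) :
    sAct i (sAct j (sAct i (sAct j α))) = sAct j (sAct i (sAct j (sAct i α))) := by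
  funext l
  by_cases h1 : l = i
  · subst h1
    simp [sAct_apply_self l j hij, sAct_last_self j hj, sAct_apply_next l j hij,
      sAct_apply_of_ne j l (by omega) (by omega)]
  by_cases h2 : l = j
  · subst h2
    simp [sAct_apply_next i l hij, sAct_apply_self i l hij, sAct_last_self l hj,
      sAct_apply_of_ne l i (by omega) (by omega)]
  · simp [sAct_apply_of_ne i l (by omega) (by omega), sAct_apply_of_ne j l (by omega) (by omega)]

/-- The simple reflection as a permutation of the strings. -/
def sPerm (i : Fin N) : Equiv.Perm (BString N) :=
  ⟨sAct i, sAct i, sAct_sAct i, sAct_sAct i⟩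

lemma sPerm_mul_self (i : Fin N) : sPerm i * sPerm i = 1 := Equiv.ext (sAct_sAct i)

/-- For involutions the Coxeter relations are equivalent to the commutation and braid relations. The
products for (i, j) and (j, i) are mutually inverse, so i < j suffices. -/
lemma sPerm_liftable : (CoxeterMatrix.B N).IsLiftable (sPerm (N := N)) := by
  have key : ∀ i j : Fin N, i.val < j.val →
      (sPerm i * sPerm j) ^ (CoxeterMatrix.B N) i j = 1 := by
    intro i j hij
    have hsi : ∀ x, sPerm i * (sPerm i * x) = x := fun x => by
      rw [← mul_assoc, sPerm_mul_self, one_mul]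
    have hsj : ∀ x, sPerm j * (sPerm j * x) = x := fun x => by
      rw [← mul_assoc, sPerm_mul_self, one_mul]
    have hne : i ≠ j := by intro h; subst h; omega
    simp only [CoxeterMatrix.B, Matrix.of_apply, hne, if_false]
    by_cases h4 : i.val + 1 = j.val
    · by_cases h5 : j.val + 1 = N
      · rw [if_pos (Or.inr (by omega))]
        have : sPerm i * (sPerm j * (sPerm i * sPerm j)) =
            sPerm j * (sPerm i * (sPerm j * sPerm i)) :=
          Equiv.ext (sAct_braid4 i j h4 h5)
        have e : (sPerm i * sPerm j) ^ 4 = (sPerm i * (sPerm j * (sPerm i * sPerm j))) *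
            (sPerm i * (sPerm j * (sPerm i * sPerm j))) := by
          simp only [pow_succ, pow_zero, one_mul, mul_assoc]
        rw [e]
        nth_rw 2 [this]
        simp only [mul_assoc, hsi, hsj, sPerm_mul_self]
      · rw [if_neg (by omega), if_pos (Or.inr h4)]
        have : sPerm i * (sPerm j * sPerm i) = sPerm j * (sPerm i * sPerm j) :=
          Equiv.ext (sAct_braid3 i j h4 (by omega))
        have e : (sPerm i * sPerm j) ^ 3 = (sPerm i * (sPerm j * sPerm i)) *
            (sPerm j * (sPerm i * sPerm j)) := by
          simp only [pow_succ, pow_zero, one_mul, mul_assoc]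
        rw [e, ← this]
        simp only [mul_assoc, hsi, hsj, sPerm_mul_self]
    · rw [if_neg (by omega), if_neg (by omega)]
      have : sPerm i * sPerm j = sPerm j * sPerm i := Equiv.ext (sAct_comm i j (by omega))
      rw [pow_two]
      nth_rw 2 [this]
      simp only [mul_assoc, hsj, sPerm_mul_self]
  intro i j
  rcases lt_trichotomy i.val j.val with h | h | h
  · exact key i j h
  · have : i = j := Fin.ext h
    subst this
    rw [sPerm_mul_self, one_pow]
  · have h1 := key j i h
    have e : sPerm i * sPerm j = (sPerm j * sPerm i)⁻¹ := by
      rw [mul_inv_rev, inv_eq_of_mul_eq_one_left (sPerm_mul_self i),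
        inv_eq_of_mul_eq_one_left (sPerm_mul_self j)]
    rw [e, inv_pow, CoxeterMatrix.symmetric, h1, inv_one]

/-- The action of the Coxeter group on the strings. -/
def strAct (N : ℕ) : (CoxeterMatrix.B N).Group →* Equiv.Perm (BString N) :=
  (cox N).lift ⟨sPerm, sPerm_liftable⟩

lemma strAct_simple (i : Fin N) (α : BString N) : strAct N ((cox N).simple i) α = sAct i α := by
  rw [strAct, CoxeterSystem.lift_apply_simple _ sPerm_liftable]
  rfl

lemma simple_comm (i j : Fin N) (hij : i.val + 1 < j.val) :
    (cox N).simple i * (cox N).simple j = (cox N).simple j * (cox N).simple i := by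
  have h := (cox N).simple_mul_simple_pow i j
  have hne : i ≠ j := by intro h; subst h; omega
  have e : (CoxeterMatrix.B N) i j = 2 := by
    simp only [CoxeterMatrix.B, Matrix.of_apply, hne, if_false]
    rw [if_neg (by omega), if_neg (by omega)]
  rw [e, pow_two] at h
  have := eq_inv_of_mul_eq_one_left h
  rwa [mul_inv_rev, CoxeterSystem.inv_simple, CoxeterSystem.inv_simple] at this

lemma minRep_sAct (i : Fin N) (α : BString N) (h : Raises i α) :
    minRep (sAct i α) = (cox N).simple i * minRep α :=
  wordImage_sAct (cox N).simple simple_comm i α h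

lemma minRep_allOnes : minRep (allOnes N) = 1 := wordImage_allOnes (cox N).simple

/-- The string is recovered from its coset representative. Any expression of a representative can
thus be followed as a walk on strings starting at 1⋯1. -/
lemma strAct_minRep (α : BString N) : strAct N (minRep α) (allOnes N) = α := by
  induction α using raising_induction with
  | h0 => rw [minRep_allOnes, map_one]; rfl
  | h1 i α h ih => rw [minRep_sAct i α h, map_mul, Equiv.Perm.mul_apply, ih, strAct_simple]

lemma strAct_wordProd_cons (i : Fin N) (ω : List (Fin N)) (α : BString N) :
    strAct N ((cox N).wordProd (i :: ω)) α = sAct i (strAct N ((cox N).wordProd ω) α) := by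
  rw [CoxeterSystem.wordProd_cons, map_mul, Equiv.Perm.mul_apply, strAct_simple]

lemma word_allOnes : word (allOnes N) = [] := by
  rw [word_eq]
  simp [allOnes]

/-- A reflection either raises a string, or lowers it, or fixes it. -/
lemma raises_trichotomy (i : Fin N) (α : BString N) :
    Raises i α ∨ Raises i (sAct i α) ∨ sAct i α = α := by
  by_cases h : i.val + 1 < N
  · obtain ⟨j, hij⟩ : ∃ j : Fin N, i.val + 1 = j.val := ⟨⟨i.val + 1, h⟩, rfl⟩
    have e : ∀ h, (⟨i.val + 1, h⟩ : Fin N) = j := fun h => Fin.ext hij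
    unfold Raises
    simp only [e, sAct_apply_self i j hij, sAct_apply_next i j hij]
    cases h1 : α i <;> cases h2 : α j
    · right; right
      funext k
      by_cases hk : k = i
      · subst hk; rw [sAct_apply_self k j hij, h1, h2]
      · by_cases hk' : k = j
        · subst hk'; rw [sAct_apply_next i k hij, h1, h2]
        · exact sAct_apply_of_ne i k hk (by omega) α
    · simp
    · simp [h]
    · right; right
      funext k
      by_cases hk : k = i
      · subst hk; rw [sAct_apply_self k j hij, h1, h2]
      · by_cases hk' : k = j
        · subst hk'; rw [sAct_apply_next i k hij, h1, h2]
        · exact sAct_apply_of_ne i k hk (by omega) α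
  · unfold Raises
    rw [sAct_last_self i (by omega)]
    cases h1 : α i <;> simp [h]

lemma word_length_sAct_le (i : Fin N) (α : BString N) :
    (word (sAct i α)).length ≤ (word α).length + 1 ∧
      ((word (sAct i α)).length = (word α).length + 1 → Raises i α) := by
  rcases raises_trichotomy i α with h | h | h
  · exact ⟨(word_length_sAct i α h).le, fun _ => h⟩
  · have := word_length_sAct i _ h
    rw [sAct_sAct] at this
    constructor <;> omega
  · rw [h]; constructor <;> omega

/-- A single generator lengthens the word of a string by at most one. -/
lemma word_length_strAct_le (ω : List (Fin N)) :
    (word (strAct N ((cox N).wordProd ω) (allOnes N))).length ≤ ω.length := by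
  induction ω with
  | nil =>
    rw [CoxeterSystem.wordProd_nil, map_one, Equiv.Perm.one_apply, word_allOnes]
  | cons i ω ih =>
    rw [strAct_wordProd_cons]
    have := (word_length_sAct_le i (strAct N ((cox N).wordProd ω) (allOnes N))).1
    simp only [List.length_cons]
    omega

/-- A shorter expression of the representative would lead from 1⋯1 to α in too few steps. -/
lemma length_minRep (α : BString N) : (cox N).length (minRep α) = (word α).length := by
  refine le_antisymm ((cox N).length_wordProd_le (word α)) ?_
  obtain ⟨ω, h1, h2⟩ := (cox N).exists_isReduced (minRep α)
  have := word_length_strAct_le ω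
  rw [← h2, strAct_minRep] at this
  rwa [h2, h1.eq]

/-! ## Heights and the Bruhat order -/

lemma height_congr {α β : BString N} (x : ℤ) (h : ∀ k : Fin N, (k.val : ℤ) < x → α k = β k) :
    height α x = height β x := by
  unfold height
  refine Finset.sum_congr rfl fun k _ => ?_
  split_ifs with h1 <;> simp_all

lemma height_succ (α : BString N) (k : Fin N) :
    height α (k.val + 1 : ℤ) = height α k.val + (if α k then 1 else -1) := by
  unfold height
  rw [← Finset.add_sum_erase _ _ (Finset.mem_univ k),
    ← Finset.add_sum_erase (a := k) Finset.univ _ (Finset.mem_univ k)]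
  simp only [lt_add_iff_pos_right, zero_lt_one, if_true, lt_irrefl, if_false, zero_add]
  rw [add_comm]
  congr 1
  refine Finset.sum_congr rfl fun l hl => ?_
  have : l ≠ k := (Finset.mem_erase.1 hl).1
  have : l.val ≠ k.val := fun h => this (Fin.ext h)
  have e : ((l.val : ℤ) < k.val + 1) ↔ (l.val : ℤ) < k.val := by omega
  simp only [e]

lemma height_zero (α : BString N) : height α 0 = 0 := by
  unfold height
  refine Finset.sum_eq_zero fun k _ => if_neg (by omega)

/-- Away from the abscissa `i + 1`, the `i`-th simple reflection does not change heights. -/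
lemma height_sAct_of_ne (i : Fin N) (α : BString N) {x : ℤ} (hx0 : 0 ≤ x) (hxN : x ≤ N)
    (hx : x ≠ i.val + 1) : height (sAct i α) x = height α x := by
  obtain ⟨n, rfl⟩ := Int.eq_ofNat_of_zero_le hx0
  by_cases hlt : n < i.val + 1
  · refine height_congr _ fun k hk => ?_
    exact sAct_apply_of_ne i k (by omega) (by omega) α
  · have : i.val + 2 ≤ n := by omega
    clear hlt hx hx0
    have hN : i.val + 1 < N := by omega
    obtain ⟨j, hij⟩ : ∃ j : Fin N, i.val + 1 = j.val := ⟨⟨i.val + 1, hN⟩, rfl⟩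
    induction n, this using Nat.le_induction with
    | base =>
      have h1 := height_succ (sAct i α) j
      have h2 := height_succ (sAct i α) i
      have h3 := height_succ α j
      have h4 := height_succ α i
      have h5 : height (sAct i α) (i.val : ℤ) = height α (i.val : ℤ) := by
        refine height_congr _ fun k hk => ?_
        exact sAct_apply_of_ne i k (by omega) (by omega) α
      have e1 : ((i.val + 2 : ℕ) : ℤ) = (j.val : ℤ) + 1 := by omega
      have e2 : (j.val : ℤ) = (i.val : ℤ) + 1 := by omega
      rw [sAct_apply_next i j hij] at h1
      rw [sAct_apply_self i j hij] at h2
      rw [e1, h1, h3, e2, h2, h4, h5]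
      ring
    | succ n hn ih =>
      have h1 := height_succ (sAct i α) ⟨n, by omega⟩
      have h2 := height_succ α ⟨n, by omega⟩
      have h3 := ih (by omega)
      simp only at h1 h2
      push_cast at h1 h2 h3 ⊢
      rw [h1, h2, h3, sAct_apply_of_ne i ⟨n, _⟩ (by intro h; have := congrArg Fin.val h; simp at this; omega)
        (by simp; omega)]

lemma height_sAct_le (i : Fin N) (α : BString N) :
    height (sAct i α) (i.val + 1) ≤ height α i.val + 1 := by
  rw [height_succ, height_sAct_of_ne i α (by omega) (by omega) (by omega)]
  split_ifs <;> omega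

lemma height_sAct_raises (i : Fin N) (α : BString N) (h : Raises i α) :
    height (sAct i α) (i.val + 1) = height α i.val + 1 := by
  rw [height_succ, height_sAct_of_ne i α (by omega) (by omega) (by omega)]
  have : sAct i α i = true := by
    by_cases hi : i.val + 1 < N
    · rw [sAct_apply_self i ⟨i.val + 1, hi⟩ rfl]; exact h.2 hi
    · rw [sAct_last_self i (by omega), h.1]; rfl
  rw [this]; simp

lemma height_succ_raises (i : Fin N) (α : BString N) (h : Raises i α) :
    height α (i.val + 1) = height α i.val - 1 := by
  rw [height_succ, h.1]; simp; ring

/-- The hypothesis forces every letter of ω to act by a raising step. Such a step changes the height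
only at i + 1, where the raised path takes the largest value compatible with its height at i; so a
subword cannot overtake it. -/
lemma height_le_of_sublist (ω : List (Fin N))
    (hω : (word (strAct N ((cox N).wordProd ω) (allOnes N))).length = ω.length)
    (ω' : List (Fin N)) (hs : ω'.Sublist ω) (x : ℤ) (hx0 : 0 ≤ x) (hxN : x ≤ N) :
    height (strAct N ((cox N).wordProd ω') (allOnes N)) x ≤
      height (strAct N ((cox N).wordProd ω) (allOnes N)) x := by
  induction ω generalizing ω' x with
  | nil => rw [List.sublist_nil.1 hs]
  | cons i ω ih =>
    rw [strAct_wordProd_cons] at hω ⊢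
    have h1 := word_length_strAct_le ω
    have h2 := word_length_sAct_le i (strAct N ((cox N).wordProd ω) (allOnes N))
    simp only [List.length_cons] at hω
    have hr := h2.2 (by omega)
    have ih' := ih (by omega)
    generalize strAct N ((cox N).wordProd ω) (allOnes N) = β at *
    have hup : height β x ≤ height (sAct i β) x := by
      by_cases hx : x = i.val + 1
      · rw [hx, height_sAct_raises i β hr, height_succ_raises i β hr]; omega
      · rw [height_sAct_of_ne i β hx0 hxN hx]
    cases hs with
    | cons _ hs => exact (ih' ω' hs x hx0 hxN).trans hup
    | cons_cons _ hs =>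
      rename_i ω''
      rw [strAct_wordProd_cons]
      by_cases hx : x = i.val + 1
      · rw [hx, height_sAct_raises i β hr]
        refine (height_sAct_le i _).trans ?_
        have := ih' ω'' hs i.val (by omega) (by omega)
        omega
      · rw [height_sAct_of_ne i β hx0 hxN hx, height_sAct_of_ne i _ hx0 hxN hx]
        exact ih' ω'' hs x hx0 hxN

/-- The path of the smaller string lies weakly below. -/
lemma height_le_of_StrLE {α β : BString N} (h : StrLE α β) (x : ℤ) (hx0 : 0 ≤ x) (hxN : x ≤ N) :
    height α x ≤ height β x := by
  obtain ⟨ω, h1, h2, ω', hs, h3⟩ := h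
  have e := height_le_of_sublist ω (by
    rw [h2, strAct_minRep, ← length_minRep, ← h2]; exact h1) ω' hs x hx0 hxN
  rwa [h2, h3, strAct_minRep, strAct_minRep] at e

lemma StrLE_refl (α : BString N) : StrLE α α := by
  obtain ⟨ω, h1, h2⟩ := (cox N).exists_isReduced (minRep α)
  exact ⟨ω, h1, h2.symm, ω, List.Sublist.refl _, h2.symm⟩

/-- Prepending i to a reduced word for β keeps it reduced, and a subword for α may be used with or
without the new letter. -/
lemma StrLE_sAct_right {i : Fin N} {α β : BString N} (hβ : Raises i β) (h : StrLE α β) :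
    StrLE α (sAct i β) ∧ StrLE (sAct i α) (sAct i β) := by
  obtain ⟨ω, h1, h2, ω', hs, h3⟩ := h
  have e : (cox N).wordProd (i :: ω) = minRep (sAct i β) := by
    rw [CoxeterSystem.wordProd_cons, h2, minRep_sAct i β hβ]
  have hr : (cox N).IsReduced (i :: ω) := by
    rw [CoxeterSystem.IsReduced, e, length_minRep, word_length_sAct i β hβ, ← length_minRep, ← h2,
      h1.eq, List.length_cons]
  have h4 : StrLE α (sAct i β) := ⟨i :: ω, hr, e, ω', hs.cons i, h3⟩
  refine ⟨h4, ?_⟩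
  rcases raises_trichotomy i α with h | h | h
  · exact ⟨i :: ω, hr, e, i :: ω', hs.cons_cons i, by
      rw [CoxeterSystem.wordProd_cons, h3, minRep_sAct i α h]⟩
  · refine ⟨i :: ω, hr, e, i :: ω', hs.cons_cons i, ?_⟩
    have := minRep_sAct i _ h
    rw [sAct_sAct] at this
    rw [CoxeterSystem.wordProd_cons, h3, this, CoxeterSystem.simple_mul_simple_cancel_left]
  · rw [h]; exact h4

end KLB

namespace KLB

variable {N : ℕ}

/-! ## The bar involution of the module -/

lemma raises_adj {i j : Fin N} (hij : i.val + 1 = j.val) {α : BString N} :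
    Raises i α ↔ α i = false ∧ α j = true := by
  have h : i.val + 1 < N := hij ▸ j.isLt
  have e : ∀ h, (⟨i.val + 1, h⟩ : Fin N) = j := fun h => Fin.ext hij
  simp [Raises, e, h]

lemma raises_last {i : Fin N} (hi : i.val + 1 = N) {α : BString N} :
    Raises i α ↔ α i = false := by
  simp [Raises, hi]

lemma raises_sAct_adj {i j : Fin N} (hij : i.val + 1 = j.val) {α : BString N} :
    Raises i (sAct i α) ↔ α i = true ∧ α j = false := by
  rw [raises_adj hij, sAct_apply_self i j hij, sAct_apply_next i j hij, and_comm]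

lemma raises_sAct_last {i : Fin N} (hi : i.val + 1 = N) {α : BString N} :
    Raises i (sAct i α) ↔ α i = true := by
  rw [raises_last hi, sAct_last_self i hi]; simp

lemma raises_cases (i : Fin N) (α : BString N) :
    Raises i α ∨ Raises i (sAct i α) ∨ ∃ j : Fin N, i.val + 1 = j.val ∧ α i = α j := by
  by_cases h : i.val + 1 < N
  · obtain ⟨j, hij⟩ : ∃ j : Fin N, i.val + 1 = j.val := ⟨⟨i.val + 1, h⟩, rfl⟩
    rw [raises_adj hij, raises_sAct_adj hij]
    by_cases h1 : α i = α j
    · exact Or.inr (Or.inr ⟨j, hij, h1⟩)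
    · revert h1
      cases α i <;> cases α j <;> simp
  · rw [raises_last (by omega), raises_sAct_last (by omega)]
    cases α i <;> simp

lemma TOp_raises {i : Fin N} {α : BString N} (h : Raises i α) :
    TOp i (m α) = m (sAct i α) := by
  rw [TOp_m, TVec]
  by_cases hi : i.val + 1 < N
  · rw [dif_pos hi, h.1, h.2 hi]; simp
  · rw [dif_neg hi, h.1]; simp

lemma TOp_lowers {i : Fin N} {α : BString N} (h : Raises i (sAct i α)) :
    TOp i (m α) = m (sAct i α) + (par i - parInv i) • m α := by
  rw [TOp_m, TVec, par, parInv]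
  by_cases hi : i.val + 1 < N
  · obtain ⟨h1, h2⟩ := (raises_sAct_adj (i := i) (j := ⟨i.val + 1, hi⟩) rfl).1 h
    rw [dif_pos hi, h1, h2]; simp [hi]
  · rw [dif_neg hi, (raises_sAct_last (by omega)).1 h]; simp [hi]

lemma TOp_equal {i j : Fin N} (hij : i.val + 1 = j.val) {α : BString N} (h : α i = α j) :
    TOp i (m α) = -(parInv i • m α) := by
  rw [TOp_rule i j hij, if_pos h, parInv, if_pos (hij ▸ j.isLt)]

lemma act_TInv (i : Fin N) (x : Mod N) :
    act N (TInv i) x = TOp i x - par i • x + parInv i • x := by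
  rw [TInv, map_add, map_sub, act_T, AlgHom.commutes, AlgHom.commutes]
  simp [Module.algebraMap_end_apply]

lemma TOp_act_TInv (i : Fin N) (x : Mod N) : TOp i (act N (TInv i) x) = x := by
  rw [← act_T, ← Module.End.mul_apply, ← map_mul, T_mul_TInv, map_one, Module.End.one_apply]

/-- The braid relation in the form in which `u` passes through `v⁻¹ * u⁻¹` and comes out as `v`. In
the relation of length four, `u` passes through `v⁻¹ * u⁻¹ * v⁻¹` and comes out as itself. -/
lemma group_braid3 {G : Type*} [Group G] {u v : G} (h : u * v * u = v * u * v) :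
    u * v⁻¹ * u⁻¹ = v⁻¹ * u⁻¹ * v := by
  calc u * v⁻¹ * u⁻¹ = v⁻¹ * u⁻¹ * (u * v * u) * v⁻¹ * u⁻¹ := by group
    _ = v⁻¹ * u⁻¹ * v := by rw [h]; group

lemma group_braid4 {G : Type*} [Group G] {u v : G} (h : u * v * u * v = v * u * v * u) :
    u * v⁻¹ * u⁻¹ * v⁻¹ = v⁻¹ * u⁻¹ * v⁻¹ * u := by
  calc u * v⁻¹ * u⁻¹ * v⁻¹ = v⁻¹ * u⁻¹ * v⁻¹ * (v * u * v * u) * v⁻¹ * u⁻¹ * v⁻¹ := by group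
    _ = v⁻¹ * u⁻¹ * v⁻¹ * u := by rw [← h]; group

lemma T_TInv_comm {i j : Fin N} (h : T i * T j = T j * T i) : T i * TInv j = TInv j * T i := by
  have h1 : TUnit i * TUnit j = TUnit j * TUnit i := Units.ext h
  have h2 : TUnit i * (TUnit j)⁻¹ = (TUnit j)⁻¹ * TUnit i := by
    rw [mul_inv_eq_iff_eq_mul, mul_assoc, h1]; group
  exact congrArg Units.val h2

lemma T_TInv_TInv_of_braid3 {i j : Fin N} (h : T i * T j * T i = T j * T i * T j) :
    T i * TInv j * TInv i = TInv j * TInv i * T j := by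
  have h1 : TUnit i * TUnit j * TUnit i = TUnit j * TUnit i * TUnit j := Units.ext h
  exact congrArg Units.val (group_braid3 h1)

lemma T_TInv_TInv_of_braid4 {i j : Fin N} (h : T i * T j * T i * T j = T j * T i * T j * T i) :
    T i * TInv j * TInv i * TInv j = TInv j * TInv i * TInv j * T i := by
  have h1 : TUnit i * TUnit j * TUnit i * TUnit j = TUnit j * TUnit i * TUnit j * TUnit i :=
    Units.ext h
  exact congrArg Units.val (group_braid4 h1)

/-- The image of `m_α` under the bar involution. -/
def barVec (α : BString N) : Mod N := act N (barHecke N (TWord α)) (m (allOnes N))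

lemma barVec_allOnes : barVec (allOnes N) = m (allOnes N) := by
  have : TWord (allOnes N) = 1 := wordImage_allOnes T
  rw [barVec, this, map_one, map_one, Module.End.one_apply]

lemma barVec_sAct {i : Fin N} {α : BString N} (h : Raises i α) :
    barVec (sAct i α) = act N (TInv i) (barVec α) := by
  have : TWord (sAct i α) = T i * TWord α := wordImage_sAct T T_comm i α h
  rw [barVec, this, map_mul, barHecke_T, map_mul, Module.End.mul_apply, barVec]

/-- The definition of the bar involution only provides for raising steps; this eigenvector property
is what remains to be shown for compatibility with the action. Induct on the length, with k the last
raising step. If k is far from i, then T_i commutes with T_k⁻¹. If not, the equal letters determine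
one or two earlier raising steps, and a braid relation moves the claim to a shorter string with two
equal adjacent letters. -/
lemma TOp_barVec_of_equal {i j : Fin N} (hij : i.val + 1 = j.val) {α : BString N}
    (h : α i = α j) : TOp i (barVec α) = -(mon (-1) 0 • barVec α) := by
  induction hn : (word α).length using Nat.strong_induction_on generalizing α i j with
  | _ n ih =>
  by_cases h0 : α = allOnes N
  · rw [h0, barVec_allOnes, TOp_equal hij rfl, parInv, if_pos (hij ▸ j.isLt)]
  obtain ⟨k, α', hk, rfl⟩ := exists_raises α h0
  have hl := word_length_sAct k α' hk
  rw [barVec_sAct hk]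
  have swap : ∀ {a b : Fin N} {x y : Mod N}, T a * TInv b = TInv b * T a →
      TOp a x = y → TOp a (act N (TInv b) x) = act N (TInv b) y := by
    intro a b x y h1 h2
    rw [← act_T, ← Module.End.mul_apply, ← map_mul, h1, map_mul, Module.End.mul_apply, act_T, h2]
  have swap3 : ∀ {a b : Fin N} {x y : Mod N}, T a * T b * T a = T b * T a * T b →
      TOp b x = y → TOp a (act N (TInv b) (act N (TInv a) x)) =
        act N (TInv b) (act N (TInv a) y) := by
    intro a b x y h1 h2
    have h3 := T_TInv_TInv_of_braid3 h1
    rw [← h2, ← act_T, ← act_T]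
    simp only [← Module.End.mul_apply, ← map_mul, ← mul_assoc]
    rw [h3]
  rcases lt_trichotomy k.val j.val with hkj | hkj | hkj
  · by_cases hki : k = i
    · subst hki
      have := (raises_adj hij).1 hk
      rw [sAct_apply_self k j hij, sAct_apply_next k j hij, this.1, this.2] at h
      exact absurd h (by simp)
    by_cases hki' : k.val + 1 = i.val
    -- At k, i, j the letters of α' are 1, 2, 1, obtained from 1, 1, 2 by the step i. The equal
    -- letters now stand at k and i.
    · have hk' := (raises_adj hki').1 hk
      have hj : α' j = false := by
        rw [sAct_apply_next k i hki', sAct_apply_of_ne k j (by omega) (by omega)] at h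
        rw [← h, hk'.1]
      have hr : Raises i (sAct i α') := (raises_sAct_adj hij).2 ⟨hk'.2, hj⟩
      have hl' := word_length_sAct i _ hr
      have eb := barVec_sAct hr
      rw [sAct_sAct] at hl' eb
      have e := ih _ (by omega) hki' (α := sAct i α') (by
        rw [sAct_apply_self i j hij, sAct_apply_of_ne i k (by omega) (by omega), hk'.1, hj]) rfl
      rw [eb, swap3 (T_braid3 k i hki' (by omega)).symm e]
      simp only [map_neg, map_smul]
    · have e := ih _ (by omega) hij (α := α') (by
        rwa [sAct_apply_of_ne k i (by omega) (by omega),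
          sAct_apply_of_ne k j (by omega) (by omega)] at h) rfl
      rw [swap (T_TInv_comm (T_comm k i (by omega)).symm) e]
      simp only [map_neg, map_smul]
  · have hkj : k = j := Fin.ext hkj
    subst hkj
    have hi : sAct k α' i = α' i := sAct_apply_of_ne k i (by omega) (by omega) α'
    rw [hi] at h
    by_cases hN : k.val + 1 < N
    · obtain ⟨l, hkl⟩ : ∃ l : Fin N, k.val + 1 = l.val := ⟨⟨k.val + 1, hN⟩, rfl⟩
      -- At i, k, l the letters of α' are 2, 1, 2, obtained from 1, 2, 2 by the step i. The equal
      -- letters now stand at k and l.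
      have hk' := (raises_adj hkl).1 hk
      rw [sAct_apply_self k l hkl, hk'.2] at h
      have hr : Raises i (sAct i α') := (raises_sAct_adj hij).2 ⟨h, hk'.1⟩
      have hl' := word_length_sAct i _ hr
      have eb := barVec_sAct hr
      rw [sAct_sAct] at hl' eb
      have e := ih _ (by omega) hkl (α := sAct i α') (by
        rw [sAct_apply_next i k hij, sAct_apply_of_ne i l (by omega) (by omega), h, hk'.2]) rfl
      rw [eb, swap3 (T_braid3 i k hij hN) e]
      simp only [map_neg, map_smul]
    -- The last two letters went through 1,1 → 1,2 → 2,1 → 2,2, so T_i passes through three inverses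
    -- and acts on a string ending in 1,1.
    · have hN : k.val + 1 = N := by omega
      have hk' := (raises_last hN).1 hk
      rw [sAct_last_self k hN, hk'] at h
      have h : α' i = true := by simpa using h
      have hr : Raises i (sAct i α') := (raises_sAct_adj hij).2 ⟨h, hk'⟩
      have hl' := word_length_sAct i _ hr
      have eb := barVec_sAct hr
      rw [sAct_sAct] at hl' eb
      have hr2 : Raises k (sAct k (sAct i α')) := (raises_sAct_last hN).2 (by
        rw [sAct_apply_next i k hij, h])
      have hl2 := word_length_sAct k _ hr2
      have eb2 := barVec_sAct hr2
      rw [sAct_sAct] at hl2 eb2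
      have e := ih _ (by omega) hij (α := sAct k (sAct i α')) (by
        rw [sAct_last_self k hN, sAct_apply_next i k hij, h,
          sAct_apply_of_ne k i (by omega) (by omega), sAct_apply_self i k hij, hk']; rfl) rfl
      have h4 := T_TInv_TInv_of_braid4 (T_braid4 i k hij hN)
      rw [eb, eb2]
      generalize barVec (sAct k (sAct i α')) = x at e
      have : TOp i (act N (TInv k) (act N (TInv i) (act N (TInv k) x))) =
          act N (TInv k) (act N (TInv i) (act N (TInv k) (TOp i x))) := by
        rw [← act_T]
        simp only [← Module.End.mul_apply, ← map_mul, ← mul_assoc]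
        rw [h4]
      rw [this, e]
      simp only [map_neg, map_smul]
  · have e := ih _ (by omega) hij (α := α') (by
      rwa [sAct_apply_of_ne k i (by omega) (by omega),
        sAct_apply_of_ne k j (by omega) (by omega)] at h) rfl
    rw [swap (T_TInv_comm (T_comm i k (by omega))) e]
    simp only [map_neg, map_smul]

lemma barMod_add (x y : Mod N) : barMod (x + y) = barMod x + barMod y := by
  unfold barMod
  refine Finsupp.sum_add_index' (fun α => ?_) fun α c d => ?_
  · rw [map_zero, zero_smul]
  · rw [map_add, add_smul]

lemma barMod_smul (c : Coeff) (x : Mod N) : barMod (c • x) = barCoeff c • barMod x := by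
  unfold barMod
  rw [Finsupp.sum_smul_index' (fun α => by rw [map_zero, zero_smul]), Finsupp.smul_sum]
  simp only [smul_eq_mul, map_mul, mul_smul]

lemma barMod_m (α : BString N) : barMod (m α) = barVec α := by
  rw [barMod, m, Finsupp.sum_single_index (by rw [map_zero, zero_smul]), map_one, one_smul, barVec]

lemma barMod_zero : barMod (0 : Mod N) = 0 := by
  simpa using barMod_smul (N := N) 0 0

lemma barMod_neg (x : Mod N) : barMod (-x) = -barMod x := by
  have := barMod_add x (-x)
  rw [add_neg_cancel, barMod_zero] at this
  exact (neg_eq_of_add_eq_zero_right this.symm).symm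

lemma barMod_sum {ι : Type*} (s : Finset ι) (f : ι → Mod N) :
    barMod (∑ i ∈ s, f i) = ∑ i ∈ s, barMod (f i) := by
  induction s using Finset.induction_on with
  | empty => simp [barMod_zero]
  | insert a s ha ih => rw [Finset.sum_insert ha, Finset.sum_insert ha, barMod_add, ih]

/-- The bar involution of the module is compatible with that of the Hecke algebra. -/
lemma barMod_TOp (i : Fin N) (x : Mod N) : barMod (TOp i x) = act N (TInv i) (barMod x) := by
  induction x using Finsupp.induction_linear with
  | zero => rw [map_zero, barMod_zero, map_zero]
  | add x y hx hy => rw [map_add, barMod_add, barMod_add, hx, hy, map_add]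
  | single α c =>
    have e : (Finsupp.single α c : Mod N) = c • m α := by simp [m]
    rw [e, map_smul, barMod_smul, barMod_smul, map_smul, barMod_m]
    congr 1
    rcases raises_cases i α with h | h | ⟨j, hij, h⟩
    · rw [TOp_raises h, barMod_m, barVec_sAct h]
    · have eb := barVec_sAct h
      rw [sAct_sAct] at eb
      rw [TOp_lowers h, barMod_add, barMod_smul, barMod_m, barMod_m, map_sub, barCoeff_par,
        barCoeff_parInv, act_TInv]
      have : TOp i (barVec α) = barVec (sAct i α) := by rw [eb, TOp_act_TInv]
      rw [this, sub_smul]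
      abel
    · rw [TOp_equal hij h, barMod_neg, barMod_smul, barMod_m, barCoeff_parInv, act_TInv,
        TOp_barVec_of_equal hij h, parInv, if_pos (hij ▸ j.isLt)]
      abel

/-- The Kazhdan--Lusztig generators `T_i + p⁻¹` preserve bar invariance. -/
lemma barMod_TOp_add (i : Fin N) {x : Mod N} (hx : barMod x = x) :
    barMod (TOp i x + parInv i • x) = TOp i x + parInv i • x := by
  rw [barMod_add, barMod_TOp, barMod_smul, hx, barCoeff_parInv, act_TInv]
  abel

end KLB

namespace KLB

variable {N : ℕ}

/-! ## The monomial basis, computed by reading two strings from left to right -/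

/-- The weight of the flip flags of the unpaired `2`s, listed from the right; the Boolean parameter
is the parity of the number of the ones already read. -/
def openWeight : Bool → List Bool → Coeff
  | _, [] => 1
  | p, f :: σ => (if f then (if p then mon (-1) 1 else mon 0 (-1)) else 1) * openWeight (!p) σ

/-- Reading the letters of `β` and `α` from left to right, with the stack of the flip flags of the
open `2`s of `β`: the weight of `α` in the basis vector of `β`. -/
def readWeight : List Bool → List (Bool × Bool) → Coeff
  | σ, [] => openWeight false σ
  | σ, (true, a) :: r => readWeight ((!a) :: σ) r
  | [], (false, a) :: r => if a then 0 else readWeight [] r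
  | f :: σ, (false, a) :: r =>
    if a = f then (if f then mon (-1) 0 else 1) * readWeight σ r else 0

/-- Ranks are counted from the right, so an unflipped entry at the bottom of the stack changes no
other rank and has weight 1. -/
lemma openWeight_append_false (p : Bool) (σ : List Bool) :
    openWeight p (σ ++ [false]) = openWeight p σ := by
  induction σ generalizing p with
  | nil => simp [openWeight]
  | cons f σ ih => simp [openWeight, ih]

/-- A letter 1 of β that meets an unflipped bottom entry or an empty stack must in both cases be a 1
in α. -/
lemma readWeight_append_false (r : List (Bool × Bool)) (σ : List Bool) :
    readWeight (σ ++ [false]) r = readWeight σ r := by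
  induction r generalizing σ with
  | nil => simp [readWeight, openWeight_append_false]
  | cons x r ih =>
    obtain ⟨b, a⟩ := x
    cases b
    · cases σ with
      | nil => cases a <;> simp [readWeight]
      | cons f σ => simp [readWeight, ih]
    · simpa [readWeight] using ih ((!a) :: σ)

/-- A prefix acts only through a scalar and a resulting stack. Identities between coefficients of
strings with a common prefix can therefore be checked locally, for an arbitrary stack. -/
lemma readWeight_append (l : List (Bool × Bool)) (σ : List Bool) :
    ∃ w τ, ∀ r, readWeight σ (l ++ r) = w * readWeight τ r := by
  induction l generalizing σ with
  | nil => exact ⟨1, σ, fun r => by simp⟩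
  | cons x l ih =>
    obtain ⟨b, a⟩ := x
    cases b
    · cases σ with
      | nil =>
        cases a
        · obtain ⟨w, τ, h⟩ := ih []
          exact ⟨w, τ, fun r => by simp [readWeight, h]⟩
        · exact ⟨0, [], fun r => by simp [readWeight]⟩
      | cons f σ =>
        obtain ⟨w, τ, h⟩ := ih σ
        by_cases ha : a = f
        · exact ⟨(if f then mon (-1) 0 else 1) * w, τ, fun r => by
            simp [readWeight, h, ha, mul_assoc]⟩
        · exact ⟨0, [], fun r => by simp [readWeight, ha]⟩
    · obtain ⟨w, τ, h⟩ := ih ((!a) :: σ)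
      exact ⟨w, τ, fun r => by simp [readWeight, h]⟩

lemma readWeight_pair (τ : List Bool) (a b : Bool) (r : List (Bool × Bool)) :
    readWeight τ ((true, a) :: (false, b) :: r) =
      if a = b then 0 else (if a then 1 else mon (-1) 0) * readWeight τ r := by
  cases a <;> cases b <;> simp [readWeight]

lemma mon_mul_inv_left : mon 1 0 * mon (-1) 0 = 1 := by simp [mon_mul, mon_zero]

/-- The letter 1 closes the top arc and the letter 2 opens another. The only nonzero term is the one
where the new flag equals the old one, so the stack is restored; the factor t cancels the t⁻¹ of a
flipped arc. -/
lemma readWeight_swap (τ : List Bool) (r : List (Bool × Bool)) :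
    readWeight τ ((false, false) :: (true, true) :: r) +
      mon 1 0 * readWeight τ ((false, true) :: (true, false) :: r) = readWeight τ r := by
  cases τ with
  | nil => simpa [readWeight] using readWeight_append_false r []
  | cons f τ => cases f <;> simp [readWeight, ← mul_assoc, mon_mul_inv_left]

/-- A final 2 makes the top arc of the stack the second unpaired one from the right, of weight
t⁻¹t_N if flipped. A final 1 closes this arc with weight t⁻¹ instead. The parities of all the arcs
below agree in the two cases. -/
lemma readWeight_last (τ : List Bool) :
    readWeight τ [(true, true)] =
      readWeight τ [(false, false)] + mon 0 1 * readWeight τ [(false, true)] := by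
  cases τ with
  | nil => simp [readWeight, openWeight]
  | cons f τ => cases f <;> simp [readWeight, openWeight, ← mul_assoc, mon_mul]

lemma readWeight_last_false (τ : List Bool) :
    readWeight τ [(true, false)] = mon 0 (-1) * readWeight τ [(true, true)] := by
  simp [readWeight, openWeight]

/-- The coefficient of `m_α` in the basis vector of `β`. -/
def flipCoeff (α β : BString N) : Coeff :=
  readWeight [] (List.ofFn fun k => (β k, α k))

lemma flipCoeff_adj (i j : Fin N) (hij : i.val + 1 = j.val) :
    ∃ s t : List (Fin N), (∀ p ∈ s, p ≠ i ∧ p ≠ j) ∧ (∀ p ∈ t, p ≠ i ∧ p ≠ j) ∧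
      ∀ α β : BString N, flipCoeff α β = readWeight [] (s.map (fun k => (β k, α k)) ++
        (β i, α i) :: (β j, α j) :: t.map fun k => (β k, α k)) := by
  obtain ⟨s, t, h, hs, ht⟩ := finRange_split_adj i j hij
  refine ⟨s, t, fun p hp => ?_, fun p hp => ?_, fun α β => ?_⟩
  · have := hs p hp
    constructor <;> omega
  · have := ht p hp
    constructor <;> omega
  · rw [flipCoeff, List.ofFn_eq_map, h]
    simp

lemma flipCoeff_last (i : Fin N) (hi : i.val + 1 = N) :
    ∃ s : List (Fin N), (∀ p ∈ s, p ≠ i) ∧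
      ∀ α β : BString N, flipCoeff α β = readWeight [] (s.map (fun k => (β k, α k)) ++
        [(β i, α i)]) := by
  obtain ⟨s, t, h, hs, ht⟩ := finRange_split i
  have ht0 : t = [] := by
    rw [List.eq_nil_iff_forall_not_mem]
    intro p hp
    have := ht p hp
    omega
  subst ht0
  refine ⟨s, fun p hp => (hs p hp).ne, fun α β => ?_⟩
  rw [flipCoeff, List.ofFn_eq_map, h]
  simp

lemma flipCoeff_sAct_of_equal {i j : Fin N} (hij : i.val + 1 = j.val) {α γ : BString N}
    (hγ : Raises i γ) (hα : α i = α j) : flipCoeff α (sAct i γ) = 0 := by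
  obtain ⟨s, t, -, -, h⟩ := flipCoeff_adj i j hij
  have hγ' := (raises_adj hij).1 hγ
  obtain ⟨w, τ, hw⟩ := readWeight_append (s.map fun k => (sAct i γ k, α k)) []
  rw [h, hw, sAct_apply_self i j hij, sAct_apply_next i j hij, hγ'.1, hγ'.2, hα, readWeight_pair]
  simp

/-- The coefficient form of multiplication by T_i + p⁻¹. After the common prefix is removed it
reduces to the local rules for the letters moved by s_i. -/
lemma flipCoeff_sAct {i : Fin N} {α γ : BString N} (hγ : Raises i γ) (hα : Raises i α) :
    flipCoeff (sAct i α) (sAct i γ) =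
        flipCoeff α γ + par i * flipCoeff (sAct i α) γ ∧
      flipCoeff α (sAct i γ) = parInv i * flipCoeff (sAct i α) (sAct i γ) := by
  by_cases hi : i.val + 1 < N
  · obtain ⟨j, hij⟩ : ∃ j : Fin N, i.val + 1 = j.val := ⟨⟨i.val + 1, hi⟩, rfl⟩
    obtain ⟨s, t, hs, ht, h⟩ := flipCoeff_adj i j hij
    have hγ' := (raises_adj hij).1 hγ
    have hα' := (raises_adj hij).1 hα
    have e : ∀ (δ : BString N) (p : Fin N), p ≠ i ∧ p ≠ j → sAct i δ p = δ p :=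
      fun δ p hp => sAct_apply_of_ne i p hp.1 (by intro hc; exact hp.2 (Fin.ext (by omega))) δ
    have es : ∀ δ ε : BString N, (∀ p, p ≠ i ∧ p ≠ j → δ p = γ p) →
        (∀ p, p ≠ i ∧ p ≠ j → ε p = α p) →
        s.map (fun k => (δ k, ε k)) = s.map (fun k => (γ k, α k)) := fun δ ε h1 h2 =>
      List.map_congr_left fun p hp => by rw [h1 p (hs p hp), h2 p (hs p hp)]
    have et : ∀ δ ε : BString N, (∀ p, p ≠ i ∧ p ≠ j → δ p = γ p) →
        (∀ p, p ≠ i ∧ p ≠ j → ε p = α p) →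
        t.map (fun k => (δ k, ε k)) = t.map (fun k => (γ k, α k)) := fun δ ε h1 h2 =>
      List.map_congr_left fun p hp => by rw [h1 p (ht p hp), h2 p (ht p hp)]
    obtain ⟨w, τ, hw⟩ := readWeight_append (s.map fun k => (γ k, α k)) []
    simp only [h, sAct_apply_self i j hij, sAct_apply_next i j hij, hγ'.1, hγ'.2, hα'.1, hα'.2]
    rw [es _ _ (e γ) (e α), et _ _ (e γ) (e α), es _ _ (fun _ _ => rfl) (e α),
      et _ _ (fun _ _ => rfl) (e α), es _ _ (e γ) (fun _ _ => rfl),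
      et _ _ (e γ) (fun _ _ => rfl), hw, hw, hw, hw, par, parInv, if_pos hi, if_pos hi,
      readWeight_pair, readWeight_pair]
    constructor
    · rw [← readWeight_swap τ]
      simp only [Bool.true_eq_false, if_false, if_true]
      ring
    · simp only [Bool.true_eq_false, Bool.false_eq_true, if_false, if_true]
      ring
  · have hi' : i.val + 1 = N := by omega
    obtain ⟨s, hs, h⟩ := flipCoeff_last i hi'
    have e : ∀ (δ : BString N) (p : Fin N), p ≠ i → sAct i δ p = δ p :=
      fun δ p hp => sAct_apply_of_ne i p hp (by omega) δ
    have es : ∀ δ ε : BString N, (∀ p, p ≠ i → δ p = γ p) → (∀ p, p ≠ i → ε p = α p) →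
        s.map (fun k => (δ k, ε k)) = s.map (fun k => (γ k, α k)) := fun δ ε h1 h2 =>
      List.map_congr_left fun p hp => by rw [h1 p (hs p hp), h2 p (hs p hp)]
    obtain ⟨w, τ, hw⟩ := readWeight_append (s.map fun k => (γ k, α k)) []
    simp only [h, sAct_last_self i hi', hγ.1, hα.1]
    rw [es _ _ (e γ) (e α), es _ _ (fun _ _ => rfl) (e α), es _ _ (e γ) (fun _ _ => rfl),
      hw, hw, hw, hw, par, parInv, if_neg hi, if_neg hi]
    simp only [Bool.not_false]
    rw [readWeight_last_false, readWeight_last]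
    constructor <;> ring

lemma flipCoeff_allOnes (α : BString N) :
    flipCoeff α (allOnes N) = if α = allOnes N then 1 else 0 := by
  have key : ∀ l : List (Fin N), readWeight [] (l.map fun k => (allOnes N k, α k)) =
      if ∀ k ∈ l, α k = false then 1 else 0 := by
    intro l
    induction l with
    | nil => simp [readWeight, openWeight]
    | cons k l ih =>
      have e : allOnes N k = false := rfl
      cases hk : α k <;> simp [readWeight, ih, hk, e]
  rw [flipCoeff, List.ofFn_eq_map, key]
  congr 1
  simp [funext_iff, allOnes]

/-- A nonzero coefficient only occurs for a smaller string. -/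
lemma StrLE_of_flipCoeff_ne_zero {α β : BString N} (h : flipCoeff α β ≠ 0) : StrLE α β := by
  induction β using raising_induction generalizing α with
  | h0 =>
    rw [flipCoeff_allOnes] at h
    have : α = allOnes N := by by_contra hc; simp [hc] at h
    rw [this]
    exact StrLE_refl _
  | h1 i γ hγ ih =>
    have key : ∀ δ, Raises i δ → flipCoeff (sAct i δ) (sAct i γ) ≠ 0 →
        StrLE δ (sAct i γ) ∧ StrLE (sAct i δ) (sAct i γ) := by
      intro δ hδ h0
      rw [(flipCoeff_sAct hγ hδ).1] at h0
      -- At least one summand is nonzero. Either way the relation lifts from γ to s_iγ, for both δ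
      -- and s_iδ.
      by_cases h1 : flipCoeff δ γ = 0
      · have h2 : flipCoeff (sAct i δ) γ ≠ 0 := by
          intro h2; exact h0 (by rw [h1, h2, mul_zero, add_zero])
        have := StrLE_sAct_right hγ (ih h2)
        rw [sAct_sAct] at this
        exact this.symm
      · exact StrLE_sAct_right hγ (ih h1)
    rcases raises_cases i α with hα | hα | ⟨j, hij, hα⟩
    · refine (key α hα ?_).1
      intro h0
      exact h (by rw [(flipCoeff_sAct hγ hα).2, h0, mul_zero])
    · have := (key _ hα (by rwa [sAct_sAct])).2
      rwa [sAct_sAct] at this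
    · exact absurd (flipCoeff_sAct_of_equal hij hγ hα) h

/-! ### Bar invariance of the monomial basis vectors -/

/-- The vector `∑ flipCoeff α β m_α`. -/
def flipVec (β : BString N) : Mod N := Finsupp.equivFunOnFinite.symm fun α => flipCoeff α β

lemma flipVec_apply (α β : BString N) : flipVec β α = flipCoeff α β := rfl

lemma not_raises_sAct {i : Fin N} {α : BString N} (h : Raises i α) : ¬ Raises i (sAct i α) := by
  intro h'
  by_cases hi : i.val + 1 < N
  · have := (raises_sAct_adj (j := ⟨i.val + 1, hi⟩) rfl).1 h'
    rw [h.1] at this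
    exact absurd this.1 (by simp)
  · have := (raises_sAct_last (by omega)).1 h'
    rw [h.1] at this
    exact absurd this (by simp)

lemma sAct_eq_iff (i : Fin N) (α γ : BString N) : sAct i γ = α ↔ γ = sAct i α :=
  ⟨fun h => by rw [← h, sAct_sAct], fun h => by rw [h, sAct_sAct]⟩

lemma m_apply (γ α : BString N) : m γ α = if γ = α then 1 else 0 := by
  rw [m, Finsupp.single_apply]

/-- The action is transposed to coefficients, because the vectors `flipVec` are known only through
theirs. -/
lemma TOp_apply (i : Fin N) (x : Mod N) (α : BString N) : TOp i x α =
    if Raises i α then x (sAct i α)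
    else if Raises i (sAct i α) then x (sAct i α) + (par i - parInv i) * x α
    else -(parInv i * x α) := by
  induction x using Finsupp.induction_linear with
  | zero => simp
  | add x y hx hy =>
    rw [map_add, Finsupp.add_apply, hx, hy]
    split_ifs <;> simp only [Finsupp.add_apply] <;> ring
  | single γ c =>
    have e : (Finsupp.single γ c : Mod N) = c • m γ := by simp [m]
    rw [e, map_smul]
    rcases raises_cases i γ with h | h | ⟨j, hij, h⟩
    · rw [TOp_raises h]
      simp only [Finsupp.smul_apply, smul_eq_mul, m_apply, sAct_eq_iff]
      by_cases h1 : γ = α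
      · subst h1
        simp [h]
      · by_cases h2 : γ = sAct i α
        · subst h2
          have h3 : ¬ Raises i α := fun hc => not_raises_sAct hc h
          simp [h, h3, h1]
        · simp [h1, h2]
    · rw [TOp_lowers h]
      simp only [Finsupp.smul_apply, Finsupp.add_apply, smul_eq_mul, m_apply, sAct_eq_iff]
      have h0 : ¬ Raises i γ := fun hc => not_raises_sAct hc h
      by_cases h1 : γ = α
      · subst h1
        have h2 : γ ≠ sAct i γ := fun hc => h0 (by rwa [← hc] at h)
        simp [h, h0, h2, mul_comm]
      · by_cases h2 : γ = sAct i α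
        · subst h2
          rw [sAct_sAct] at h
          simp [h, h1]
        · simp [h1, h2]
    · rw [TOp_equal hij h]
      simp only [Finsupp.smul_apply, Finsupp.neg_apply, smul_eq_mul, m_apply]
      have h0 : ¬ Raises i γ := by
        rw [raises_adj hij, h]; simp
      have h0' : ¬ Raises i (sAct i γ) := by
        rw [raises_sAct_adj hij, h]; simp
      have hs : sAct i γ = γ := ((raises_trichotomy i γ).resolve_left h0).resolve_left h0'
      by_cases h1 : γ = α
      · subst h1
        simp [h0, h0', mul_comm]
      · have h2 : γ ≠ sAct i α := fun hc => h1 (by rw [← hs, hc, sAct_sAct])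
        simp [h1, h2]

/-- This recursion is the source of bar invariance: every vector arises from m_{1⋯1} by operators
T_i + p⁻¹ alone, without correction terms. -/
lemma flipVec_sAct {i : Fin N} {γ : BString N} (hγ : Raises i γ) :
    flipVec (sAct i γ) = TOp i (flipVec γ) + parInv i • flipVec γ := by
  ext1 α
  rw [Finsupp.add_apply, TOp_apply, Finsupp.smul_apply, smul_eq_mul]
  simp only [flipVec_apply]
  have hp := par_mul_parInv i
  rcases raises_cases i α with h | h | ⟨j, hij, h⟩
  · obtain ⟨h1, h2⟩ := flipCoeff_sAct hγ h
    rw [if_pos h, h2, h1]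
    linear_combination flipCoeff (sAct i α) γ * hp
  · obtain ⟨h1, h2⟩ := flipCoeff_sAct hγ h
    rw [sAct_sAct] at h1
    rw [if_neg (fun hc => not_raises_sAct hc h), if_pos h, h1]
    ring
  · rw [if_neg (by rw [raises_adj hij, h]; simp), if_neg (by rw [raises_sAct_adj hij, h]; simp),
      flipCoeff_sAct_of_equal hij hγ h]
    ring

lemma barMod_flipVec (β : BString N) : barMod (flipVec β) = flipVec β := by
  induction β using raising_induction with
  | h0 =>
    have : flipVec (allOnes N) = m (allOnes N) := by
      ext1 α
      rw [flipVec_apply, flipCoeff_allOnes, m_apply]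
      simp only [eq_comm]
    rw [this, barMod_m, barVec_allOnes]
  | h1 i γ hγ ih => rw [flipVec_sAct hγ, barMod_TOp_add i ih]

end KLB

namespace KLB

variable {N : ℕ}

/-! ## Arcs of a path -/

/-- A path with steps `(1, ±1)` on `[0, N]`, starting at the origin. -/
structure IsPath (N : ℕ) (h : ℤ → ℤ) : Prop where
  zero : h 0 = 0
  step : ∀ x : ℤ, 0 ≤ x → x < N → h (x + 1) = h x + 1 ∨ h (x + 1) = h x - 1

lemma height_up_iff (α : BString N) (k : Fin N) :
    height α k.val < height α (k.val + 1) ↔ α k = true := by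
  rw [height_succ]; split_ifs with h <;> simp_all

lemma height_down_iff (α : BString N) (k : Fin N) :
    height α (k.val + 1) < height α k.val ↔ α k = false := by
  rw [height_succ]; split_ifs with h <;> simp_all

lemma isPath_height (α : BString N) : IsPath N (height α) where
  zero := height_zero α
  step x h0 hN := by
    obtain ⟨n, rfl⟩ := Int.eq_ofNat_of_zero_le h0
    have := height_succ α ⟨n, by omega⟩
    simp only at this
    rw [this]
    split_ifs
    · exact Or.inl rfl
    · exact Or.inr rfl

lemma IsPath.bounds {h : ℤ → ℤ} (hp : IsPath N h) {x : ℤ} (h0 : 0 ≤ x) (hN : x ≤ N) :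
    -x ≤ h x ∧ h x ≤ x ∧ Even (h x + x) := by
  obtain ⟨n, rfl⟩ := Int.eq_ofNat_of_zero_le h0
  induction n with
  | zero => simp [hp.zero]
  | succ n ih =>
    obtain ⟨h1, h2, h3⟩ := ih (by omega) (by omega)
    push_cast at *
    rw [Int.even_iff] at *
    rcases hp.step n (by omega) (by omega) with h | h <;> rw [h] <;>
      refine ⟨?_, ?_, ?_⟩ <;> omega

/-- The arc of the up step from `i` to `i + 1` covers the abscissa `x`: the path stays weakly above
the height at `i + 1` up to `x`. -/
def Cov (h : ℤ → ℤ) (i x : ℤ) : Prop := i < x ∧ ∀ y, i < y → y ≤ x → h (i + 1) ≤ h y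

/-- The positions of the up steps of `h` which are down steps of `g`. -/
def flips (N : ℕ) (h g : ℤ → ℤ) : Finset ℤ :=
  (Finset.Ico 0 (N : ℤ)).filter (fun i => h i < h (i + 1) ∧ g (i + 1) < g i)

/-- The path `g` is obtained from `h` by flipping arcs. -/
def IsFlip (N : ℕ) (h g : ℤ → ℤ) : Prop :=
  ∀ x : ℤ, 0 ≤ x → x ≤ N → g x = h x - 2 * ((flips N h g).filter (fun i => Cov h i x)).card

/-- The contribution of a flipped arc. -/
def arcWeight (N : ℕ) (h : ℤ → ℤ) (i : ℤ) : Coeff :=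
  if Cov h i N then (if Even (h N - h (i + 1)) then mon 0 (-1) else mon (-1) 1) else mon (-1) 0

lemma mem_flips {h g : ℤ → ℤ} {i : ℤ} :
    i ∈ flips N h g ↔ (0 ≤ i ∧ i < N) ∧ h i < h (i + 1) ∧ g (i + 1) < g i := by
  simp [flips]

lemma Cov.mono {h : ℤ → ℤ} {i x y : ℤ} (hc : Cov h i x) (h1 : i < y) (h2 : y ≤ x) : Cov h i y :=
  ⟨h1, fun z hz hz' => hc.2 z hz (hz'.trans h2)⟩

lemma Cov.self (h : ℤ → ℤ) (i : ℤ) : Cov h i (i + 1) :=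
  ⟨by omega, fun y h1 h2 => by rw [show y = i + 1 by omega]⟩

lemma Cov.succ {h : ℤ → ℤ} {i x : ℤ} (hc : Cov h i x) (h1 : h (i + 1) ≤ h (x + 1)) :
    Cov h i (x + 1) := by
  refine ⟨by have := hc.1; omega, fun y hy hy' => ?_⟩
  by_cases hx : y ≤ x
  · exact hc.2 y hy hx
  · rwa [show y = x + 1 by omega]

/-- The open arcs at the abscissa `k`, from right to left. -/
def openArcs (h : ℤ → ℤ) : ℕ → List ℤ
  | 0 => []
  | k + 1 => if h k < h (k + 1) then (k : ℤ) :: openArcs h k else (openArcs h k).tail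

/-- Each arc opened later and still open accounts for exactly one unit of height. -/
lemma openArcs_index {h : ℤ → ℤ} (hp : IsPath N h) (k : ℕ) (hk : k ≤ N) (l₁ l₂ : List ℤ) (i : ℤ)
    (e : openArcs h k = l₁ ++ i :: l₂) : (l₁.length : ℤ) = h k - h (i + 1) := by
  induction k generalizing l₁ with
  | zero => simp [openArcs] at e
  | succ k ih =>
    rw [openArcs] at e
    split_ifs at e with hu
    · have hs : h (k + 1) = h k + 1 := by
        rcases hp.step k (by omega) (by omega) with h1 | h1 <;> omega
      cases l₁ with
      | nil =>
        simp only [List.nil_append, List.cons.injEq] at e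
        rw [← e.1]; simp
      | cons a l₁ =>
        simp only [List.cons_append, List.cons.injEq] at e
        have := ih (by omega) l₁ e.2
        push_cast [List.length_cons]
        omega
    · have hs : h (k + 1) = h k - 1 := by
        rcases hp.step k (by omega) (by omega) with h1 | h1 <;> omega
      cases ho : openArcs h k with
      | nil => rw [ho] at e; simp at e
      | cons a l =>
        rw [ho, List.tail_cons] at e
        have := ih (by omega) (a :: l₁) (by rw [ho, e]; rfl)
        push_cast [List.length_cons] at this ⊢
        omega

/-- A down step ends the top arc and no other: by `openArcs_index` the arcs below it have starting
heights that are still not above the new height. -/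
lemma mem_openArcs {h : ℤ → ℤ} (hp : IsPath N h) (k : ℕ) (hk : k ≤ N) (i : ℤ) :
    i ∈ openArcs h k ↔ 0 ≤ i ∧ h i < h (i + 1) ∧ Cov h i k := by
  induction k with
  | zero =>
    simp only [openArcs, List.not_mem_nil, false_iff]
    rintro ⟨h0, -, h1, -⟩
    push_cast at h1
    omega
  | succ k ih =>
    rw [openArcs]
    push_cast
    split_ifs with hu
    · rw [List.mem_cons, ih (by omega)]
      constructor
      · rintro (rfl | ⟨h1, h2, h3⟩)
        · exact ⟨by omega, hu, Cov.self h _⟩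
        · refine ⟨h1, h2, h3.succ ?_⟩
          have := h3.2 k h3.1 le_rfl
          omega
      · rintro ⟨h1, h2, h3⟩
        by_cases hik : i = k
        · exact Or.inl hik
        · exact Or.inr ⟨h1, h2, h3.mono (by have := h3.1; omega) (by omega)⟩
    · have hs : h (k + 1) = h k - 1 := by
        rcases hp.step k (by omega) (by omega) with h1 | h1 <;> omega
      constructor
      · intro hi
        have hi' : i ∈ openArcs h k := List.mem_of_mem_tail hi
        obtain ⟨h1, h2, h3⟩ := (ih (by omega)).1 hi'
        refine ⟨h1, h2, h3.succ ?_⟩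
        cases ho : openArcs h k with
        | nil => rw [ho] at hi'; simp at hi'
        | cons a l =>
          rw [ho, List.tail_cons] at hi
          obtain ⟨l₁, l₂, rfl⟩ := List.append_of_mem hi
          have := openArcs_index hp k (by omega) (a :: l₁) l₂ i ho
          push_cast [List.length_cons] at this
          omega
      · rintro ⟨h1, h2, h3⟩
        have hik : i ≠ k := by rintro rfl; exact hu h2
        have hi : i ∈ openArcs h k :=
          (ih (by omega)).2 ⟨h1, h2, h3.mono (by have := h3.1; omega) (by omega)⟩
        obtain ⟨l₁, l₂, e⟩ := List.append_of_mem hi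
        have hlen := openArcs_index hp k (by omega) l₁ l₂ i e
        have h4 := h3.2 (k + 1) h3.1 le_rfl
        cases l₁ with
        | nil =>
          simp only [List.length_nil, Nat.cast_zero] at hlen
          omega
        | cons a l₁ => rw [e]; simp

lemma openArcs_nodup {h : ℤ → ℤ} (hp : IsPath N h) (k : ℕ) (hk : k ≤ N) :
    (openArcs h k).Nodup := by
  induction k with
  | zero => exact List.nodup_nil
  | succ k ih =>
    rw [openArcs]
    split_ifs
    · refine List.nodup_cons.2 ⟨fun hc => ?_, ih (by omega)⟩
      exact absurd ((mem_openArcs hp k (by omega) _).1 hc).2.2.1 (lt_irrefl _)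
    · exact (ih (by omega)).tail

/-- The flag of a flipped position. -/
def flag (g : ℤ → ℤ) (i : ℤ) : Bool := decide (g (i + 1) < g i)

lemma openArcs_flips {h : ℤ → ℤ} (hp : IsPath N h) (g : ℤ → ℤ) (k : ℕ) (hk : k ≤ N) :
    (flips N h g).filter (fun i => Cov h i k) = ((openArcs h k).filter (flag g)).toFinset := by
  ext i
  rw [Finset.mem_filter, mem_flips, List.mem_toFinset, List.mem_filter, mem_openArcs hp k hk, flag,
    decide_eq_true_iff]
  constructor
  · rintro ⟨⟨⟨h1, h2⟩, h3, h4⟩, h5⟩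
    exact ⟨⟨h1, h3, h5⟩, h4⟩
  · rintro ⟨⟨h1, h3, h5⟩, h4⟩
    exact ⟨⟨⟨h1, by have := h5.1; omega⟩, h3, h4⟩, h5⟩

lemma card_openArcs_flips {h : ℤ → ℤ} (hp : IsPath N h) (g : ℤ → ℤ) (k : ℕ) (hk : k ≤ N) :
    ((flips N h g).filter (fun i => Cov h i k)).card = (openArcs h k).countP (flag g) := by
  rw [openArcs_flips hp g k hk, List.toFinset_card_of_nodup ((openArcs_nodup hp k hk).filter _),
    List.countP_eq_length_filter]

/-! ### From the stack automaton to a product over flipped arcs -/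

lemma openWeight_map (l : List ℤ) (f : ℤ → Bool) (p : Bool) (w : ℤ → Coeff)
    (hw : ∀ l₁ i l₂, l = l₁ ++ i :: l₂ →
      w i = if (Odd l₁.length ↔ p = true) then mon 0 (-1) else mon (-1) 1) :
    openWeight p (l.map f) = (l.map fun i => if f i then w i else 1).prod := by
  induction l generalizing p with
  | nil => rfl
  | cons a l ih =>
    rw [List.map_cons, List.map_cons, List.prod_cons, openWeight, ih (!p)]
    · have := hw [] a l rfl
      rw [this]
      cases p <;> simp
    · intro l₁ i l₂ e
      rw [hw (a :: l₁) i l₂ (by rw [e]; rfl)]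
      simp only [List.length_cons, Nat.odd_add_one]
      cases p <;> simp

/-- The index of an arc in the final stack is h(N) − h(i + 1), so the parity used by the automaton
is the one used in `arcWeight`. -/
lemma openWeight_openArcs {h : ℤ → ℤ} (hp : IsPath N h) (g : ℤ → ℤ) :
    openWeight false ((openArcs h N).map (flag g)) =
      ∏ i ∈ (flips N h g).filter (fun i => Cov h i N), arcWeight N h i := by
  rw [openWeight_map _ _ _ (arcWeight N h)]
  · rw [openArcs_flips hp g N le_rfl,
      ← List.prod_toFinset _ ((openArcs_nodup hp N le_rfl)), Finset.prod_ite,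
      Finset.prod_const_one, mul_one]
    refine Finset.prod_congr ?_ fun _ _ => rfl
    ext i
    simp
  · intro l₁ i l₂ e
    have h1 := openArcs_index hp N le_rfl l₁ l₂ i e
    have h2 := ((mem_openArcs hp N le_rfl i).1 (by rw [e]; simp)).2.2
    rw [arcWeight, if_pos h2, ← h1]
    simp only [Bool.false_eq_true, iff_false, Nat.not_odd_iff_even, Int.even_coe_nat]

/-- The contribution of the flipped arcs closed before `k`. -/
def closedWeight (N : ℕ) (h g : ℤ → ℤ) (k : ℤ) : Coeff :=
  ∏ i ∈ flips N h g, if i < k ∧ ¬ Cov h i k then mon (-1) 0 else 1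

lemma closedWeight_congr {h g : ℤ → ℤ} {k l : ℤ}
    (hkl : ∀ i ∈ flips N h g, (i < k ∧ ¬ Cov h i k) ↔ (i < l ∧ ¬ Cov h i l)) :
    closedWeight N h g k = closedWeight N h g l :=
  Finset.prod_congr rfl fun i hi => by simp only [hkl i hi]

/-- The invariant of the reading. Either α agrees so far with a flip of β, the stack holds the flags
of the open arcs and the scalar is the weight of the closed ones; or a mismatch has occurred, which
makes the reading zero and rules out a flip for good. -/
lemma readWeight_take (α β : BString N) (k : ℕ) (hk : k ≤ N) :
    ((∀ x : ℕ, x ≤ k → height α x =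
        height β x - 2 * (openArcs (height β) x).countP (flag (height α))) ∧
      ∀ r, readWeight [] ((List.ofFn fun k => (β k, α k)).take k ++ r) =
        closedWeight N (height β) (height α) k *
          readWeight ((openArcs (height β) k).map (flag (height α))) r) ∨
    (¬ (∀ x : ℕ, x ≤ N → height α x =
        height β x - 2 * (openArcs (height β) x).countP (flag (height α))) ∧
      ∀ r, readWeight [] ((List.ofFn fun k => (β k, α k)).take k ++ r) = 0) := by
  have hp := isPath_height β
  induction k with
  | zero =>
    left
    refine ⟨fun x hx => ?_, fun r => ?_⟩
    · have : x = 0 := by omega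
      subst this
      simp [openArcs, height_zero]
    · have : closedWeight N (height β) (height α) (0 : ℕ) = 1 := by
        refine Finset.prod_eq_one fun i hi => ?_
        have := (mem_flips.1 hi).1.1
        rw [if_neg (by push_cast; omega)]
      rw [this]
      simp [openArcs]
  | succ k ih =>
    have hkN : k < N := by omega
    set f : Fin N → Bool × Bool := fun k => (β k, α k) with hf
    have et : ∀ r, (List.ofFn f).take (k + 1) ++ r =
        (List.ofFn f).take k ++ (β ⟨k, hkN⟩, α ⟨k, hkN⟩) :: r := by
      intro r
      rw [List.take_succ_eq_append_getElem (by simpa using hkN)]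
      simp [hf]
    rcases ih (by omega) with ⟨h1, h2⟩ | ⟨h1, h2⟩
    swap
    · exact Or.inr ⟨h1, fun r => by rw [et, h2]⟩
    have hβ := height_succ β ⟨k, hkN⟩
    have hα := height_succ α ⟨k, hkN⟩
    simp only at hβ hα
    have hk0 := h1 k le_rfl
    have hcov : ∀ i : ℤ, i ≠ k → (i < ((k + 1 : ℕ) : ℤ) ↔ i < (k : ℤ)) := by
      intro i hi; push_cast; omega
    by_cases hb : β ⟨k, hkN⟩ = true
    · rw [hb, if_pos rfl] at hβ
      have ho : openArcs (height β) (k + 1) = (k : ℤ) :: openArcs (height β) k := by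
        rw [openArcs, if_pos (by omega)]
      have hfl : flag (height α) k = !(α ⟨k, hkN⟩) := by
        rw [flag]
        cases ha : α ⟨k, hkN⟩ <;> rw [ha] at hα <;> simp at hα ⊢ <;> omega
      left
      refine ⟨fun x hx => ?_, fun r => ?_⟩
      · by_cases hx' : x ≤ k
        · exact h1 x hx'
        · have : x = k + 1 := by omega
          subst this
          rw [ho, List.countP_cons, hfl]
          push_cast
          rw [hα, hβ, hk0]
          cases α ⟨k, hkN⟩ <;> simp <;> ring
      · rw [et, h2, hb, ho, readWeight, List.map_cons, hfl]
        congr 1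
        refine closedWeight_congr fun i hi => ?_
        by_cases hik : i = k
        · subst hik
          have := Cov.self (height β) k
          push_cast
          simp [this]
        · rw [hcov i hik]
          refine and_congr_right fun hlt => not_congr ?_
          push_cast
          refine ⟨fun h => h.succ ?_, fun h => h.mono hlt (by omega)⟩
          have := h.2 k h.1 le_rfl
          omega
    · have hb : β ⟨k, hkN⟩ = false := by simpa using hb
      rw [hb] at hβ
      simp only [Bool.false_eq_true, if_false] at hβ
      have ho : openArcs (height β) (k + 1) = (openArcs (height β) k).tail := by
        rw [openArcs, if_neg (by omega)]
      have hnk : ∀ i ∈ flips N (height β) (height α), i ≠ k := by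
        rintro i hi rfl
        have := (mem_flips.1 hi).2.1
        omega
      have hmem := mem_openArcs hp k hkN.le
      have hmem' := mem_openArcs hp (k + 1) (by omega)
      cases hl : openArcs (height β) k with
      | nil =>
        rw [hl] at hk0 ho
        simp only [List.countP_nil, Nat.cast_zero, mul_zero, sub_zero, List.tail_nil] at hk0 ho
        cases ha : α ⟨k, hkN⟩
        · rw [ha] at hα
          simp only [Bool.false_eq_true, if_false] at hα
          left
          refine ⟨fun x hx => ?_, fun r => ?_⟩
          · by_cases hx' : x ≤ k
            · exact h1 x hx'
            · have : x = k + 1 := by omega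
              subst this
              rw [ho]
              push_cast
              rw [hα, hβ, hk0]
              simp
          · rw [et, h2, hb, ho, hl, ha, List.map_nil, readWeight]
            simp only [Bool.false_eq_true, if_false]
            congr 1
            refine closedWeight_congr fun i hi => ?_
            rw [hcov i (hnk i hi)]
            refine and_congr_right fun hlt => not_congr ?_
            have h3 := hmem i
            have h4 := hmem' i
            obtain ⟨h5, h6, -⟩ := mem_flips.1 hi
            rw [hl] at h3
            rw [ho] at h4
            simp only [List.not_mem_nil, false_iff, not_and] at h3 h4
            simp only [h3 h5.1 h6, h4 h5.1 h6]
        -- An unpaired 1 of β cannot become a 2: the path of α would rise above that of β although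
        -- no arc is open.
        · right
          refine ⟨fun hc => ?_, fun r => ?_⟩
          · rw [ha] at hα
            have := hc (k + 1) (by omega)
            push_cast at this
            rw [hα, hβ, hk0] at this
            simp only [if_true] at this
            omega
          · rw [et, h2, hb, hl, ha, List.map_nil, readWeight]
            simp
      | cons a l =>
        rw [hl, List.tail_cons] at ho
        rw [hl, List.countP_cons] at hk0
        push_cast at hk0
        -- The down step closes the arc a, so α must step up here exactly when a has been flipped.
        by_cases ha : α ⟨k, hkN⟩ = flag (height α) a
        · left
          refine ⟨fun x hx => ?_, fun r => ?_⟩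
          · by_cases hx' : x ≤ k
            · exact h1 x hx'
            · have : x = k + 1 := by omega
              subst this
              rw [ho]
              push_cast
              rw [hα, hβ, hk0, ha]
              cases flag (height α) a <;> simp <;> ring
          · rw [et, h2, hb, ho, hl, List.map_cons, readWeight, if_pos ha, ← mul_assoc]
            congr 1
            have hnd := openArcs_nodup hp k hkN.le
            rw [hl] at hnd hmem
            rw [ho] at hmem'
            have hal : a ∉ l := (List.nodup_cons.1 hnd).1
            -- Every other flipped arc is open at k + 1 if and only if it is open at k. Only the
            -- factor of a changes, from 1 to t⁻¹, when a is flipped.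
            have hagree : ∀ i ∈ flips N (height β) (height α), i ≠ a →
                ((i < (k : ℤ) ∧ ¬ Cov (height β) i k) ↔
                  (i < ((k + 1 : ℕ) : ℤ) ∧ ¬ Cov (height β) i (k + 1 : ℕ))) := by
              intro i hi hia
              obtain ⟨h5, h6, -⟩ := mem_flips.1 hi
              rw [hcov i (hnk i hi)]
              refine and_congr_right fun hlt => not_congr ?_
              have h3 := hmem i
              have h4 := hmem' i
              simp only [List.mem_cons, hia, false_or, h5.1, h6, true_and] at h3 h4
              rw [← h3, ← h4]
            have ha1 := (hmem a).1 (by simp)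
            have ha2 : ¬ Cov (height β) a (k + 1 : ℕ) := fun hc =>
              hal ((hmem' a).2 ⟨ha1.1, ha1.2.1, hc⟩)
            by_cases hf1 : flag (height α) a = true
            · have haf : a ∈ flips N (height β) (height α) := by
                refine mem_flips.2 ⟨⟨ha1.1, ?_⟩, ha1.2.1, by simpa [flag] using hf1⟩
                have := ha1.2.2.1
                omega
              rw [if_pos hf1, closedWeight, closedWeight, ← Finset.mul_prod_erase _ _ haf,
                ← Finset.mul_prod_erase (a := a) (flips N (height β) (height α)) _ haf,
                if_neg (fun hc => hc.2 ha1.2.2), if_pos ⟨by have := ha1.2.2.1; push_cast; omega, ha2⟩,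
                one_mul, mul_comm]
              congr 1
              refine Finset.prod_congr rfl fun i hi => ?_
              simp only [hagree i (Finset.mem_of_mem_erase hi) (Finset.ne_of_mem_erase hi)]
            · rw [if_neg hf1, mul_one]
              refine closedWeight_congr fun i hi => hagree i hi ?_
              rintro rfl
              exact hf1 (by simpa [flag] using (mem_flips.1 hi).2.2)
        · right
          refine ⟨fun hc => ?_, fun r => ?_⟩
          · have := hc (k + 1) (by omega)
            rw [ho] at this
            push_cast at this
            rw [hα, hβ, hk0] at this
            revert ha this
            cases α ⟨k, hkN⟩ <;> cases flag (height α) a <;> simp <;> omega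
          · rw [et, h2, hb, hl, List.map_cons, readWeight, if_neg ha, mul_zero]

/-- The coefficients of the monomial basis in terms of flipped arcs. -/
lemma flipCoeff_eq (α β : BString N) : flipCoeff α β =
    if IsFlip N (height β) (height α) then
      ∏ i ∈ flips N (height β) (height α), arcWeight N (height β) i else 0 := by
  have hp := isPath_height β
  have hiff : IsFlip N (height β) (height α) ↔ ∀ x : ℕ, x ≤ N → height α x =
        height β x - 2 * (openArcs (height β) x).countP (flag (height α)) := by
    constructor
    · intro h x hx
      rw [← card_openArcs_flips hp _ x hx]
      exact h x (by omega) (by omega)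
    · intro h x h0 hx
      obtain ⟨n, rfl⟩ := Int.eq_ofNat_of_zero_le h0
      rw [card_openArcs_flips hp _ n (by omega)]
      exact h n (by omega)
  have e : flipCoeff α β = readWeight [] ((List.ofFn fun k => (β k, α k)).take N ++ []) := by
    rw [flipCoeff, List.append_nil, List.take_of_length_le (by simp)]
  rw [e]
  rcases readWeight_take α β N le_rfl with ⟨h1, h2⟩ | ⟨h1, h2⟩
  · rw [if_pos (hiff.2 h1), h2, readWeight, openWeight_openArcs hp,
      ← Finset.prod_filter_mul_prod_filter_not (flips N (height β) (height α))
        (fun i => Cov (height β) i N), mul_comm]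
    congr 1
    rw [closedWeight, Finset.prod_filter]
    refine Finset.prod_congr rfl fun i hi => ?_
    have := (mem_flips.1 hi).1.2
    simp only [this, true_and]
    by_cases hc : Cov (height β) i N <;> simp [arcWeight, hc]
  · rw [if_neg (fun hc => h1 (hiff.1 hc)), h2]

end KLB

namespace KLB

variable {N : ℕ}

/-! ## Ballot strips -/

namespace BallotStrip

lemma ext_iff' {D E : BallotStrip} : D = E ↔ D.x = E.x ∧ D.y = E.y ∧ D.steps = E.steps := by
  obtain ⟨x, y, s, h⟩ := D
  obtain ⟨x', y', s', h'⟩ := E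
  simp

lemma col_bounds {D : BallotStrip} {b : ℤ × ℤ} (h : b ∈ D.boxSet) :
    D.x ≤ b.1 ∧ b.1 ≤ D.x + D.steps.length := by
  obtain ⟨k, hk, rfl⟩ := h
  simp only [vertex]
  omega

lemma col_unique {D : BallotStrip} {x y y' : ℤ} (h : (x, y) ∈ D.boxSet)
    (h' : (x, y') ∈ D.boxSet) : y = y' := by
  obtain ⟨k, hk, e⟩ := h
  obtain ⟨k', hk', e'⟩ := h'
  simp only [vertex, Prod.mk.injEq] at e e'
  have : k = k' := by omega
  subst this
  omega

lemma col_exists (D : BallotStrip) {x : ℤ} (h1 : D.x ≤ x) (h2 : x ≤ D.x + D.steps.length) :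
    ∃ y, (x, y) ∈ D.boxSet := by
  obtain ⟨k, hk⟩ := Int.eq_ofNat_of_zero_le (show 0 ≤ x - D.x by omega)
  exact ⟨_, k, by omega, Prod.ext (by simp only [vertex]; omega) rfl⟩

lemma y_le {D : BallotStrip} {b : ℤ × ℤ} (h : b ∈ D.boxSet) : D.y ≤ b.2 := by
  obtain ⟨k, hk, rfl⟩ := h
  have := D.ballot k
  simp only [vertex]
  omega

lemma start_mem (D : BallotStrip) : (D.x, D.y) ∈ D.boxSet :=
  ⟨0, Nat.zero_le _, by simp [vertex]⟩

lemma end_mem (D : BallotStrip) : (D.x + D.steps.length, D.y + D.l') ∈ D.boxSet := by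
  refine ⟨D.steps.length, le_rfl, ?_⟩
  have := D.ballot D.steps.length
  rw [List.take_length] at this
  refine Prod.ext rfl ?_
  simp only [vertex, l', List.take_length]
  omega

lemma length_eq (D : BallotStrip) : D.steps.length = 2 * D.l + D.l' := by
  have h1 := D.ballot D.steps.length
  rw [List.take_length] at h1
  have h2 : D.steps.count true + D.steps.count false = D.steps.length :=
    List.count_true_add_count_false D.steps
  simp only [l, l']
  omega

lemma eq_of_boxSet {D E : BallotStrip} (h : D.boxSet = E.boxSet) : D = E := by
  have h1 := col_bounds (h ▸ D.start_mem)
  have h2 := col_bounds (h ▸ E.start_mem : _ ∈ D.boxSet)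
  have h3 := col_bounds (h ▸ D.end_mem)
  have h4 := col_bounds (h ▸ E.end_mem : _ ∈ D.boxSet)
  simp only at h1 h2 h3 h4
  have hx : D.x = E.x := by omega
  have hl : D.steps.length = E.steps.length := by omega
  have hy : D.y = E.y := col_unique (h ▸ D.start_mem) (hx ▸ E.start_mem)
  have hv : ∀ k ≤ D.steps.length, D.vertex k = E.vertex k := by
    intro k hk
    have e1 : D.vertex k ∈ E.boxSet := h ▸ ⟨k, hk, rfl⟩
    have e2 : E.vertex k ∈ E.boxSet := ⟨k, hl ▸ hk, rfl⟩
    have e3 : (D.vertex k).1 = (E.vertex k).1 := by simp only [vertex, hx]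
    refine Prod.ext e3 ?_
    exact col_unique (x := (E.vertex k).1) (by rw [← e3]; exact e1) e2
  refine ext_iff'.2 ⟨hx, hy, ?_⟩
  refine List.ext_getElem hl fun k hk hk' => ?_
  have e1 := congrArg Prod.snd (hv k hk.le)
  have e2 := congrArg Prod.snd (hv (k + 1) hk)
  simp only [vertex, hy, List.take_succ_eq_append_getElem hk,
    List.take_succ_eq_append_getElem hk', List.count_append] at e1 e2
  cases hd : D.steps[k] <;> cases he : E.steps[k] <;> simp [hd, he] at e2 ⊢ <;> omega

end BallotStrip

/-! ## Fillings satisfying Rule II are unique -/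

lemma mem_skew {α β : BString N} {x y : ℤ} : (x, y) ∈ skew α β ↔
    0 < x ∧ x ≤ N ∧ height α x ≤ y ∧ y < height β x ∧ Even (x + y - 1) := by
  simp only [skew, boxes, Set.mem_sdiff, Set.mem_ofPred_eq, not_and, not_lt]
  constructor
  · rintro ⟨⟨h1, h2, h3, h4, h5⟩, h6⟩
    exact ⟨h1, h2, h6 h1 h2 h3 h4, h5, h4⟩
  · rintro ⟨h1, h2, h3, h4, h5⟩
    have hα := (isPath_height α).bounds h1.le h2
    have hβ := (isPath_height β).bounds h1.le h2
    exact ⟨⟨h1, h2, abs_le.2 ⟨by omega, by omega⟩, h5, h4⟩, fun _ _ _ _ => h3⟩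

/-- The number `n` is the depth of the box below the upper path, the coordinate used in place of the
ordinate from here on. -/
lemma exists_gap {α β : BString N} {x y : ℤ} (h : (x, y) ∈ skew α β) :
    ∃ n : ℕ, y = height β x - 1 - 2 * n := by
  obtain ⟨h1, h2, h3, h4, h5⟩ := mem_skew.1 h
  have hβ := ((isPath_height β).bounds h1.le h2).2.2
  rw [Int.even_iff] at h5 hβ
  exact ⟨((height β x - 1 - y) / 2).toNat, by omega⟩

lemma mem_skew_gap {α β : BString N} {x : ℤ} (h1 : 0 < x) (h2 : x ≤ N) (n : ℕ) :
    (x, height β x - 1 - 2 * n) ∈ skew α β ↔ height α x + 2 * n + 2 ≤ height β x := by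
  have hα := ((isPath_height α).bounds h1.le h2).2.2
  have hβ := ((isPath_height β).bounds h1.le h2).2.2
  rw [mem_skew]
  rw [Int.even_iff] at *
  constructor
  · rintro ⟨-, -, h3, h4, h5⟩
    omega
  · intro h3
    refine ⟨h1, h2, by omega, by omega, ?_⟩
    omega

/-- The shape of a strip in a filling: a shifted copy of the part of the upper path over an arc. -/
structure IsArcStrip (N : ℕ) (h : ℤ → ℤ) (n : ℕ) (D : BallotStrip) : Prop where
  gap : ∀ b ∈ D.boxSet, b.2 = h b.1 - 1 - 2 * n
  up : h D.x = h (D.x - 1) + 1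
  cov : ∀ x : ℤ, (D.x ≤ x ∧ x ≤ D.x + D.steps.length) ↔ Cov h (D.x - 1) x ∧ x ≤ N

/-- By Rule 0 a strip ending before the column N has excess 0 and returns to its starting height.
The down step that follows then ends the arc exactly where the strip ends. -/
lemma isArcStrip_of {h : ℤ → ℤ} {n : ℕ} {D : BallotStrip}
    (hN : ∀ b ∈ D.boxSet, b.1 ≤ N) (h0 : Rule0 N D)
    (gap : ∀ b ∈ D.boxSet, b.2 = h b.1 - 1 - 2 * n) (up : h D.x = h (D.x - 1) + 1)
    (down : D.x + D.steps.length < N →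
      h (D.x + D.steps.length + 1) = h (D.x + D.steps.length) - 1) : IsArcStrip N h n D := by
  refine ⟨gap, up, fun x => ⟨fun hx => ?_, fun hx => ?_⟩⟩
  · refine ⟨⟨by omega, fun y h1 h2 => ?_⟩, ?_⟩
    · obtain ⟨z, hz⟩ := D.col_exists (x := y) (by omega) (by omega)
      have e1 := gap _ hz
      have e2 := gap _ D.start_mem
      have e3 := BallotStrip.y_le hz
      simp only at e1 e2 e3
      rw [show D.x - 1 + 1 = D.x by ring]
      omega
    · obtain ⟨z, hz⟩ := D.col_exists hx.1 hx.2
      exact hN _ hz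
  · refine ⟨by have := hx.1.1; omega, ?_⟩
    by_contra hc
    have hlt : D.x + D.steps.length < N := by omega
    have hl : D.l' = 0 := by
      by_contra hl
      have := h0 (by omega)
      simp only [BallotStrip.vertex] at this
      omega
    have e1 := gap _ D.start_mem
    have e2 := gap _ D.end_mem
    have e3 := hx.1.2 (D.x + D.steps.length + 1) (by omega) (by omega)
    have e4 := down hlt
    simp only [hl] at e1 e2
    rw [show D.x - 1 + 1 = D.x by ring] at e3
    push_cast at e2
    omega

lemma strip_unique {α β : BString N} {C : Finset BallotStrip} (hC : C ∈ Conf α β)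
    {D E : BallotStrip} (hD : D ∈ C) (hE : E ∈ C) {b : ℤ × ℤ} (h1 : b ∈ D.boxSet)
    (h2 : b ∈ E.boxSet) : D = E :=
  (hC.2 b ((hC.1 D hD).1 h1)).unique ⟨hD, h1⟩ ⟨hE, h2⟩

/-- Rule II determines the strips from the top downwards. A strip with a box of depth 0 contains
every box of the skew diagram that lies above one of its boxes. A strip with a box of depth n + 1
lies directly under an arc strip of depth n, and Rule II confines all positions above it, up to the
column N, to these two strips. -/
lemma isArcStrip_of_mem {α β : BString N} {C : Finset BallotStrip} (hC : C ∈ ConfII α β) (n : ℕ)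
    (D : BallotStrip) (hD : D ∈ C) (hb : ∃ b ∈ D.boxSet, b.2 = height β b.1 - 1 - 2 * n) :
    IsArcStrip N (height β) n D := by
  have hpα := isPath_height α
  have hpβ := isPath_height β
  induction n generalizing D with
  | zero =>
    obtain ⟨⟨bx, by'⟩, hb, hbn⟩ := hb
    have hsub := (hC.1.1 D hD).1
    -- Contact with another strip would, by Rule II, put the position just above the depth 0 box
    -- into one of the two strips, although it lies outside the skew diagram.
    have hmax : ∀ b ∈ D.boxSet, ∀ b' ∈ above b, b' ∈ skew α β → b' ∈ D.boxSet := by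
      intro b0 hb0 b' hb' hs
      obtain ⟨D', ⟨hD', hbD'⟩, -⟩ := hC.1.2 b' hs
      by_cases hDD : D = D'
      · rw [hDD]; exact hbD'
      exfalso
      have hbs := mem_skew.1 (hsub hb)
      have := hC.2 D hD D' hD' hDD ⟨b0, hb0, b', hbD', hb'⟩ (bx, by') hb (bx, by' + 2)
        (by simp [above]) hbs.2.1
      have hs' : (bx, by' + 2) ∈ skew α β := by
        rcases this with h | h
        · exact hsub h
        · exact (hC.1.1 D' hD').1 h
      have := (mem_skew.1 hs').2.2.2.1
      simp only at hbn
      push_cast at hbn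
      omega
    have hgap : ∀ b ∈ D.boxSet, b.2 = height β b.1 - 1 - 2 * (0 : ℕ) := by
      rintro ⟨x, y⟩ hxy
      obtain ⟨n, hn⟩ := exists_gap (hsub hxy)
      obtain ⟨h1, h2, h3, h4, h5⟩ := mem_skew.1 (hsub hxy)
      by_cases hn0 : n = 0
      · rw [hn0] at hn; exact hn
      exfalso
      have : (x, y + 2) ∈ D.boxSet := by
        refine hmax _ hxy _ (by simp [above]) (mem_skew.2 ⟨h1, h2, by omega, by omega, ?_⟩)
        rw [Int.even_iff] at *
        omega
      have := BallotStrip.col_unique hxy this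
      omega
    refine isArcStrip_of (fun b hb => (mem_skew.1 (hsub hb)).2.1) (hC.1.1 D hD).2 hgap ?_ ?_
    · have hs := hsub D.start_mem
      obtain ⟨h1, h2, h3, h4, h5⟩ := mem_skew.1 hs
      have hg := hgap _ D.start_mem
      simp only at hg
      push_cast at hg
      have e : D.x - 1 + 1 = D.x := by ring
      rcases hpβ.step (D.x - 1) (by omega) (by omega) with h | h <;> rw [e] at h
      · exact h
      exfalso
      have hα := hpα.step (D.x - 1) (by omega) (by omega)
      rw [e] at hα
      by_cases hx : D.x = 1
      · rw [hx] at h h3 hg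
        have h0 : height β (1 - 1) = 0 := by simpa using hpβ.zero
        have := (hpα.bounds (x := 1) (by omega) (by omega)).1
        omega
      -- If the upper path stepped down here, the box north-west of the first box would lie in the
      -- skew diagram, hence in D, left of its first column.
      · have : (D.x - 1, D.y + 1) ∈ D.boxSet := by
          refine hmax _ D.start_mem _ (by simp [above])
            (mem_skew.2 ⟨by omega, by omega, by omega, by omega, ?_⟩)
          rw [Int.even_iff] at *
          omega
        have := BallotStrip.col_bounds this
        simp only at this
        omega
    · intro hlt
      have hs := hsub D.end_mem
      obtain ⟨h1, h2, h3, h4, h5⟩ := mem_skew.1 hs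
      have hg := hgap _ D.end_mem
      simp only at hg
      push_cast at hg
      generalize hX : D.x + (D.steps.length : ℤ) = X at *
      rcases hpβ.step X (by omega) (by omega) with h | h
      swap
      · exact h
      exfalso
      have hα := hpα.step X (by omega) (by omega)
      have he := D.end_mem
      rw [hX] at he
      have : (X + 1, D.y + D.l' + 1) ∈ D.boxSet := by
        refine hmax _ he _ (by simp [above])
          (mem_skew.2 ⟨by omega, by omega, by omega, by omega, ?_⟩)
        rw [Int.even_iff] at *
        omega
      have := BallotStrip.col_bounds this
      simp only at this
      omega
  | succ n ih =>
    obtain ⟨⟨bx, by'⟩, hb, hbn⟩ := hb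
    have hsub := (hC.1.1 D hD).1
    obtain ⟨b1, b2, b3, b4, b5⟩ := mem_skew.1 (hsub hb)
    simp only at hbn
    push_cast at hbn
    have hs : (bx, by' + 2) ∈ skew α β := by
      refine mem_skew.2 ⟨b1, b2, by omega, by omega, ?_⟩
      rw [Int.even_iff] at *
      omega
    obtain ⟨D', ⟨hD', hbD'⟩, -⟩ := hC.1.2 _ hs
    have hne : D ≠ D' := by
      rintro rfl
      have := BallotStrip.col_unique hb hbD'
      omega
    have ih' := ih D' hD' ⟨_, hbD', by simp only; omega⟩
    have hrule := hC.2 D hD D' hD' hne ⟨_, hb, _, hbD', by simp [above]⟩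
    have hgap : ∀ b ∈ D.boxSet, b.2 = height β b.1 - 1 - 2 * (n + 1 : ℕ) := by
      rintro ⟨x, y⟩ hxy
      rcases hrule _ hxy (x, y + 2) (by simp [above]) (mem_skew.1 (hsub hxy)).2.1 with h | h
      · have := BallotStrip.col_unique hxy h
        omega
      · have := ih'.gap _ h
        simp only at this
        push_cast
        omega
    refine isArcStrip_of (fun b hb => (mem_skew.1 (hsub hb)).2.1) (hC.1.1 D hD).2 hgap ?_ ?_
    · have hg := hgap _ D.start_mem
      have hx := (mem_skew.1 (hsub D.start_mem)).2.1
      -- The position north-west of the first box must be a box of D', hence of depth n; comparing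
      -- ordinates shows that the upper path steps up.
      rcases hrule _ D.start_mem (D.x - 1, D.y + 1) (by simp [above]) (by simp only; omega) with h | h
      · have := BallotStrip.col_bounds h
        simp only at this
        omega
      · have := ih'.gap _ h
        simp only at this hg
        push_cast at hg
        omega
    · intro hlt
      have hg := hgap _ D.end_mem
      rcases hrule _ D.end_mem (D.x + D.steps.length + 1, D.y + D.l' + 1) (by simp [above])
        (by simp only; omega) with h | h
      · have := BallotStrip.col_bounds h
        simp only at this
        omega
      · have := ih'.gap _ h
        simp only at this hg
        push_cast at hg
        omega

/-! ### Maximality of the strips and uniqueness of the filling -/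

section Unique

variable {α β : BString N} {C : Finset BallotStrip}

/-- A box of the skew diagram lies in a strip of the filling which follows an arc. -/
lemma exists_arcStrip (hC : C ∈ ConfII α β) {x : ℤ} (h1 : 0 < x) (h2 : x ≤ N) (n : ℕ)
    (h3 : height α x + 2 * n + 2 ≤ height β x) :
    ∃ D ∈ C, IsArcStrip N (height β) n D ∧ D.x ≤ x ∧ x ≤ D.x + D.steps.length ∧
      (x, height β x - 1 - 2 * n) ∈ D.boxSet := by
  obtain ⟨D, ⟨hD, hb⟩, -⟩ := hC.1.2 _ ((mem_skew_gap (α := α) (β := β) h1 h2 n).2 h3)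
  have := BallotStrip.col_bounds hb
  exact ⟨D, hD, isArcStrip_of_mem hC n D hD ⟨_, hb, rfl⟩, this.1, this.2, hb⟩

lemma IsArcStrip.mem {h : ℤ → ℤ} {n : ℕ} {D : BallotStrip} (hA : IsArcStrip N h n D) {x : ℤ}
    (h1 : D.x ≤ x) (h2 : x ≤ D.x + D.steps.length) : (x, h x - 1 - 2 * n) ∈ D.boxSet := by
  obtain ⟨y, hy⟩ := D.col_exists h1 h2
  have := hA.gap _ hy
  simp only at this
  rwa [← this]

lemma strip_skew (hC : C ∈ ConfII α β) {D : BallotStrip} (hD : D ∈ C) {n : ℕ}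
    (hA : IsArcStrip N (height β) n D) {x : ℤ} (h1 : D.x ≤ x) (h2 : x ≤ D.x + D.steps.length) :
    0 < x ∧ x ≤ N ∧ height α x + 2 * n + 2 ≤ height β x := by
  have hm := hA.mem h1 h2
  have hs := (hC.1.1 D hD).1 hm
  have := mem_skew.1 hs
  exact ⟨this.1, this.2.1, (mem_skew_gap this.1 this.2.1 n).1 hs⟩

/-- A box of the same depth in the preceding column would lie in an arc strip E. Since the upper
path steps up into the first column of D, the arc of E would continue and E would meet D. -/
lemma strip_maximal_left (hC : C ∈ ConfII α β) {D : BallotStrip} (hD : D ∈ C) {n : ℕ}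
    (hA : IsArcStrip N (height β) n D) :
    height β (D.x - 1) ≤ height α (D.x - 1) + 2 * n + 1 := by
  have hs := strip_skew hC hD hA le_rfl (by omega)
  by_contra hc
  by_cases hx : D.x = 1
  · rw [hx] at hc
    simp only [sub_self, height_zero] at hc
    omega
  obtain ⟨E, hE, hAE, h1, h2, hb⟩ :=
    exists_arcStrip hC (x := D.x - 1) (by omega) (by omega) n (by omega)
  have h3 : Cov (height β) (E.x - 1) (D.x - 1) := ((hAE.cov _).1 ⟨h1, h2⟩).1
  have h4 : Cov (height β) (E.x - 1) D.x := by
    have := h3.succ (by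
      have := h3.2 _ h3.1 le_rfl
      have := hA.up
      rw [show D.x - 1 + 1 = D.x by ring]
      omega)
    rwa [show D.x - 1 + 1 = D.x by ring] at this
  have h5 := (hAE.cov _).2 ⟨h4, hs.2.1⟩
  have h6 := strip_unique hC.1 hD hE (hA.mem le_rfl (by omega)) (hAE.mem h5.1 h5.2)
  rw [← h6] at h1
  omega

/-- A box of the same depth in the next column would lie in an arc strip E. If E starts earlier it
meets D; if it starts there, the upper path steps up and the arc of D would not have ended. -/
lemma strip_maximal_right (hC : C ∈ ConfII α β) {D : BallotStrip} (hD : D ∈ C) {n : ℕ}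
    (hA : IsArcStrip N (height β) n D) (hlt : D.x + D.steps.length < N) :
    height β (D.x + D.steps.length + 1) ≤ height α (D.x + D.steps.length + 1) + 2 * n + 1 := by
  have hs := strip_skew hC hD hA le_rfl (by omega)
  by_contra hc
  obtain ⟨E, hE, hAE, h1, h2, hb⟩ :=
    exists_arcStrip hC (x := D.x + D.steps.length + 1) (by omega) (by omega) n (by omega)
  by_cases hx : E.x ≤ D.x + D.steps.length
  · have h6 := strip_unique hC.1 hD hE (hA.mem (by omega) le_rfl) (hAE.mem hx (by omega))
    rw [← h6] at h2
    omega
  · have hx : E.x = D.x + D.steps.length + 1 := by omega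
    have hup := hAE.up
    rw [hx, show D.x + (D.steps.length : ℤ) + 1 - 1 = D.x + D.steps.length by ring] at hup
    have h3 := ((hA.cov (D.x + D.steps.length)).1 ⟨by omega, le_rfl⟩).1
    have h4 := h3.succ (by
      have := h3.2 _ h3.1 le_rfl
      omega)
    have := (hA.cov _).2 ⟨h4, by omega⟩
    omega

/-- By maximality, a strip of depth n occupies a maximal run of consecutive columns containing a box
of that depth. Such runs depend only on α and β. -/
lemma confII_subset {C' : Finset BallotStrip} (hC : C ∈ ConfII α β) (hC' : C' ∈ ConfII α β) :
    C ⊆ C' := by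
  have half : ∀ {C C' : Finset BallotStrip} {D E : BallotStrip} {n : ℕ}, C ∈ ConfII α β →
      C' ∈ ConfII α β → D ∈ C → E ∈ C' → IsArcStrip N (height β) n D →
      IsArcStrip N (height β) n E → D.x ≤ E.x + E.steps.length → E.x ≤ D.x + D.steps.length →
      D.x ≤ E.x ∧ E.x + E.steps.length ≤ D.x + D.steps.length := by
    intro C C' D E n hC hC' hD hE hAD hAE h1 h2
    constructor
    · by_contra hc
      have := strip_maximal_left hC hD hAD
      have := (strip_skew hC' hE hAE (x := D.x - 1) (by omega) (by omega)).2.2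
      omega
    · by_contra hc
      have hs := strip_skew hC' hE hAE (x := E.x + E.steps.length) (by omega) (by omega)
      have := strip_maximal_right hC hD hAD (by omega)
      have := (strip_skew hC' hE hAE (x := D.x + D.steps.length + 1) (by omega) (by omega)).2.2
      omega
  intro D hD
  have hs := (hC.1.1 D hD).1 D.start_mem
  obtain ⟨n, hn⟩ := exists_gap hs
  have hA := isArcStrip_of_mem hC n D hD ⟨_, D.start_mem, hn⟩
  obtain ⟨E, ⟨hE, hb⟩, -⟩ := hC'.1.2 _ hs
  have hAE := isArcStrip_of_mem hC' n E hE ⟨_, hb, hn⟩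
  have hcol := BallotStrip.col_bounds hb
  simp only at hcol
  have e1 := half hC hC' hD hE hA hAE (by omega) (by omega)
  have e2 := half hC' hC hE hD hAE hA (by omega) (by omega)
  have : D = E := by
    refine BallotStrip.eq_of_boxSet (Set.ext fun ⟨x, y⟩ => ⟨fun h => ?_, fun h => ?_⟩)
    · have h1 := BallotStrip.col_bounds h
      have h2 := hA.gap _ h
      simp only at h1 h2
      rw [h2]
      exact hAE.mem (by omega) (by omega)
    · have h1 := BallotStrip.col_bounds h
      have h2 := hAE.gap _ h
      simp only at h1 h2
      rw [h2]
      exact hA.mem (by omega) (by omega)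
  rw [this]
  exact hE

/-- If there is a filling, then the lower path is obtained from the upper one by flips. -/
lemma isFlip_of_confII (hle : ∀ x : ℤ, 0 ≤ x → x ≤ N → height α x ≤ height β x)
    (hC : C ∈ ConfII α β) : IsFlip N (height β) (height α) := by
  have hpα := isPath_height α
  have hpβ := isPath_height β
  intro x hx0 hxN
  by_cases hx : x = 0
  · subst hx
    have : (flips N (height β) (height α)).filter (fun i => Cov (height β) i 0) = ∅ := by
      refine Finset.filter_eq_empty_iff.2 fun i hi hc => ?_
      have := (mem_flips.1 hi).1.1
      have := hc.1
      omega
    rw [this, height_zero, height_zero]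
    simp
  have hx0 : 0 < x := by omega
  obtain ⟨c, hc⟩ : ∃ c : ℕ, height β x - height α x = 2 * c := by
    have h1 := (hpα.bounds hx0.le hxN).2.2
    have h2 := (hpβ.bounds hx0.le hxN).2.2
    have h3 := hle x hx0.le hxN
    rw [Int.even_iff] at h1 h2
    exact ⟨((height β x - height α x) / 2).toNat, by omega⟩
  have hex : ∀ n ∈ Finset.range c, ∃ D ∈ C, IsArcStrip N (height β) n D ∧ D.x ≤ x ∧
      x ≤ D.x + D.steps.length ∧ (x, height β x - 1 - 2 * n) ∈ D.boxSet := fun n hn =>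
    exists_arcStrip hC hx0 hxN n (by have := Finset.mem_range.1 hn; omega)
  have : Nonempty BallotStrip := ⟨⟨0, 0, [], by simp⟩⟩
  choose! D hDC hDA hD1 hD2 hDb using hex
  -- Column x has boxes of depths 0, …, c − 1. Sending a depth to the up step at which its strip
  -- starts is a bijection onto the flipped arcs over x.
  have hcard : (Finset.range c).card =
      ((flips N (height β) (height α)).filter (fun i => Cov (height β) i x)).card := by
    refine Finset.card_bij (fun n _ => (D n).x - 1) ?_ ?_ ?_
    · intro n hn
      have hs := strip_skew hC (hDC n hn) (hDA n hn) le_rfl (by omega)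
      have hm := strip_maximal_left hC (hDC n hn) (hDA n hn)
      have hu := (hDA n hn).up
      have hα := hpα.step ((D n).x - 1) (by omega) (by omega)
      rw [show (D n).x - 1 + 1 = (D n).x by ring] at hα
      refine Finset.mem_filter.2 ⟨mem_flips.2 ⟨⟨by omega, by omega⟩, ?_, ?_⟩,
        (((hDA n hn).cov x).1 ⟨hD1 n hn, hD2 n hn⟩).1⟩
      · rw [show (D n).x - 1 + 1 = (D n).x by ring]; omega
      · rw [show (D n).x - 1 + 1 = (D n).x by ring]; omega
    -- Just before the start, the two paths differ by at most 2n + 1, and one step increases the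
    -- difference by at most 2.
    · have key : ∀ n ∈ Finset.range c, ∀ k ∈ Finset.range c, (D n).x - 1 = (D k).x - 1 →
          k ≤ n := by
        intro n hn k hk e
        have hs := strip_skew hC (hDC k hk) (hDA k hk) le_rfl (by omega)
        have hm := strip_maximal_left hC (hDC n hn) (hDA n hn)
        have hu := (hDA n hn).up
        have e' : (D k).x = (D n).x := by omega
        rw [e'] at hs
        have hα := hpα.step ((D n).x - 1) (by omega) (by omega)
        rw [show (D n).x - 1 + 1 = (D n).x by ring] at hα
        omega
      intro n hn k hk e
      exact le_antisymm (key k hk n hn e.symm) (key n hn k hk e)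
    · intro i hi
      obtain ⟨hi1, hi2⟩ := Finset.mem_filter.1 hi
      obtain ⟨⟨hi3, hi4⟩, hi5, hi6⟩ := mem_flips.1 hi1
      have hα := hpα.step i hi3 hi4
      have hβ := hpβ.step i hi3 hi4
      -- The flipped step creates exactly one new depth in column i + 1, namely half the difference
      -- of the paths at i.
      obtain ⟨n, hn⟩ : ∃ n : ℕ, height β i - height α i = 2 * n := by
        have h1 := (hpα.bounds hi3 hi4.le).2.2
        have h2 := (hpβ.bounds hi3 hi4.le).2.2
        have h3 := hle i hi3 hi4.le
        rw [Int.even_iff] at h1 h2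
        exact ⟨((height β i - height α i) / 2).toNat, by omega⟩
      obtain ⟨E, hE, hAE, h1, h2, hb⟩ :=
        exists_arcStrip hC (x := i + 1) (by omega) (by omega) n (by omega)
      have hEx : E.x = i + 1 := by
        by_contra hne
        have := strip_skew hC hE hAE (x := i) (by omega) (by omega)
        omega
      have hEx' : E.x - 1 = i := by omega
      have hxE := (hAE.cov x).2 ⟨by rwa [hEx'], hxN⟩
      have hsx := strip_skew hC hE hAE hxE.1 hxE.2
      have hnc : n ∈ Finset.range c := Finset.mem_range.2 (by omega)
      refine ⟨n, hnc, ?_⟩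
      rw [strip_unique hC.1 (hDC n hnc) hE (hDb n hnc) (hAE.mem hxE.1 hxE.2), hEx']
  rw [← hcard, Finset.card_range]
  omega

end Unique

end KLB

namespace KLB

variable {N : ℕ}

/-! ## The filling attached to a family of flipped arcs -/

lemma count_steps {h : ℤ → ℤ} (hp : IsPath N h) {i : ℤ} (hi : 0 ≤ i) (k : ℕ)
    (hk : i + 1 + k ≤ N) :
    ((((List.range k).map fun j : ℕ => decide (h (i + 1 + j) < h (i + 1 + j + 1))).count true : ℕ) : ℤ)
      - (((List.range k).map fun j : ℕ => decide (h (i + 1 + j) < h (i + 1 + j + 1))).count false : ℕ)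
      = h (i + 1 + k) - h (i + 1) := by
  induction k with
  | zero => simp
  | succ k ih =>
    push_cast at hk
    have := ih (by omega)
    rw [List.range_succ, List.map_append, List.count_append, List.count_append]
    push_cast
    rw [← add_assoc]
    rcases hp.step (i + 1 + k) (by omega) (by omega) with h1 | h1
    · have e : h (i + 1 + k) < h (i + 1 + k + 1) := by omega
      simp only [List.map_cons, List.map_nil, e, decide_true, List.count_singleton_self]
      rw [show List.count false [true] = 0 from rfl]
      push_cast
      omega
    · have e : ¬ h (i + 1 + k) < h (i + 1 + k + 1) := by omega
      simp only [List.map_cons, List.map_nil, e, decide_false, List.count_singleton_self]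
      rw [show List.count true [false] = 0 from rfl]
      push_cast
      omega

/-- The path itself is followed from i + 1 to the last abscissa covered; being covered is exactly
the ballot condition. -/
lemma exists_isArcStrip {h : ℤ → ℤ} (hp : IsPath N h) {i : ℤ} (hi : 0 ≤ i) (hiN : i < N)
    (hu : h i < h (i + 1)) (n : ℕ) : ∃ D : BallotStrip, IsArcStrip N h n D ∧ D.x = i + 1 := by
  obtain ⟨e, ⟨he1, he2⟩, he3⟩ := Int.exists_greatest_of_bdd
    (P := fun x => Cov h i x ∧ x ≤ N) ⟨N, fun z hz => hz.2⟩ ⟨i + 1, Cov.self h i, by omega⟩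
  obtain ⟨ℓ, hℓ⟩ := Int.eq_ofNat_of_zero_le (show 0 ≤ e - (i + 1) by have := he1.1; omega)
  set s := (List.range ℓ).map fun j : ℕ => decide (h (i + 1 + j) < h (i + 1 + j + 1)) with hs
  have htake : ∀ k ≤ ℓ, s.take k =
      (List.range k).map fun j : ℕ => decide (h (i + 1 + j) < h (i + 1 + j + 1)) := by
    intro k hk
    rw [hs, ← List.map_take, List.take_range, min_eq_left hk]
  have hlen : s.length = ℓ := by simp [hs]
  have hcount : ∀ k ≤ ℓ, ((s.take k).count true : ℤ) - (s.take k).count false =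
      h (i + 1 + k) - h (i + 1) := by
    intro k hk
    rw [htake k hk]
    exact count_steps hp hi k (by omega)
  have hcount' : ∀ k ≤ ℓ, (s.take k).count false ≤ (s.take k).count true := by
    intro k hk
    have h1 := hcount k hk
    have h2 := he1.2 (i + 1 + k) (by omega) (by omega)
    omega
  refine ⟨⟨i + 1, h (i + 1) - 1 - 2 * n, s, fun k => ?_⟩, ⟨?_, ?_, ?_⟩, rfl⟩
  · by_cases hk : k ≤ ℓ
    · exact hcount' k hk
    · have := hcount' ℓ le_rfl
      rw [List.take_of_length_le (by omega)] at this ⊢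
      exact this
  · rintro _ ⟨k, hk, rfl⟩
    simp only [BallotStrip.vertex] at hk ⊢
    have := hcount k (by omega)
    omega
  · simp only
    rw [show i + 1 - 1 = i by ring]
    rcases hp.step i hi hiN with h1 | h1 <;> omega
  · intro x
    simp only
    rw [show i + 1 - 1 = i by ring, hlen]
    refine ⟨fun hx => ⟨he1.mono (by omega) (by omega), by omega⟩, fun hx => ?_⟩
    have := he3 x hx
    have := hx.1.1
    omega

lemma IsArcStrip.mem_iff {h : ℤ → ℤ} {n : ℕ} {D : BallotStrip} (hA : IsArcStrip N h n D)
    {x y : ℤ} : (x, y) ∈ D.boxSet ↔ (Cov h (D.x - 1) x ∧ x ≤ N) ∧ y = h x - 1 - 2 * n := by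
  rw [← hA.cov]
  constructor
  · intro hb
    exact ⟨BallotStrip.col_bounds hb, hA.gap _ hb⟩
  · rintro ⟨h1, rfl⟩
    exact hA.mem h1.1 h1.2

/-- Applied to the flipped arcs over a column, this provides the arc whose strip contains the box of
depth n. -/
lemma exists_mem_card_filter_lt (s : Finset ℤ) (n : ℕ) (hn : n < s.card) :
    ∃ k ∈ s, (s.filter (· < k)).card = n := by
  induction s using Finset.induction_on_max with
  | empty => simp at hn
  | insert a s ha ih =>
    have has : a ∉ s := fun h => lt_irrefl _ (ha a h)
    rw [Finset.card_insert_of_notMem has] at hn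
    by_cases hn' : n < s.card
    · obtain ⟨k, hk, hc⟩ := ih hn'
      refine ⟨k, Finset.mem_insert_of_mem hk, ?_⟩
      rw [Finset.filter_insert, if_neg (by have := ha k hk; omega), hc]
    · refine ⟨a, Finset.mem_insert_self _ _, ?_⟩
      rw [Finset.filter_insert, if_neg (lt_irrefl _), Finset.filter_true_of_mem ha]
      omega

lemma Cov.trans {h : ℤ → ℤ} {k i x : ℤ} (hu : h i < h (i + 1)) (h1 : Cov h k i)
    (h2 : Cov h i x) : Cov h k x := by
  refine ⟨h1.1.trans h2.1, fun y hy hy' => ?_⟩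
  by_cases hyi : y ≤ i
  · exact h1.2 y hy hyi
  · have := h1.2 i h1.1 le_rfl
    have := h2.2 y (by omega) hy'
    omega

/-! ### Nesting depth of the flipped arcs -/

/-- The depth of an arc among the flipped arcs. -/
def depth (N : ℕ) (h g : ℤ → ℤ) (i : ℤ) : ℕ := ((flips N h g).filter (fun k => Cov h k i)).card

/-- Arcs over a common abscissa are nested, so those enclosing i are the ones opened before it. Over
a given column the depth is therefore the rank from the left. -/
lemma depth_eq {h g : ℤ → ℤ} {i x : ℤ} (hi : i ∈ flips N h g) (hx : Cov h i x) :
    depth N h g i = (((flips N h g).filter (fun k => Cov h k x)).filter (· < i)).card := by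
  rw [depth, Finset.filter_filter]
  congr 1
  refine Finset.filter_congr fun k _ => ⟨fun hc => ⟨hc.trans (mem_flips.1 hi).2.1 hx, hc.1⟩,
    fun hc => hc.1.mono hc.2 hx.1.le⟩

lemma depth_lt_card {h g : ℤ → ℤ} {i x : ℤ} (hi : i ∈ flips N h g) (hx : Cov h i x) :
    depth N h g i < ((flips N h g).filter (fun k => Cov h k x)).card := by
  rw [depth_eq hi hx]
  refine Finset.card_lt_card (Finset.filter_ssubset.2
    ⟨i, Finset.mem_filter.2 ⟨hi, hx⟩, lt_irrefl _⟩)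

lemma depth_lt_depth {h g : ℤ → ℤ} {i k : ℤ} (hk : k ∈ flips N h g) (hc : Cov h k i) :
    depth N h g k < depth N h g i := depth_lt_card hk hc

lemma depth_injOn {h g : ℤ → ℤ} {i k x : ℤ} (hi : i ∈ flips N h g) (hk : k ∈ flips N h g)
    (hix : Cov h i x) (hkx : Cov h k x) (e : depth N h g i = depth N h g k) : i = k := by
  rcases lt_trichotomy i k with hlt | hlt | hlt
  · have := depth_lt_depth hi (hix.mono hlt hkx.1.le)
    omega
  · exact hlt
  · have := depth_lt_depth hk (hkx.mono hlt hix.1.le)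
    omega

section Exists

variable {α β : BString N}

/-- The strips following the flipped arcs, each one at its depth. -/
structure ArcStrips (α β : BString N) (D : ℤ → BallotStrip) : Prop where
  arc : ∀ i ∈ flips N (height β) (height α),
    IsArcStrip N (height β) (depth N (height β) (height α) i) (D i)
  x_eq : ∀ i ∈ flips N (height β) (height α), (D i).x = i + 1

lemma exists_arcStrips (α β : BString N) : ∃ D, ArcStrips α β D := by
  have : ∀ i : ℤ, ∃ D : BallotStrip, i ∈ flips N (height β) (height α) →
      IsArcStrip N (height β) (depth N (height β) (height α) i) D ∧ D.x = i + 1 := by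
    intro i
    by_cases hi : i ∈ flips N (height β) (height α)
    · obtain ⟨h1, h2, -⟩ := mem_flips.1 hi
      obtain ⟨D, hD⟩ := exists_isArcStrip (isPath_height β) h1.1 h1.2 h2
        (depth N (height β) (height α) i)
      exact ⟨D, fun _ => hD⟩
    · exact ⟨⟨0, 0, [], by simp⟩, fun h => absurd h hi⟩
  choose D hD using this
  exact ⟨D, fun i hi => (hD i hi).1, fun i hi => (hD i hi).2⟩

variable {D : ℤ → BallotStrip}

lemma ArcStrips.mem_iff (hD : ArcStrips α β D) {i : ℤ}
    (hi : i ∈ flips N (height β) (height α)) {x y : ℤ} : (x, y) ∈ (D i).boxSet ↔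
      (Cov (height β) i x ∧ x ≤ N) ∧
        y = height β x - 1 - 2 * depth N (height β) (height α) i := by
  rw [(hD.arc i hi).mem_iff, hD.x_eq i hi, show i + 1 - 1 = i by ring]

lemma ArcStrips.inj (hD : ArcStrips α β D) :
    Set.InjOn D (flips N (height β) (height α)) := by
  intro i hi k hk e
  have h1 := hD.x_eq i hi
  have h2 := hD.x_eq k hk
  rw [e] at h1
  omega

/-- A strip of positive excess ends in the last column. -/
lemma IsArcStrip.end_eq {h : ℤ → ℤ} (hp : IsPath N h) {n : ℕ} {D : BallotStrip}
    (hA : IsArcStrip N h n D) (h0 : 0 < D.x) :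
    (D.l' : ℤ) = h (D.x + D.steps.length) - h D.x ∧ D.x + D.steps.length ≤ N ∧
      (D.x + D.steps.length < N → D.l' = 0) := by
  have e1 := hA.gap _ D.start_mem
  have e2 := hA.gap _ D.end_mem
  simp only at e1 e2
  have h1 := (hA.cov (D.x + D.steps.length)).1 ⟨by omega, le_rfl⟩
  refine ⟨by omega, h1.2, fun hlt => ?_⟩
  by_contra hl
  have h2 := h1.1.succ (by
    rw [show D.x - 1 + 1 = D.x by ring]
    rcases hp.step (D.x + D.steps.length) (by omega) hlt with h | h <;> omega)
  have := (hA.cov _).2 ⟨h2, by omega⟩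
  omega

/-- The flipped arcs over x take each depth from 0 to c − 1 once, where c is their number; the flip
condition says that column x has exactly c boxes. -/
lemma ArcStrips.conf (hD : ArcStrips α β D) (hf : IsFlip N (height β) (height α)) :
    (flips N (height β) (height α)).image D ∈ Conf α β := by
  have hpβ := isPath_height β
  constructor
  · intro E hE
    obtain ⟨i, hi, rfl⟩ := Finset.mem_image.1 hE
    have hi' := mem_flips.1 hi
    refine ⟨?_, ?_⟩
    · rintro ⟨x, y⟩ hb
      obtain ⟨⟨h1, h2⟩, rfl⟩ := (hD.mem_iff hi).1 hb
      have hx : 0 < x := by have := h1.1; omega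
      rw [mem_skew_gap hx h2]
      have := hf x hx.le h2
      have := depth_lt_card hi h1
      omega
    · intro hl
      have := (hD.arc i hi).end_eq hpβ (by rw [hD.x_eq i hi]; omega)
      simp only [BallotStrip.vertex]
      by_contra hne
      have := this.2.2 (by omega)
      omega
  · rintro ⟨x, y⟩ hb
    obtain ⟨n, rfl⟩ := exists_gap hb
    have hs := mem_skew.1 hb
    have hg := (mem_skew_gap hs.1 hs.2.1 n).1 hb
    have hfx := hf x hs.1.le hs.2.1
    obtain ⟨k, hk, hkn⟩ := exists_mem_card_filter_lt _ n
      (show n < ((flips N (height β) (height α)).filter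
        (fun i => Cov (height β) i x)).card by omega)
    obtain ⟨hk1, hk2⟩ := Finset.mem_filter.1 hk
    rw [← depth_eq hk1 hk2] at hkn
    refine ⟨D k, ⟨Finset.mem_image_of_mem D hk1, ?_⟩, ?_⟩
    · exact (hD.mem_iff hk1).2 ⟨⟨hk2, hs.2.1⟩, by rw [hkn]⟩
    · rintro E ⟨hE, hbE⟩
      obtain ⟨i, hi, rfl⟩ := Finset.mem_image.1 hE
      obtain ⟨⟨h1, h2⟩, h3⟩ := (hD.mem_iff hi).1 hbE
      rw [depth_injOn hi hk1 h1 hk2 (by omega)]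

/-- Contact of the strip of i with the strip of k above it forces the arc of k to be the flipped arc
immediately enclosing that of i, with depth smaller by one. The strip of k then runs along the whole
upper side of the strip of i. -/
lemma ArcStrips.ruleII (hD : ArcStrips α β D) :
    RuleII N ((flips N (height β) (height α)).image D) := by
  have hpβ := isPath_height β
  intro E hE E' hE' hne hex
  obtain ⟨i, hi, rfl⟩ := Finset.mem_image.1 hE
  obtain ⟨k, hk, rfl⟩ := Finset.mem_image.1 hE'
  have hik : i ≠ k := fun h => hne (by rw [h])
  have hi' := mem_flips.1 hi
  have hk' := mem_flips.1 hk
  have hiu : height β (i + 1) = height β i + 1 := by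
    rcases hpβ.step i hi'.1.1 hi'.1.2 with h | h <;> omega
  have hku : height β (k + 1) = height β k + 1 := by
    rcases hpβ.step k hk'.1.1 hk'.1.2 with h | h <;> omega
  have hinj : ∀ x, Cov (height β) i x → Cov (height β) k x →
      depth N (height β) (height α) i ≠ depth N (height β) (height α) k :=
    fun x h1 h2 h => hik (depth_injOn hi hk h1 h2 h)
  have hnest : ∀ x, Cov (height β) i x → Cov (height β) k x →
      depth N (height β) (height α) k < depth N (height β) (height α) i →
      Cov (height β) k i := by
    intro x h1 h2 h3
    rcases lt_trichotomy i k with hlt | hlt | hlt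
    · have := depth_lt_depth hi (h1.mono hlt h2.1.le)
      omega
    · exact absurd hlt hik
    · exact h2.mono hlt h1.1.le
  have key : Cov (height β) k i ∧
      depth N (height β) (height α) k + 1 = depth N (height β) (height α) i := by
    obtain ⟨⟨x, y⟩, hb, b', hb', hab⟩ := hex
    obtain ⟨⟨h1, h2⟩, h3⟩ := (hD.mem_iff hi).1 hb
    have hx0 : 0 < x := by have := h1.1; omega
    simp only [above, Set.mem_insert_iff, Set.mem_singleton_iff] at hab
    rcases hab with rfl | rfl | rfl
    · obtain ⟨⟨h4, h5⟩, h6⟩ := (hD.mem_iff hk).1 hb'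
      exact ⟨hnest x h1 h4 (by omega), by omega⟩
    · obtain ⟨⟨h4, h5⟩, h6⟩ := (hD.mem_iff hk).1 hb'
      by_cases hxi : x - 1 = i
      · rw [hxi] at h4 h6
        have hx : x = i + 1 := by omega
        subst hx
        exact ⟨h4, by omega⟩
      · have h7 : Cov (height β) i (x - 1) := h1.mono (by have := h1.1; omega) (by omega)
        have hst := hpβ.step (x - 1) (by omega) (by omega)
        rw [show x - 1 + 1 = x by ring] at hst
        have hd : depth N (height β) (height α) k + 1 = depth N (height β) (height α) i := by
          have := hinj _ h7 h4
          omega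
        exact ⟨hnest _ h7 h4 (by omega), hd⟩
    · obtain ⟨⟨h4, h5⟩, h6⟩ := (hD.mem_iff hk).1 hb'
      have hst := hpβ.step x (by omega) (by omega)
      by_cases h7 : Cov (height β) i (x + 1)
      · have hd : depth N (height β) (height α) k + 1 = depth N (height β) (height α) i := by
          have := hinj _ h7 h4
          omega
        exact ⟨hnest _ h7 h4 (by omega), hd⟩
      -- The arc of i ends at x while that of k goes on. As the path steps down after x, it does not
      -- open k there, so both arcs cover x.
      · have h8 : height β (x + 1) < height β (i + 1) := by
          by_contra hc
          exact h7 (h1.succ (by omega))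
        have h9 := h1.2 x h1.1 le_rfl
        have hkx : k ≠ x := by
          rintro rfl
          omega
        have h10 : Cov (height β) k x := h4.mono (by have := h4.1; omega) (by omega)
        exact ⟨hnest _ h1 h10 (by omega), by omega⟩
  obtain ⟨hc, hd⟩ := key
  have hci : height β (k + 1) ≤ height β i := hc.2 i hc.1 le_rfl
  rintro ⟨x, y⟩ hb b' hab hN
  obtain ⟨⟨h1, h2⟩, h3⟩ := (hD.mem_iff hi).1 hb
  have hx0 : 0 < x := by have := h1.1; omega
  have hkx := hc.trans hi'.2.1 h1
  simp only [above, Set.mem_insert_iff, Set.mem_singleton_iff] at hab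
  rcases hab with rfl | rfl | rfl
  · exact Or.inr ((hD.mem_iff hk).2 ⟨⟨hkx, h2⟩, by omega⟩)
  · have hst := hpβ.step (x - 1) (by omega) (by omega)
    rw [show x - 1 + 1 = x by ring] at hst
    by_cases hxi : x - 1 = i
    · have hx : x = i + 1 := by omega
      right
      rw [hD.mem_iff hk, hxi]
      subst hx
      exact ⟨⟨hc, by omega⟩, by omega⟩
    · have h7 : Cov (height β) i (x - 1) := h1.mono (by have := h1.1; omega) (by omega)
      rcases hst with h | h
      · exact Or.inr ((hD.mem_iff hk).2 ⟨⟨hc.trans hi'.2.1 h7, by omega⟩, by omega⟩)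
      · exact Or.inl ((hD.mem_iff hi).2 ⟨⟨h7, by omega⟩, by omega⟩)
  · simp only at hN
    have hst := hpβ.step x (by omega) (by omega)
    by_cases h7 : Cov (height β) i (x + 1)
    · rcases hst with h | h
      · exact Or.inl ((hD.mem_iff hi).2 ⟨⟨h7, by omega⟩, by omega⟩)
      · exact Or.inr ((hD.mem_iff hk).2 ⟨⟨hc.trans hi'.2.1 h7, by omega⟩, by omega⟩)
    · have h8 : height β (x + 1) < height β (i + 1) := by
        by_contra hc
        exact h7 (h1.succ (by omega))
      have h9 := h1.2 x h1.1 le_rfl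
      exact Or.inr ((hD.mem_iff hk).2 ⟨⟨hkx.succ (by omega), by omega⟩, by omega⟩)

end Exists

/-! ## Weights of fillings -/

lemma countP_word_sAct (p : Fin N → Bool) (i : Fin N) (α : BString N) (h : Raises i α) :
    (word (sAct i α)).countP p = (word α).countP p + if p i then 1 else 0 := by
  have e : ∀ l : List (Fin N), (l.map fun i => Multiplicative.ofAdd (if p i then 1 else 0)).prod =
      Multiplicative.ofAdd (l.countP p) := by
    intro l
    induction l with
    | nil => rfl
    | cons a l ih => rw [List.map_cons, List.prod_cons, ih, ← ofAdd_add, List.countP_cons, add_comm]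
  have := wordImage_sAct (fun i : Fin N => Multiplicative.ofAdd (if p i then 1 else 0))
    (fun _ _ _ => mul_comm _ _) i α h
  rw [wordImage, wordImage, e, e, ← ofAdd_add] at this
  have := Multiplicative.ofAdd.injective this
  omega

lemma height_allOnes {x : ℤ} (h0 : 0 ≤ x) (hN : x ≤ N) : height (allOnes N) x = -x := by
  obtain ⟨n, rfl⟩ := Int.eq_ofNat_of_zero_le h0
  induction n with
  | zero => simp [height_zero]
  | succ n ih =>
    have h1 := height_succ (allOnes N) ⟨n, by omega⟩
    have h2 := ih (by omega) (by omega)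
    simp only [allOnes, Bool.false_eq_true, if_false] at h1
    push_cast
    change height (allOnes N) _ = height (allOnes N) _ + -1 at h1
    rw [h1, h2]
    ring

/-- A raising step lifts the path by 2 at a single abscissa. Interior abscissae contribute to l',
and the abscissa N to l_N. -/
lemma two_len' (β : BString N) :
    2 * (len' β : ℤ) = ∑ x ∈ Finset.Ico 1 (N : ℤ), (height β x + x) := by
  induction β using raising_induction with
  | h0 =>
    rw [len', word_allOnes, Finset.sum_eq_zero]
    · simp
    · intro x hx
      have := Finset.mem_Ico.1 hx
      rw [height_allOnes (by omega) (by omega)]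
      ring
  | h1 i α h ih =>
    rw [len', countP_word_sAct _ i α h]
    rw [len'] at ih
    push_cast
    rw [mul_add, ih]
    by_cases hi : i.val + 1 < N
    · have hm : ((i.val : ℤ) + 1) ∈ Finset.Ico 1 (N : ℤ) := Finset.mem_Ico.2 ⟨by omega, by omega⟩
      rw [← Finset.add_sum_erase _ _ hm,
        ← Finset.add_sum_erase (a := (i.val : ℤ) + 1) (Finset.Ico 1 (N : ℤ)) _ hm,
        height_sAct_raises i α h, height_succ_raises i α h]
      have : ∑ x ∈ (Finset.Ico 1 (N : ℤ)).erase (i.val + 1), (height (sAct i α) x + x) =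
          ∑ x ∈ (Finset.Ico 1 (N : ℤ)).erase (i.val + 1), (height α x + x) := by
        refine Finset.sum_congr rfl fun x hx => ?_
        have h1 := Finset.mem_Ico.1 (Finset.mem_of_mem_erase hx)
        rw [height_sAct_of_ne i α (by omega) (by omega) (Finset.ne_of_mem_erase hx)]
      rw [this]
      simp only [hi, decide_true, if_true]
      ring
    · have : ∑ x ∈ (Finset.Ico 1 (N : ℤ)), (height (sAct i α) x + x) =
          ∑ x ∈ (Finset.Ico 1 (N : ℤ)), (height α x + x) := by
        refine Finset.sum_congr rfl fun x hx => ?_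
        have h1 := Finset.mem_Ico.1 hx
        rw [height_sAct_of_ne i α (by omega) (by omega) (by omega)]
      rw [this]
      simp [hi]

lemma two_lenN (β : BString N) : 2 * (lenN β : ℤ) = height β N + N := by
  induction β using raising_induction with
  | h0 =>
    rw [lenN, word_allOnes, height_allOnes (by omega) le_rfl]
    simp
  | h1 i α h ih =>
    rw [lenN, countP_word_sAct _ i α h]
    rw [lenN] at ih
    push_cast
    rw [mul_add, ih]
    by_cases hi : i.val + 1 = N
    · have e : (N : ℤ) = i.val + 1 := by omega
      have h1 := height_sAct_raises i α h
      have h2 := height_succ_raises i α h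
      rw [← e] at h1 h2
      simp only [hi, decide_true, if_true]
      push_cast
      omega
    · rw [height_sAct_of_ne i α (by omega) le_rfl (by omega)]
      simp [hi]

lemma mon_prod {ι : Type*} (s : Finset ι) (f g : ι → ℤ) :
    ∏ i ∈ s, mon (f i) (g i) = mon (∑ i ∈ s, f i) (∑ i ∈ s, g i) := by
  induction s using Finset.induction_on with
  | empty => simp [mon_zero]
  | insert a s ha ih => rw [Finset.prod_insert ha, Finset.sum_insert ha, Finset.sum_insert ha, ih,
      mon_mul]

/-- The number of columns before the last one covered by an arc. -/
def innerColumns (N : ℕ) (h : ℤ → ℤ) (i : ℤ) : ℕ :=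
  ((Finset.Ico 1 (N : ℤ)).filter (fun x => Cov h i x)).card

/-- Double counting: the differences of lengths, computed column by column, are redistributed over
the arcs covering the columns. -/
lemma normFactor_eq {α β : BString N} (hf : IsFlip N (height β) (height α)) :
    normFactor α β = ∏ i ∈ flips N (height β) (height α),
      mon (-(innerColumns N (height β) i : ℤ)) (-(if Cov (height β) i N then 1 else 0)) := by
  rw [mon_prod, normFactor]
  congr 1
  · have h1 := two_len' α
    have h2 := two_len' β
    have h3 : ∑ x ∈ Finset.Ico 1 (N : ℤ), (height α x + x) =
        ∑ x ∈ Finset.Ico 1 (N : ℤ), (height β x + x) -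
          2 * ∑ x ∈ Finset.Ico 1 (N : ℤ),
            (((flips N (height β) (height α)).filter (fun i => Cov (height β) i x)).card : ℤ) := by
      rw [Finset.mul_sum, ← Finset.sum_sub_distrib]
      refine Finset.sum_congr rfl fun x hx => ?_
      have := Finset.mem_Ico.1 hx
      rw [hf x (by omega) (by omega)]
      ring
    have h4 : ∑ i ∈ flips N (height β) (height α), -(innerColumns N (height β) i : ℤ) =
        -∑ x ∈ Finset.Ico 1 (N : ℤ),
            (((flips N (height β) (height α)).filter (fun i => Cov (height β) i x)).card : ℤ) := by
      rw [Finset.sum_neg_distrib, neg_inj]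
      unfold innerColumns
      simp only [Finset.card_filter]
      push_cast
      exact Finset.sum_comm
    omega
  · have h1 := two_lenN α
    have h2 := two_lenN β
    have h3 := hf N (by omega) le_rfl
    have h4 : ∑ i ∈ flips N (height β) (height α),
        -(if Cov (height β) i N then (1 : ℤ) else 0) =
        -(((flips N (height β) (height α)).filter (fun i => Cov (height β) i N)).card : ℤ) := by
      rw [Finset.sum_neg_distrib, neg_inj, Finset.card_filter]
      push_cast
      rfl
    omega

/-- A strip ending before N has excess 0 and 2l + 1 columns, which leaves t⁻¹. A strip reaching N
has 2l + l' columns before N and one at N, which leaves t_N⁻¹ for even l' and t⁻¹t_N for odd l'. -/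
lemma normalized_wt {h : ℤ → ℤ} (hp : IsPath N h) {n : ℕ} {D : BallotStrip}
    (hA : IsArcStrip N h n D) {i : ℤ} (hi : 0 ≤ i) (hx : D.x = i + 1) :
    mon (-(innerColumns N h i : ℤ)) (-(if Cov h i N then 1 else 0)) * D.wt (-1) =
      arcWeight N h i := by
  obtain ⟨h1, h2, h3⟩ := hA.end_eq hp (by omega)
  have hcov := hA.cov
  have hlen := D.length_eq
  rw [hx, show i + 1 - 1 = i by ring] at hcov
  rw [hx] at h1 h2 h3
  by_cases hN : i + 1 + (D.steps.length : ℤ) < N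
  · have hl := h3 hN
    have hnc : ¬ Cov h i N := fun hc => by
      have := (hcov N).2 ⟨hc, le_rfl⟩
      omega
    have hin : innerColumns N h i = D.steps.length + 1 := by
      rw [innerColumns]
      have : (Finset.Ico 1 (N : ℤ)).filter (fun x => Cov h i x) =
          Finset.Icc (i + 1) (i + 1 + D.steps.length) := by
        ext x
        rw [Finset.mem_filter, Finset.mem_Ico, Finset.mem_Icc, hcov]
        constructor
        · rintro ⟨h5, h6⟩; exact ⟨h6, by omega⟩
        · rintro ⟨h5, h6⟩
          have := (hcov x).2 ⟨h5, h6⟩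
          exact ⟨⟨by omega, by omega⟩, h5⟩
      rw [this, Int.card_Icc]
      omega
    rw [arcWeight, if_neg hnc, if_neg hnc, hin, BallotStrip.wt, if_pos (by rw [hl]; simp), mon_mul]
    congr 1
    push_cast
    omega
  · have hN : i + 1 + (D.steps.length : ℤ) = N := by omega
    have hc : Cov h i N := ((hcov N).1 ⟨by omega, by omega⟩).1
    have hin : innerColumns N h i = D.steps.length := by
      rw [innerColumns]
      have : (Finset.Ico 1 (N : ℤ)).filter (fun x => Cov h i x) = Finset.Ico (i + 1) N := by
        ext x
        rw [Finset.mem_filter, Finset.mem_Ico, Finset.mem_Ico]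
        constructor
        · rintro ⟨h5, h6⟩
          have := (hcov x).2 ⟨h6, by omega⟩
          omega
        · rintro ⟨h5, h6⟩
          exact ⟨⟨by omega, by omega⟩, ((hcov x).1 ⟨by omega, by omega⟩).1⟩
      rw [this, Int.card_Ico]
      omega
    rw [hN] at h1
    have hev : Even (h N - h (i + 1)) ↔ Even D.l' := by
      rw [← h1, Int.even_coe_nat]
    rw [arcWeight, if_pos hc, if_pos hc, hin, BallotStrip.wt]
    simp only [hev]
    by_cases he : Even D.l'
    · rw [if_pos he, if_pos he, mon_mul]
      congr 1
      omega
    · rw [if_neg he, if_neg he]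
      have : -((-1 : ℤ) • mon (2 * (D.l : ℤ) + D.l' - 1) 2) = mon (2 * (D.l : ℤ) + D.l' - 1) 2 := by
        rw [neg_smul, one_smul, neg_neg]
      rw [this, mon_mul]
      congr 1
      omega

/-- The generating function of fillings satisfying Rule II is a monomial or zero. -/
lemma normFactor_mul_QII (α β : BString N) :
    normFactor α β * QII α β = if StrLE α β then flipCoeff α β else 0 := by
  rw [QII]
  by_cases hle : StrLE α β
  swap
  · rw [if_neg hle, if_neg hle, mul_zero]
  rw [if_pos hle, if_pos hle, flipCoeff_eq]
  by_cases hf : IsFlip N (height β) (height α)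
  · obtain ⟨D, hD⟩ := exists_arcStrips α β
    have hmem : (flips N (height β) (height α)).image D ∈ ConfII α β := ⟨hD.conf hf, hD.ruleII⟩
    have hset : ConfII α β = {(flips N (height β) (height α)).image D} :=
      Set.eq_singleton_iff_unique_mem.2 ⟨hmem, fun C hC =>
        Finset.Subset.antisymm (confII_subset hC hmem) (confII_subset hmem hC)⟩
    rw [if_pos hf, hset, finsum_mem_singleton, Finset.prod_image hD.inj, normFactor_eq hf,
      ← Finset.prod_mul_distrib]
    refine Finset.prod_congr rfl fun i hi => ?_
    exact normalized_wt (isPath_height β) (hD.arc i hi) (mem_flips.1 hi).1.1 (hD.x_eq i hi)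
  · have hset : ConfII α β = ∅ := by
      rw [Set.eq_empty_iff_forall_notMem]
      intro C hC
      exact hf (isFlip_of_confII (fun x h0 hN => height_le_of_StrLE hle x h0 hN) hC)
    rw [if_neg hf, hset, finsum_mem_empty, mul_zero]

end KLB

namespace KLB

variable {N : ℕ}

/-! ## Pairings and arcs -/

lemma exists_right_end {h : ℤ → ℤ} {k x : ℤ} (hkx : k < x) (hc : ¬ Cov h k x) :
    ∃ b, k < b ∧ b + 1 ≤ x ∧ Cov h k b ∧ h (b + 1) < h (k + 1) := by
  obtain ⟨e, ⟨he1, he2⟩, he3⟩ := Int.exists_greatest_of_bdd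
    (P := fun y => Cov h k y ∧ y ≤ x) ⟨x, fun z hz => hz.2⟩ ⟨k + 1, Cov.self h k, by omega⟩
  have hex : e + 1 ≤ x := by
    by_contra hex
    have : e = x := by omega
    exact hc (this ▸ he1)
  refine ⟨e, he1.1, hex, he1, ?_⟩
  by_contra hlt
  have := he3 (e + 1) ⟨he1.succ (by omega), hex⟩
  omega

/-- The partner of the down step at k starts at the last earlier abscissa whose height does not
exceed h(k + 1). -/
lemma exists_left_end {h : ℤ → ℤ} (hp : IsPath N h) {a₀ k : ℤ} (h0 : 0 ≤ a₀) (hk : k < N)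
    (h1 : a₀ < k) (hd : h (k + 1) < h k) (h2 : h a₀ ≤ h (k + 1)) :
    ∃ a, a₀ ≤ a ∧ a < k ∧ h a < h (a + 1) ∧ Cov h a k ∧ h (k + 1) < h (a + 1) := by
  obtain ⟨a, ⟨ha1, ha2, ha3⟩, ha4⟩ := Int.exists_greatest_of_bdd
    (P := fun y => a₀ ≤ y ∧ y < k ∧ h y ≤ h (k + 1)) ⟨k, fun z hz => hz.2.1.le⟩
    ⟨a₀, le_rfl, h1, h2⟩
  have key : ∀ y, a < y → y ≤ k → h (k + 1) < h y := by
    intro y hy hy'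
    by_cases hyk : y = k
    · rw [hyk]; exact hd
    · by_contra hc
      have := ha4 y ⟨by omega, by omega, by omega⟩
      omega
  have h3 := key (a + 1) (by omega) (by omega)
  have h4 := hp.step a (by omega) (by omega)
  exact ⟨a, ha1, ha2, by omega, ⟨ha2, fun y hy hy' => by have := key y hy hy'; omega⟩, h3⟩

lemma height_up {β : BString N} {k : Fin N} (h : β k = true) :
    height β (k.val + 1) = height β k.val + 1 := by rw [height_succ, h, if_pos rfl]

lemma height_down {β : BString N} {k : Fin N} (h : β k = false) :
    height β (k.val + 1) = height β k.val - 1 := by rw [height_succ, h]; rfl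

/-- Inner letters are paired among themselves. Scanning from the left, the path never drops below
its height after i; scanning from the right, it never lies below its height before j. So the step at
j is the first one to go below the arc. -/
lemma Paired.cov {β : BString N} {i j : Fin N} (h : Paired β i j) :
    β i = true ∧ β j = false ∧ Cov (height β) i.val j.val ∧
      height β (j.val + 1) < height β (i.val + 1) := by
  induction h with
  | mk i j p hij hi hj hp _ _ ih2 ih1 =>
    have hij' : i.val < j.val := hij
    have left : ∀ n : ℕ, ∀ y : ℕ, y ≤ i.val + 1 + n → i.val < y → y ≤ j.val →
        height β (i.val + 1) ≤ height β y := by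
      intro n
      induction n with
      | zero =>
        intro y h1 h2 h3
        have : y = i.val + 1 := by omega
        subst this
        push_cast
        exact le_rfl
      | succ n ih =>
        intro y h1 h2 h3
        by_cases hy : y ≤ i.val + 1 + n
        · exact ih y hy h2 h3
        obtain ⟨k, rfl⟩ : ∃ k, y = k + 1 := ⟨i.val + 1 + n, by omega⟩
        have hk := ih k (by omega) (by omega) (by omega)
        have hkN : k < N := by omega
        push_cast
        cases hb : β ⟨k, hkN⟩
        · have hp' := hp ⟨k, hkN⟩ (by simp [Fin.lt_def]; omega) (by simp [Fin.lt_def]; omega)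
          obtain ⟨e1, -, e2, e3⟩ := ih1 ⟨k, hkN⟩ (by simp [Fin.lt_def]; omega)
            (by simp [Fin.lt_def]; omega) hb
          have e4 := height_up e1
          have e5 := height_down hb
          have e6 := e2.2 k (by have := e2.1; simpa using this) le_rfl
          have e7 := e2.1
          simp only [Fin.lt_def] at e3 e5 e7 hp'
          have e8 := ih (p ⟨k, hkN⟩).val (by omega) (by omega) (by omega)
          omega
        · have := height_up hb
          simp only at this
          omega
    have right : ∀ n : ℕ, ∀ y : ℕ, j.val ≤ y + n → i.val < y → y ≤ j.val →
        height β j.val ≤ height β y := by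
      intro n
      induction n with
      | zero =>
        intro y h1 h2 h3
        have : y = j.val := by omega
        subst this
        exact le_rfl
      | succ n ih =>
        intro y h1 h2 h3
        by_cases hy : j.val ≤ y + n
        · exact ih y hy h2 h3
        have hk := ih (y + 1) (by omega) (by omega) (by omega)
        have hkN : y < N := by omega
        push_cast at hk
        cases hb : β ⟨y, hkN⟩
        · have := height_down hb
          simp only at this
          omega
        · have hp' := hp ⟨y, hkN⟩ (by simp [Fin.lt_def]; omega) (by simp [Fin.lt_def]; omega)
          obtain ⟨-, e1, e2, e3⟩ := ih2 ⟨y, hkN⟩ (by simp [Fin.lt_def]; omega)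
            (by simp [Fin.lt_def]; omega) hb
          have e4 := height_up hb
          have e7 := e2.1
          simp only [Fin.lt_def] at e3 e4 e7 hp'
          have e8 := ih ((p ⟨y, hkN⟩).val + 1) (by omega) (by omega) (by omega)
          push_cast at e8
          omega
    refine ⟨hi, hj, ⟨by omega, fun y h1 h2 => ?_⟩, ?_⟩
    · obtain ⟨n, rfl⟩ := Int.eq_ofNat_of_zero_le (show 0 ≤ y by omega)
      exact left n n (by omega) (by omega) (by omega)
    · have := right j.val (i.val + 1) (by omega) (by omega) (by omega)
      push_cast at this
      have := height_down hj
      omega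

/-- Strong induction on the distance: the partner of each inner letter is found by `exists_left_end`
or `exists_right_end`, and the covering condition keeps it strictly inside. -/
lemma paired_of_cov {β : BString N} (i j : Fin N) (hi : β i = true)
    (hc : Cov (height β) i.val j.val) (hd : height β (j.val + 1) < height β (i.val + 1)) :
    Paired β i j := by
  have hpβ := isPath_height β
  induction hn : j.val - i.val using Nat.strong_induction_on generalizing i j with
  | _ n ih =>
  have hij : i.val < j.val := by have := hc.1; omega
  have hj : β j = false := by
    rw [← height_down_iff]
    have := hc.2 j.val hc.1 le_rfl
    omega
  have hui := height_up hi
  have hdj := height_down hj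
  have hpart : ∀ k : Fin N, i < k → k < j → ∃ q : Fin N, (i < q ∧ q < j) ∧
      (β k = true → Paired β k q) ∧ (β k = false → Paired β q k) := by
    intro k hik hkj
    rw [Fin.lt_def] at hik hkj
    have hck := hc.2 k.val (by omega) (by omega)
    have hck' := hc.2 (k.val + 1) (by omega) (by omega)
    cases hb : β k
    · have hdk := height_down hb
      obtain ⟨a, ha1, ha2, ha3, ha4, ha5⟩ := exists_left_end hpβ (a₀ := i.val) (k := k.val)
        (by omega) (by omega) (by omega) (by omega) (by omega)
      have hai : a ≠ i.val := by
        rintro rfl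
        omega
      obtain ⟨q, rfl⟩ := Int.eq_ofNat_of_zero_le (show 0 ≤ a by omega)
      have hq : β ⟨q, by omega⟩ = true := (height_up_iff β ⟨q, by omega⟩).1 ha3
      refine ⟨⟨q, by omega⟩, ⟨by simp only [Fin.lt_def]; omega, by simp only [Fin.lt_def]; omega⟩,
        by simp, fun _ => ?_⟩
      exact ih _ (by simp only; omega) ⟨q, by omega⟩ k hq ha4 ha5 rfl
    · have huk := height_up hb
      obtain ⟨b, hb1, hb2, hb3, hb4⟩ := exists_right_end (h := height β) (k := k.val)
        (x := j.val + 1) (by omega) (fun hc' => by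
          have := hc'.2 (j.val + 1) (by omega) le_rfl
          omega)
      obtain ⟨q, rfl⟩ := Int.eq_ofNat_of_zero_le (show 0 ≤ b by omega)
      have hqj : q ≠ j.val := by
        rintro rfl
        have := hb3.2 _ hb3.1 le_rfl
        omega
      refine ⟨⟨q, by omega⟩, ⟨by simp only [Fin.lt_def]; omega, by simp only [Fin.lt_def]; omega⟩,
        fun _ => ?_, by simp⟩
      exact ih _ (by simp only; omega) k ⟨q, by omega⟩ hb hb3 hb4 rfl
  choose! p hp using hpart
  exact Paired.mk i j p hij hi hj (fun k h1 h2 => (hp k h1 h2).1)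
    (fun k h1 h2 => (hp k h1 h2).2.1) (fun k h1 h2 => (hp k h1 h2).2.2)

lemma Paired.right_unique {β : BString N} {i j j' : Fin N} (h : Paired β i j)
    (h' : Paired β i j') : j = j' := by
  obtain ⟨-, -, h1, h2⟩ := h.cov
  obtain ⟨-, -, h3, h4⟩ := h'.cov
  rcases lt_trichotomy j j' with hlt | hlt | hlt
  · rw [Fin.lt_def] at hlt
    have := h3.2 (j.val + 1) (by have := h1.1; omega) (by omega)
    omega
  · exact hlt
  · rw [Fin.lt_def] at hlt
    have := h1.2 (j'.val + 1) (by have := h3.1; omega) (by omega)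
    omega

lemma exists_paired_of_not_cov {β : BString N} {i : Fin N} (hi : β i = true)
    (hc : ¬ Cov (height β) i.val N) : ∃ j, Paired β i j := by
  obtain ⟨b, hb1, hb2, hb3, hb4⟩ := exists_right_end (h := height β) (k := i.val)
    (x := N) (by omega) hc
  obtain ⟨q, rfl⟩ := Int.eq_ofNat_of_zero_le (show 0 ≤ b by omega)
  exact ⟨⟨q, by omega⟩, paired_of_cov i ⟨q, by omega⟩ hi hb3 hb4⟩

lemma mem_unpairedTwos {β : BString N} {i : Fin N} :
    i ∈ unpairedTwos β ↔ β i = true ∧ Cov (height β) i.val N := by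
  simp only [unpairedTwos, Finset.mem_filter, Finset.mem_univ, true_and]
  constructor
  · rintro ⟨h1, h2⟩
    refine ⟨h2, ?_⟩
    by_contra hc
    obtain ⟨j, hj⟩ := exists_paired_of_not_cov h2 hc
    exact (h1 j).1 hj
  · rintro ⟨h1, h2⟩
    refine ⟨fun j => ⟨fun hj => ?_, fun hj => ?_⟩, h1⟩
    · obtain ⟨-, -, h3, h4⟩ := hj.cov
      have := h2.2 (j.val + 1) (by have := h3.1; omega) (by omega)
      omega
    · have := hj.cov.2.1
      rw [h1] at this
      exact absurd this (by simp)

lemma openArcs_sorted {h : ℤ → ℤ} (hp : IsPath N h) (k : ℕ) (hk : k ≤ N) :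
    (openArcs h k).Pairwise (· > ·) := by
  induction k with
  | zero => exact List.Pairwise.nil
  | succ k ih =>
    rw [openArcs]
    split_ifs
    · refine List.pairwise_cons.2 ⟨fun i hi => ?_, ih (by omega)⟩
      exact ((mem_openArcs hp k (by omega) _).1 hi).2.2.1
    · exact (ih (by omega)).tail

/-- The rank of an unpaired `2` from the right in terms of heights. -/
lemma rankFromRight_eq {β : BString N} {i : Fin N} (hi : β i = true)
    (hc : Cov (height β) i.val N) :
    (rankFromRight β i : ℤ) = height β N - height β (i.val + 1) + 1 := by
  have hp := isPath_height β
  have hmem : (i.val : ℤ) ∈ openArcs (height β) N :=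
    (mem_openArcs hp N le_rfl _).2 ⟨by omega, (height_up_iff β i).2 hi, hc⟩
  obtain ⟨l₁, l₂, e⟩ := List.append_of_mem hmem
  have hlen := openArcs_index hp N le_rfl l₁ l₂ _ e
  have hs := openArcs_sorted hp N le_rfl
  have hnd := openArcs_nodup hp N le_rfl
  have hm := mem_openArcs hp N le_rfl
  rw [e] at hs hnd hm
  rw [List.pairwise_append, List.pairwise_cons] at hs
  have hnd1 : (l₁ ++ [(i.val : ℤ)]).Nodup := hnd.sublist (by simp)
  -- The unpaired 2's from i on are the entries of the final stack down to and including i, since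
  -- the stack is decreasing.
  have hcard : rankFromRight β i = (l₁ ++ [(i.val : ℤ)]).toFinset.card := by
    rw [rankFromRight]
    refine Finset.card_bij (fun k _ => (k.val : ℤ)) ?_ ?_ ?_
    · intro k hk
      obtain ⟨h1, h2⟩ := Finset.mem_filter.1 hk
      obtain ⟨h3, h4⟩ := mem_unpairedTwos.1 h1
      have h5 := (hm k.val).2 ⟨by omega, (height_up_iff β k).2 h3, h4⟩
      simp only [List.mem_append, List.mem_cons, List.mem_toFinset, List.not_mem_nil,
        or_false] at h5 ⊢
      rcases h5 with h5 | h5 | h5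
      · exact Or.inl h5
      · exact Or.inr h5
      · have := hs.2.1.1 _ h5
        rw [Fin.le_def] at h2
        omega
    · intro k _ k' _ h
      exact Fin.ext (by simpa using h)
    · intro b hb
      simp only [List.mem_append, List.mem_toFinset, List.mem_singleton] at hb
      obtain ⟨h1, h2, h3⟩ := (hm b).1 (by simp; tauto)
      have hbi : (i.val : ℤ) ≤ b := by
        rcases hb with hb | hb
        · exact (hs.2.2 b hb _ (by simp)).le
        · exact hb.ge
      obtain ⟨q, rfl⟩ := Int.eq_ofNat_of_zero_le h1
      have hqN : q < N := by have := h3.1; omega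
      exact ⟨⟨q, hqN⟩, Finset.mem_filter.2 ⟨mem_unpairedTwos.2
        ⟨(height_up_iff β ⟨q, hqN⟩).1 h2, h3⟩, by rw [Fin.le_def]; simp only; omega⟩, rfl⟩
  rw [hcard, List.toFinset_card_of_nodup hnd1, List.length_append, List.length_singleton]
  push_cast
  omega

lemma flag_height (α : BString N) (k : Fin N) : flag (height α) k.val = !(α k) := by
  rw [flag, Bool.eq_iff_iff, decide_eq_true_iff, height_down_iff]
  simp

/-- Induction along the stack of open arcs. A down step on an empty stack is an unpaired 1, which
stays fixed; otherwise it closes the top arc, and the two ends of a pair are flipped together. -/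
lemma isFlip_of_mem_FA {α β : BString N} (h : α ∈ FA β) : IsFlip N (height β) (height α) := by
  obtain ⟨-, hpair, hun⟩ := h
  have hp := isPath_height β
  intro x h0 hx
  obtain ⟨n, rfl⟩ := Int.eq_ofNat_of_zero_le h0
  rw [card_openArcs_flips hp _ n (by omega)]
  clear h0
  induction n with
  | zero => simp [openArcs, height_zero]
  | succ k ih =>
    have hkN : k < N := by omega
    have ih := ih (by omega)
    have hα := height_succ α ⟨k, hkN⟩
    simp only at hα
    push_cast
    rw [openArcs]
    cases hb : β ⟨k, hkN⟩
    · have hβ := height_down hb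
      simp only at hβ
      rw [if_neg (by omega)]
      cases hl : openArcs (height β) k with
      | nil =>
        have : α ⟨k, hkN⟩ = false := by
          refine hun _ (fun j => ⟨fun hj => ?_, fun hj => ?_⟩) hb
          · have := hj.cov.1
            rw [hb] at this
            exact absurd this (by simp)
          · obtain ⟨h1, -, h2, -⟩ := hj.cov
            have := (mem_openArcs hp k hkN.le j.val).2 ⟨by omega, (height_up_iff β j).2 h1, h2⟩
            rw [hl] at this
            exact absurd this (by simp)
        rw [hl] at ih
        simp only [List.countP_nil, List.tail_nil] at ih ⊢
        rw [hα, hβ, ih, this]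
        simp
        ring
      | cons a l =>
        obtain ⟨h1, h2, h3⟩ := (mem_openArcs hp k hkN.le a).1 (by rw [hl]; simp)
        have hidx := openArcs_index hp k hkN.le [] l a hl
        obtain ⟨q, rfl⟩ := Int.eq_ofNat_of_zero_le h1
        have hqN : q < N := by have := h3.1; omega
        have hq : β ⟨q, hqN⟩ = true := (height_up_iff β ⟨q, hqN⟩).1 h2
        have hpd : Paired β ⟨q, hqN⟩ ⟨k, hkN⟩ := by
          refine paired_of_cov _ _ hq h3 ?_
          simp only [List.length_nil] at hidx ⊢
          push_cast at hidx
          omega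
        have hfl : flag (height α) q = α ⟨k, hkN⟩ := by
          have e := flag_height α ⟨q, hqN⟩
          simp only at e
          rw [e]
          rcases hpair _ _ hpd with ⟨e1, e2⟩ | ⟨e1, e2⟩ <;> rw [e1, e2] <;> simp
        rw [hl, List.countP_cons, hfl] at ih
        rw [List.tail_cons, hα, hβ, ih]
        cases α ⟨k, hkN⟩ <;> simp <;> ring
    · have hβ := height_up hb
      simp only at hβ
      have hfl : flag (height α) k = !(α ⟨k, hkN⟩) := flag_height α ⟨k, hkN⟩
      rw [if_pos (by omega), List.countP_cons, hfl, hα, hβ, ih]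
      cases α ⟨k, hkN⟩ <;> simp <;> ring

/-! ### Counting flipped pairs and flipped unpaired letters -/

lemma mem_flips_val {α β : BString N} {i : Fin N} :
    (i.val : ℤ) ∈ flips N (height β) (height α) ↔ β i = true ∧ α i = false := by
  rw [mem_flips, height_up_iff, height_down_iff]
  constructor
  · exact fun h => h.2
  · exact fun h => ⟨⟨by omega, by omega⟩, h⟩

lemma exists_fin_of_mem_flips {h g : ℤ → ℤ} {b : ℤ} (hb : b ∈ flips N h g) :
    ∃ i : Fin N, (i.val : ℤ) = b := by
  obtain ⟨h1, -⟩ := mem_flips.1 hb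
  obtain ⟨q, rfl⟩ := Int.eq_ofNat_of_zero_le h1.1
  exact ⟨⟨q, by omega⟩, rfl⟩

lemma dPairs_eq {α β : BString N} (h : α ∈ FA β) : dPairs α β =
    ((flips N (height β) (height α)).filter (fun i => ¬ Cov (height β) i N)).card := by
  refine Finset.card_bij (fun q _ => (q.1.val : ℤ)) ?_ ?_ ?_
  · rintro ⟨i, j⟩ hq
    obtain ⟨-, h1, h2, h3⟩ := Finset.mem_filter.1 hq
    obtain ⟨h4, -, h5, h6⟩ := h1.cov
    refine Finset.mem_filter.2 ⟨mem_flips_val.2 ⟨h4, h2⟩, fun hc => ?_⟩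
    have := hc.2 (j.val + 1) (by have := h5.1; simp only at this ⊢; omega) (by omega)
    simp only at this h6
    omega
  · rintro ⟨i, j⟩ hq ⟨i', j'⟩ hq' e
    obtain ⟨-, h1, -⟩ := Finset.mem_filter.1 hq
    obtain ⟨-, h2, -⟩ := Finset.mem_filter.1 hq'
    have e : i = i' := Fin.ext (by simpa using e)
    subst e
    have e2 : j = j' := h1.right_unique h2
    rw [e2]
  · intro b hb
    obtain ⟨h1, h2⟩ := Finset.mem_filter.1 hb
    obtain ⟨i, rfl⟩ := exists_fin_of_mem_flips h1
    obtain ⟨h3, h4⟩ := mem_flips_val.1 h1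
    obtain ⟨j, hj⟩ := exists_paired_of_not_cov h3 h2
    refine ⟨(i, j), Finset.mem_filter.2 ⟨Finset.mem_univ _, hj, h4, ?_⟩, rfl⟩
    rcases h.2.1 i j hj with ⟨e, -⟩ | ⟨-, e⟩
    · rw [h4] at e
      exact absurd e (by simp)
    · exact e

/-- Both parities are treated at once. The rank exceeds the height difference by one, so odd ranks
will correspond to even differences. -/
lemma card_unpaired_filter (α β : BString N) (P : ℕ → Prop) (Q : ℤ → Prop)
    (hPQ : ∀ i : Fin N, β i = true → Cov (height β) i.val N →
      (P (rankFromRight β i) ↔ Q (height β N - height β (i.val + 1)))) :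
    (((unpairedTwos β).filter (fun i => P (rankFromRight β i))).filter
      (fun i => α i = false)).card =
    ((flips N (height β) (height α)).filter
      (fun i => Cov (height β) i N ∧ Q (height β N - height β (i + 1)))).card := by
  refine Finset.card_bij (fun k _ => (k.val : ℤ)) ?_ ?_ ?_
  · intro i hi
    simp only [Finset.mem_filter, mem_unpairedTwos] at hi
    obtain ⟨⟨⟨h1, h2⟩, h3⟩, h4⟩ := hi
    exact Finset.mem_filter.2 ⟨mem_flips_val.2 ⟨h1, h4⟩, h2, (hPQ i h1 h2).1 h3⟩
  · intro k _ k' _ h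
    exact Fin.ext (by simpa using h)
  · intro b hb
    obtain ⟨h1, h2, h5⟩ := Finset.mem_filter.1 hb
    obtain ⟨i, rfl⟩ := exists_fin_of_mem_flips h1
    obtain ⟨h3, h4⟩ := mem_flips_val.1 h1
    refine ⟨i, ?_, rfl⟩
    simp only [Finset.mem_filter, mem_unpairedTwos]
    exact ⟨⟨⟨h3, h2⟩, (hPQ i h3 h2).2 h5⟩, h4⟩

lemma dO_eq (α β : BString N) : dO α β = ((flips N (height β) (height α)).filter
    (fun i => Cov (height β) i N ∧ Even (height β N - height β (i + 1)))).card := by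
  have key := card_unpaired_filter α β (fun n => Odd n) (fun z => Even z) fun i h1 h2 => by
    have := rankFromRight_eq h1 h2
    rw [← Int.odd_coe_nat, this, ← Int.not_even_iff_odd, Int.even_add_one, not_not]
  rw [dO, oUnpaired]
  convert key

lemma dE_eq (α β : BString N) : dE α β = ((flips N (height β) (height α)).filter
    (fun i => Cov (height β) i N ∧ ¬ Even (height β N - height β (i + 1)))).card := by
  have key := card_unpaired_filter α β (fun n => Even n) (fun z => ¬ Even z) fun i h1 h2 => by
    have := rankFromRight_eq h1 h2
    rw [← Int.even_coe_nat, this, Int.even_add_one]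
  rw [dE, eUnpaired]
  convert key

/-- The value of the coefficients on `F^A(β)`. -/
lemma flipCoeff_of_mem_FA {α β : BString N} (h : α ∈ FA β) : flipCoeff α β =
    mon (-(dPairs α β : ℤ)) 0 * mon 0 (-(dO α β : ℤ)) * mon (-(dE α β : ℤ)) (dE α β : ℤ) := by
  -- With exponents written as sums of indicators, the product over arcs becomes a count of each
  -- kind of arc.
  have hw : ∀ i, arcWeight N (height β) i =
      mon (-(if ¬ Cov (height β) i N then 1 else 0) -
          (if Cov (height β) i N ∧ ¬ Even (height β N - height β (i + 1)) then 1 else 0))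
        (-(if Cov (height β) i N ∧ Even (height β N - height β (i + 1)) then 1 else 0) +
          (if Cov (height β) i N ∧ ¬ Even (height β N - height β (i + 1)) then 1 else 0)) := by
    intro i
    rw [arcWeight]
    by_cases h1 : Cov (height β) i N <;>
      by_cases h2 : Even (height β N - height β (i + 1)) <;> simp [h1, h2]
  rw [flipCoeff_eq, if_pos (isFlip_of_mem_FA h), dPairs_eq h, dO_eq, dE_eq, mon_mul, mon_mul]
  simp only [hw]
  rw [mon_prod]
  simp only [Finset.card_filter, Finset.sum_sub_distrib, Finset.sum_add_distrib,
    Finset.sum_neg_distrib]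
  push_cast
  congr 1 <;> ring

end KLB

namespace KLB

variable {N : ℕ}

/-! ## The Kazhdan--Lusztig basis -/

/-- A subword of full length is the whole word and would give the same string by `strAct_minRep`. -/
lemma word_length_lt_of_StrLE {α β : BString N} (h : StrLE α β) (hne : α ≠ β) :
    (word α).length < (word β).length := by
  obtain ⟨ω, h1, h2, ω', hs, h3⟩ := h
  have e1 : (word β).length = ω.length := by rw [← length_minRep, ← h2, h1.eq]
  have e2 : (word α).length ≤ ω'.length := by
    rw [← length_minRep, ← h3]
    exact (cox N).length_wordProd_le ω'
  rcases hs.length_le.lt_or_eq with h | h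
  · omega
  · rw [hs.eq_of_length h, h2] at h3
    exact absurd (by rw [← strAct_minRep α, ← strAct_minRep β, h3]) hne

lemma word_length_lt_of_flipCoeff {α β : BString N} (h : flipCoeff α β ≠ 0) (hne : α ≠ β) :
    (word α).length < (word β).length :=
  word_length_lt_of_StrLE (StrLE_of_flipCoeff_ne_zero h) hne

lemma flips_self (h : ℤ → ℤ) : flips N h h = ∅ := by
  refine Finset.filter_eq_empty_iff.2 fun i _ hc => ?_
  exact lt_asymm hc.1 hc.2

lemma flipCoeff_self (β : BString N) : flipCoeff β β = 1 := by
  rw [flipCoeff_eq, flips_self, Finset.prod_empty, if_pos]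
  intro x _ _
  rw [flips_self]
  simp

lemma arcWeight_eq_mon (h : ℤ → ℤ) (i : ℤ) :
    ∃ g ∈ GammaNeg, arcWeight N h i = mon g.1 g.2 := by
  rw [arcWeight]
  split_ifs
  · exact ⟨(0, -1), Or.inr ⟨rfl, by norm_num⟩, rfl⟩
  · exact ⟨(-1, 1), Or.inl (by norm_num), rfl⟩
  · exact ⟨(-1, 0), Or.inl (by norm_num), rfl⟩

lemma GammaNeg_add {g g' : ℤ × ℤ} (h : g ∈ GammaNeg) (h' : g' ∈ GammaNeg) :
    g + g' ∈ GammaNeg := by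
  simp only [GammaNeg, Set.mem_ofPred_eq, Prod.fst_add, Prod.snd_add] at *
  omega

lemma prod_arcWeight (h : ℤ → ℤ) {s : Finset ℤ} (hs : s.Nonempty) :
    ∃ g ∈ GammaNeg, ∏ i ∈ s, arcWeight N h i = mon g.1 g.2 := by
  induction hs using Finset.Nonempty.cons_induction with
  | singleton a =>
    rw [Finset.prod_singleton]
    exact arcWeight_eq_mon h a
  | cons a s ha hs ih =>
    obtain ⟨g, hg, e⟩ := ih
    obtain ⟨g', hg', e'⟩ := arcWeight_eq_mon (N := N) h a
    exact ⟨g' + g, GammaNeg_add hg' hg, by rw [Finset.prod_cons, e, e', mon_mul]; rfl⟩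

lemma mon_mem_ZGammaNeg {g : ℤ × ℤ} (hg : g ∈ GammaNeg) : mon g.1 g.2 ∈ ZGammaNeg := by
  intro g'
  simp only [mon, AddMonoidAlgebra.coeff_single, Finsupp.single_apply]
  split_ifs with h
  · exact ⟨⟨1, by simp⟩, fun _ => h ▸ hg⟩
  · exact ⟨⟨0, by simp⟩, fun h => absurd rfl h⟩

lemma zero_mem_ZGammaNeg : (0 : Coeff) ∈ ZGammaNeg :=
  fun _ => ⟨⟨0, by simp⟩, fun h => absurd rfl h⟩

/-- Distinct strings differ by at least one flipped arc, and every arc weight is a negative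
monomial. For t⁻¹t_N this uses that the exponent of t takes precedence. -/
lemma flipCoeff_mem_ZGammaNeg {α β : BString N} (hne : α ≠ β) : flipCoeff α β ∈ ZGammaNeg := by
  rw [flipCoeff_eq]
  split_ifs with hf
  · have hs : (flips N (height β) (height α)).Nonempty := by
      by_contra hc
      rw [Finset.not_nonempty_iff_eq_empty] at hc
      refine hne (funext fun k => ?_)
      have h1 := hf k.val (by omega) (by omega)
      have h2 := hf (k.val + 1) (by omega) (by omega)
      rw [hc] at h1 h2
      simp only [Finset.filter_empty, Finset.card_empty, Nat.cast_zero, mul_zero,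
        sub_zero] at h1 h2
      rw [Bool.eq_iff_iff, ← height_up_iff, ← height_up_iff, h1, h2]
    obtain ⟨g, hg, e⟩ := prod_arcWeight (N := N) (height β) hs
    rw [e]
    exact mon_mem_ZGammaNeg hg
  · exact zero_mem_ZGammaNeg

lemma barCoeff_coeff (f : Coeff) (g : ℤ × ℤ) : (barCoeff f).coeff g = f.coeff (-g) := by
  induction f using AddMonoidAlgebra.induction_linear with
  | zero => simp
  | add f f' hf hf' =>
    rw [map_add, AddMonoidAlgebra.coeff_add, Finsupp.add_apply, hf, hf',
      AddMonoidAlgebra.coeff_add, Finsupp.add_apply]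
  | single a b =>
    have : barCoeff (AddMonoidAlgebra.single a b) = AddMonoidAlgebra.single (-a) b := by
      simp [barCoeff, AddMonoidAlgebra.mapDomain_single]
    rw [this, AddMonoidAlgebra.coeff_single, AddMonoidAlgebra.coeff_single, Finsupp.single_apply,
      Finsupp.single_apply]
    simp only [neg_eq_iff_eq_neg]

/-- A bar-invariant combination of negative monomials vanishes. -/
lemma eq_zero_of_bar {f : Coeff} (hb : barCoeff f = f) (hn : ∀ g, f.coeff g ≠ 0 → g ∈ GammaNeg) :
    f = 0 := by
  rw [← AddMonoidAlgebra.coeff_eq_zero]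
  ext g
  by_contra hg
  have h1 := hn g hg
  have h2 := hn (-g) (by rw [← barCoeff_coeff, hb]; exact hg)
  simp only [GammaNeg, Set.mem_ofPred_eq, Prod.fst_neg, Prod.snd_neg] at h1 h2
  omega

/-- The linear map sending `m_β` to `∑ flipCoeff α β m_α`. -/
def flipMap (N : ℕ) : Module.End Coeff (Mod N) := Finsupp.linearCombination Coeff flipVec

lemma flipMap_m (β : BString N) : flipMap N (m β) = flipVec β := by
  simp [flipMap, m]

lemma flipMap_eq_sum (e : Mod N) : flipMap N e = ∑ γ, e γ • flipVec γ := by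
  rw [flipMap, Finsupp.linearCombination_apply, Finsupp.sum_fintype]
  intro γ
  exact zero_smul _ _

lemma flipVec_eq_sum (β : BString N) : flipVec β = ∑ α, flipCoeff α β • m α := by
  ext1 γ
  rw [Finsupp.finsetSum_apply]
  simp only [Finsupp.smul_apply, m_apply, smul_eq_mul, mul_ite, mul_one, mul_zero]
  rw [Finset.sum_ite_eq' Finset.univ γ, if_pos (Finset.mem_univ _), flipVec_apply]

/-- The matrix is unitriangular with respect to the length of words. -/
lemma flipMap_surjective : Function.Surjective (flipMap N) := by
  have key : ∀ β : BString N, m β ∈ LinearMap.range (flipMap N) := by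
    intro β
    induction hn : (word β).length using Nat.strong_induction_on generalizing β with
    | _ n ih =>
    have h1 : flipVec β = m β + ∑ α ∈ Finset.univ.erase β, flipCoeff α β • m α := by
      rw [flipVec_eq_sum, ← Finset.add_sum_erase _ _ (Finset.mem_univ β), flipCoeff_self, one_smul]
    have h2 : m β = flipMap N (m β) - ∑ α ∈ Finset.univ.erase β, flipCoeff α β • m α := by
      rw [flipMap_m, h1, add_sub_cancel_right]
    rw [h2]
    refine Submodule.sub_mem _ (LinearMap.mem_range_self _ _) (Submodule.sum_mem _ fun α hα => ?_)
    by_cases h0 : flipCoeff α β = 0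
    · rw [h0, zero_smul]; exact Submodule.zero_mem _
    · refine Submodule.smul_mem _ _ (ih _ ?_ α rfl)
      rw [← hn]
      exact word_length_lt_of_flipCoeff h0 (Finset.ne_of_mem_erase hα)
  rw [← LinearMap.range_eq_top, eq_top_iff]
  intro x _
  induction x using Finsupp.induction_linear with
  | zero => exact Submodule.zero_mem _
  | add x y hx hy => exact Submodule.add_mem _ (hx trivial) (hy trivial)
  | single α c =>
    have e : (Finsupp.single α c : Mod N) = c • m α := by simp [m]
    rw [e]
    exact Submodule.smul_mem _ _ (key α)

/-- A surjective endomorphism of a finitely generated module over a commutative ring is injective,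
so no inverse matrix is needed. -/
lemma flipMap_bijective : Function.Bijective (flipMap N) :=
  ⟨OrzechProperty.injective_of_surjective_endomorphism _ flipMap_surjective, flipMap_surjective⟩

/-- The basis of the vectors `∑ flipCoeff α β m_α`. -/
def flipBasis (N : ℕ) : Module.Basis (BString N) Coeff (Mod N) :=
  Finsupp.basisSingleOne.map (LinearEquiv.ofBijective (flipMap N) flipMap_bijective)

lemma flipBasis_apply (β : BString N) : flipBasis N β = flipVec β := by
  rw [flipBasis, Module.Basis.map_apply, LinearEquiv.ofBijective_apply,
    Finsupp.coe_basisSingleOne, ← flipMap_m]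
  rfl

/-! ### Uniqueness of the Kazhdan–Lusztig polynomials -/

/-- A bar-invariant vector with negative coefficients vanishes. -/
lemma eq_zero_of_barMod {x : Mod N} (hb : barMod x = x)
    (hn : ∀ α g, (x α).coeff g ≠ 0 → g ∈ GammaNeg) : x = 0 := by
  obtain ⟨e, rfl⟩ := flipMap_surjective x
  -- Since the vectors `flipVec γ` are bar-invariant, bar invariance of the combination passes to
  -- its coordinates.
  have hbe : ∀ γ, barCoeff (e γ) = e γ := by
    have h1 : flipMap N (Finsupp.equivFunOnFinite.symm fun γ => barCoeff (e γ)) = flipMap N e := by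
      rw [← hb, flipMap_eq_sum, flipMap_eq_sum, barMod_sum]
      refine Finset.sum_congr rfl fun γ _ => ?_
      rw [barMod_smul, barMod_flipVec]
      rfl
    exact fun γ => DFunLike.congr_fun (flipMap_bijective.1 h1) γ
  suffices e = 0 by rw [this, map_zero]
  by_contra he
  -- At an index of maximal length, triangularity makes the coefficient of m_γ equal to e γ, which
  -- is then both bar-invariant and negative.
  obtain ⟨γ, hγ, hmax⟩ := Finset.exists_max_image e.support (fun γ => (word γ).length)
    (Finsupp.support_nonempty_iff.2 he)
  have hval : flipMap N e γ = e γ := by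
    rw [flipMap_eq_sum, Finsupp.finsetSum_apply, Finset.sum_eq_single γ]
    · rw [Finsupp.smul_apply, flipVec_apply, flipCoeff_self, smul_eq_mul, mul_one]
    · intro δ _ hδ
      rw [Finsupp.smul_apply, flipVec_apply, smul_eq_mul]
      by_contra h0
      have h1 : e δ ≠ 0 := left_ne_zero_of_mul h0
      have h2 := word_length_lt_of_flipCoeff (right_ne_zero_of_mul h0) hδ.symm
      have h3 := hmax δ (Finsupp.mem_support_iff.2 h1)
      omega
    · exact fun h => absurd (Finset.mem_univ _) h
  exact Finsupp.mem_support_iff.1 hγ (eq_zero_of_bar (hbe γ) fun g hg => hn γ g (by rwa [hval]))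

lemma normFactor_mul_normFactor (α β : BString N) : normFactor α β * normFactor β α = 1 := by
  rw [normFactor, normFactor, mon_mul, ← mon_zero]
  congr 1 <;> ring

lemma normFactor_self (β : BString N) : normFactor β β = 1 := by
  rw [normFactor, sub_self, sub_self, mon_zero]

/-- The normalised coefficients of the monomial basis. -/
def flipPoly (α β : BString N) : Coeff := normFactor β α * flipCoeff α β

lemma normFactor_mul_flipPoly (α β : BString N) :
    normFactor α β * flipPoly α β = flipCoeff α β := by
  rw [flipPoly, ← mul_assoc, normFactor_mul_normFactor, one_mul]

lemma flipCoeff_eq_zero {α β : BString N} (h : ¬ StrLE α β) : flipCoeff α β = 0 := by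
  by_contra hc
  exact h (StrLE_of_flipCoeff_ne_zero hc)

lemma isKLPolynomials_flipPoly : IsKLPolynomials (flipPoly (N := N)) := by
  refine ⟨flipBasis N, ?_, ?_, ?_, ?_, ?_⟩
  · intro β
    rw [flipBasis_apply, barMod_flipVec]
  · intro β
    rw [flipBasis_apply, flipVec_eq_sum]
    simp only [normFactor_mul_flipPoly]
    symm
    refine Finset.sum_subset (Finset.filter_subset _ _) fun α _ hα => ?_
    rw [flipCoeff_eq_zero (fun h => hα (Finset.mem_filter.2 ⟨Finset.mem_univ _, h⟩)), zero_smul]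
  · intro β
    rw [flipPoly, normFactor_self, flipCoeff_self, one_mul]
  · intro α β _ hne
    rw [normFactor_mul_flipPoly]
    exact flipCoeff_mem_ZGammaNeg hne
  · intro α β h
    rw [flipPoly, flipCoeff_eq_zero h, mul_zero]

/-- The difference between a Kazhdan–Lusztig vector and `flipVec β` is bar-invariant, and its
coefficients are negative because the two diagonal terms 1 cancel; so it vanishes. -/
lemma IsKLPolynomials.normFactor_mul {P : BString N → BString N → Coeff} (hP : IsKLPolynomials P)
    (α β : BString N) : normFactor α β * P α β = flipCoeff α β := by
  obtain ⟨C, hC⟩ := hP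
  have hcoef : ∀ α, C β α = normFactor α β * P α β := by
    intro α
    rw [hC.expansion β, Finsupp.finsetSum_apply]
    simp only [Finsupp.smul_apply, m_apply, smul_eq_mul, mul_ite, mul_one, mul_zero]
    rw [Finset.sum_ite_eq' _ α]
    by_cases h : StrLE α β
    · simp [h]
    · simp [h, hC.support α β h]
  have hzero : C β - flipVec β = 0 := by
    refine eq_zero_of_barMod ?_ fun γ g hg => ?_
    · rw [sub_eq_add_neg, barMod_add, barMod_neg, hC.bar_invariant, barMod_flipVec]
    · rw [Finsupp.sub_apply, hcoef, flipVec_apply] at hg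
      by_cases hγ : γ = β
      · subst hγ
        rw [normFactor_self, hC.diag, flipCoeff_self] at hg
        simp at hg
      by_cases hle : StrLE γ β
      · have h1 := hC.negative γ β hle hγ g
        have h2 := flipCoeff_mem_ZGammaNeg hγ g
        by_contra hgn
        have h3 : (normFactor γ β * P γ β).coeff g = 0 := by
          by_contra h; exact hgn (h1.2 h)
        have h4 : (flipCoeff γ β).coeff g = 0 := by
          by_contra h; exact hgn (h2.2 h)
        apply hg
        rw [AddMonoidAlgebra.coeff_sub, Finsupp.sub_apply, h3, h4, sub_zero]
      · rw [hC.support γ β hle, flipCoeff_eq_zero hle] at hg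
        simp at hg
  rw [← hcoef, sub_eq_zero.1 hzero, flipVec_apply]

lemma IsKLPolynomials.eq_flipPoly {P : BString N → BString N → Coeff} (hP : IsKLPolynomials P) :
    P = flipPoly := by
  funext α β
  rw [flipPoly, ← hP.normFactor_mul, ← mul_assoc, normFactor_mul_normFactor, one_mul]

end KLB

end

theorem mainTheorem5 (N : ℕ) :
    (∃! P : KLB.BString N → KLB.BString N → KLB.Coeff, KLB.IsKLPolynomials P) ∧
    ∀ P : KLB.BString N → KLB.BString N → KLB.Coeff, KLB.IsKLPolynomials P →
      ∀ α β : KLB.BString N,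
        KLB.normFactor α β * KLB.QII α β = KLB.normFactor α β * P α β ∧
        (α ∈ KLB.FA β →
          KLB.normFactor α β * P α β =
            KLB.mon (-(KLB.dPairs α β : ℤ)) 0 * KLB.mon 0 (-(KLB.dO α β : ℤ)) *
              KLB.mon (-(KLB.dE α β : ℤ)) (KLB.dE α β : ℤ)) := by
  refine ⟨⟨KLB.flipPoly, KLB.isKLPolynomials_flipPoly, fun P hP => hP.eq_flipPoly⟩,
    fun P hP α β => ⟨?_, fun h => ?_⟩⟩
  -- Both sides are `flipCoeff α β`, which vanishes when α is not below β.
  · rw [KLB.normFactor_mul_QII, hP.normFactor_mul]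
    split_ifs with h
    · rfl
    · exact (KLB.flipCoeff_eq_zero h).symm
  · rw [hP.normFactor_mul, KLB.flipCoeff_of_mem_FA h]
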